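/- **Setting.** For $j\in\mathbb N_0=\{0,1,2,\dots\}$ let $(X_j,\mathcal G_j,m_j)$ be probability spaces with notions of variation $\mathrm{var}_j\colon L^1(X_j,m_j)\to[0,\infty]$ (real-valued functions). Put $\mathcal B_j=\{\varphi\in L^1(m_j):\mathrm{var}_j(\varphi)<\infty\}$ and $\|\varphi\|_{\mathcal B_j}=\|\varphi\|_{L^1(m_j)}+\mathrm{var}_j(\varphi)$. Assume, for all $j$: $\mathrm{var}_j(t\varphi)=|t|\,\mathrm{var}_j(\varphi)$ for $t\in\mathbb R$; $\mathrm{var}_j(\varphi+\psi)\le\mathrm{var}_j(\varphi)+\mathrm{var}_j(\psi)$; $\mathrm{var}_j(1)<\infty$; $\mathcal B_j$ is complete, and dense in $L^1(m_j)$; and, with a constant $C$ independent of $j$, $\|\varphi\|_{L^\infty(m_j)}\le C\|\varphi\|_{\mathcal B_j}$ for $\varphi \in L^1(m_j)$ and $\mathrm{var}_j(\varphi\psi)\le C(\|\varphi\|_{\infty}\mathrm{var}_j(\psi)+\|\psi\|_\infty\mathrm{var}_j(\varphi))$ for $\varphi,\psi\in\mathcal B_j$. Let $T_j\colon X_j\to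 X_{j+1}$ be measurable with $(T_j)_*m_j\ll m_{j+1}$ and $\sup_j\sup_{\mathrm{var}_{j+1}(h)\le1}\mathrm{var}_j(h\circ T_j)<\infty$. Let $\mathcal L_j\colon L^1(m_j)\to L^1(m_{j+1})$ be the transfer operator: $\int(\mathcal L_j\varphi)\psi\,dm_{j+1}=\int\varphi\,(\psi\circ T_j)\,dm_j$ for $\varphi\in L^1(m_j)$, $\psi\in L^\infty(m_{j+1})$. Put $T_j^{(n)}=T_{j+n-1}\circ\dots\circ T_j$ and $\mathcal L_j^{(n)}=\mathcal L_{j+n-1}\circ\dots\circ\mathcal L_j$, with $T_j^{(0)}=\mathrm{id}$. The sequence $(\mathcal L_j)$ is *admissible* if * there is $K>0$ with $\|\mathcal L_j\varphi\|_{\mathcal B_{j+1}}\le K\|\varphi\|_{\mathcal B_j}$ for all $j$ and $\varphi\in\mathcal B_j$; * there are $N\ge1$, $\alpha\in(0,1)$, $\beta>0$ with $\|\mathcal L_j^{(N)}\varphi\|_{\mathcal B_{j+N}}\le\alpha\|\varphi\|_{\mathcal B_j}+\beta\|\varphi\|_{L^1(m_j)}$ for all $j$ and $\varphi\in\mathcal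 B_j$; * for each $a>0$ there are $c>0$ and $n_0$ such that $\operatorname{ess\,inf}\mathcal L_j^{(n)}\varphi\ge c\|\varphi\|_{L^1(m_j)}$ for all $j$, all $n\ge n_0$ and all $\varphi\in\mathcal B_j$ with $\varphi\ge0$ and $\mathrm{var}_j(\varphi)\le a\int\varphi\,dm_j$. **Theorem.** Let $(\mathcal L_j)$ be admissible, let $F_j\in\mathcal B_j$ with $\sup_j\|F_j\|_{\mathcal B_j}<\infty$, and let $H_j\colon X_j\to\mathbb R$ be measurable with $F_j=H_{j+1}\circ T_j-H_j$ ($m_j$-a.e.) for all $j\in\mathbb N_0$. Then there are functions $U_j,\mathcal M_j\colon X_j\to\mathbb R$ such that for all $j\in\mathbb N_0$ $$F_j=\int_{X_0}F_j\circ T_0^{(j)}\,dm_0+U_{j+1}\circ T_j-U_j+\mathcal M_j\qquad m_j\text{-a.e.},$$ and the following hold. 1. $U_j,\mathcal M_j\in\mathcal B_j$, $\sup_j\|U_j\|_{\mathcal B_j}<\infty$, $\sup_j\|\mathcal M_j\|_{\mathcal B_j}<\infty$ and $\int_{X_0}U_j\circ T_0^{(j)}\,dm_0=0$ for all $j$.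 2. $\mathbb E_{m_0}[\mathcal M_j\circ T_0^{(j)}\mid(T_0^{(j+1)})^{-1}\mathcal G_{j+1}]=0$ for all $j$, and $\sum_{j\ge0}\mathcal M_j\circ T_0^{(j)}$ converges $m_0$-a.s. and in $L^p(m_0)$ for every $1\le p<\infty$. 3. For every $1\le p<\infty$, $\int_{X_0}|H_n\circ T_0^{(n)}|^p\,dm_0<\infty$ for all $n$, and, with $q_n=\int_{X_0}H_n\circ T_0^{(n)}\,dm_0$, $\sup_n\int_{X_0}|H_n\circ T_0^{(n)}-q_n|^p\,dm_0<\infty$. For every $n$, the series $\sum_{k\ge n}\mathcal M_k\circ T_n^{(k-n)}$ converges $m_n$-a.e. and $$H_n=q_n+U_n-\sum_{k=n}^\infty\mathcal M_k\circ T_n^{(k-n)}\qquad m_n\text{-a.e.}$$ In particular $(H_n-U_n)\circ T_0^{(n)}-q_n\to0$ as $n\to\infty$, $m_0$-a.e. and in $L^p(m_0)$ for every $1\le p<\infty$. -/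

import Mathlib

open MeasureTheory Filter Topology
open scoped ENNReal NNReal

noncomputable section

namespace SeqLivsic

/-- The transfer operator of `T : (X, μ) → (Y, ν)` applied to `φ ∈ L¹(μ)`: the density with respect
to `ν` of the push-forward under `T` of the signed measure `φ dμ`. See `transfer_duality` for the
duality relation that characterizes it. -/
def transfer {X Y : Type*} [MeasurableSpace X] [MeasurableSpace Y]
    (μ : Measure X) (ν : Measure Y) (T : X → Y) (φ : X → ℝ) (y : Y) : ℝ :=
  (((μ.withDensity fun x => ENNReal.ofReal (φ x)).map T).rnDeriv ν y).toReal -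
    (((μ.withDensity fun x => ENNReal.ofReal (-φ x)).map T).rnDeriv ν y).toReal

theorem transfer_integrable {X Y : Type*} [MeasurableSpace X] [MeasurableSpace Y]
    {μ : Measure X} {ν : Measure Y} [IsProbabilityMeasure μ] [IsProbabilityMeasure ν]
    {T : X → Y} {φ : X → ℝ} (hφ : Integrable φ μ) :
    Integrable (transfer μ ν T φ) ν := by
  have : IsFiniteMeasure (μ.withDensity fun x => ENNReal.ofReal (φ x)) :=
    isFiniteMeasure_withDensity_ofReal hφ.2
  have : IsFiniteMeasure (μ.withDensity fun x => ENNReal.ofReal (-φ x)) :=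
    isFiniteMeasure_withDensity_ofReal hφ.neg.2
  exact Measure.integrable_toReal_rnDeriv.sub Measure.integrable_toReal_rnDeriv

/-- The duality relation `∫ (𝓛 φ) ψ dν = ∫ φ (ψ ∘ T) dμ` for `φ ∈ L¹(μ)`, `ψ ∈ L^∞(ν)`. -/
theorem transfer_duality {X Y : Type*} [MeasurableSpace X] [MeasurableSpace Y]
    {μ : Measure X} {ν : Measure Y} [IsProbabilityMeasure μ] [IsProbabilityMeasure ν]
    {T : X → Y} (hT : Measure.QuasiMeasurePreserving T μ ν)
    {φ : X → ℝ} (hφ : Integrable φ μ) {ψ : Y → ℝ} (hψ : MemLp ψ ∞ ν) :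
    ∫ y, transfer μ ν T φ y * ψ y ∂ν = ∫ x, φ x * ψ (T x) ∂μ := by
  have key : ∀ f : X → ℝ, Integrable f μ →
      Integrable (fun y => (((μ.withDensity fun x => ENNReal.ofReal (f x)).map T).rnDeriv ν
        y).toReal * ψ y) ν ∧
      ∫ y, (((μ.withDensity fun x => ENNReal.ofReal (f x)).map T).rnDeriv ν y).toReal * ψ y ∂ν
        = ∫ x, max (f x) 0 * ψ (T x) ∂μ := by
    intro f hf
    have : IsFiniteMeasure (μ.withDensity fun x => ENNReal.ofReal (f x)) :=
      isFiniteMeasure_withDensity_ofReal hf.2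
    have hac : (μ.withDensity fun x => ENNReal.ofReal (f x)).map T ≪ ν :=
      ((withDensity_absolutelyContinuous μ _).map hT.measurable).trans hT.absolutelyContinuous
    constructor
    · exact Integrable.mul_of_top_left Measure.integrable_toReal_rnDeriv hψ
    · have h1 := integral_rnDeriv_smul (f := ψ) hac
      simp only [smul_eq_mul] at h1
      rw [h1, integral_map hT.measurable.aemeasurable (hψ.1.mono_ac hac),
        integral_withDensity_eq_integral_toReal_smul₀ hf.1.aemeasurable.ennreal_ofReal
          (Eventually.of_forall fun _ => ENNReal.ofReal_lt_top)]
      simp [ENNReal.toReal_ofReal']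
  obtain ⟨i1, e1⟩ := key φ hφ
  obtain ⟨i2, e2⟩ := key (fun x => -φ x) hφ.neg
  have hψT : MemLp (ψ ∘ T) ∞ μ := by
    refine ⟨hψ.1.comp_quasiMeasurePreserving hT, lt_of_le_of_lt ?_ hψ.2⟩
    rw [eLpNorm_exponent_top, eLpNorm_exponent_top]
    refine essSup_le_of_ae_le _ ?_
    exact hT.ae (ae_le_eLpNormEssSup (f := ψ) (μ := ν))
  have j1 : Integrable (fun x => max (φ x) 0 * ψ (T x)) μ :=
    Integrable.mul_of_top_left hφ.pos_part hψT
  have j2 : Integrable (fun x => max (-φ x) 0 * ψ (T x)) μ :=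
    Integrable.mul_of_top_left hφ.neg_part hψT
  simp only [transfer, sub_mul]
  rw [integral_sub i1 i2, e1, e2, ← integral_sub j1 j2]
  congr 1
  ext x
  rcases le_total 0 (φ x) with h | h
  · simp [h]
  · simp [h]

/-- For `j ≤ k`, the composition `T_{k-1} ∘ ⋯ ∘ T_{j+1} ∘ T_j : X_j → X_k` (the identity if
`j = k`), that is, `T_j^{(k-j)}`. -/
def orbit {X : ℕ → Type*} (T : ∀ j, X j → X (j + 1)) {j k : ℕ} (h : j ≤ k) : X j → X k :=
  Nat.leRecOn h (fun {i} => T i)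

/-- For `j ≤ k`, the composition `𝓛_{k-1} ∘ ⋯ ∘ 𝓛_j` of transfer operators, that is,
`𝓛_j^{(k-j)}`. -/
def transferIter {X : ℕ → Type*} [∀ j, MeasurableSpace (X j)] (m : ∀ j, Measure (X j))
    (T : ∀ j, X j → X (j + 1)) {j k : ℕ} (h : j ≤ k) : (X j → ℝ) → (X k → ℝ) :=
  Nat.leRecOn (C := fun i => X i → ℝ) h (fun {i} φ => transfer (m i) (m (i + 1)) (T i) φ)

/-- The norm `‖φ‖_{L¹(μ)} + var φ`, with values in `[0, ∞]`. -/
def bNorm {X : Type*} [MeasurableSpace X] (μ : Measure X) (var : (X → ℝ) → ℝ≥0∞)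
    (φ : X → ℝ) : ℝ≥0∞ :=
  eLpNorm φ 1 μ + var φ

/-- Membership in the space `𝓑` of functions in `L¹(μ)` with finite variation. -/
def MemB {X : Type*} [MeasurableSpace X] (μ : Measure X) (var : (X → ℝ) → ℝ≥0∞)
    (φ : X → ℝ) : Prop :=
  Integrable φ μ ∧ var φ < ∞

/-- `var j : L¹(X_j, m_j) → [0, ∞]` is a sequence of notions of variation. Elements of `L¹` are
represented by integrable functions, and `var j` respects equality almost everywhere; its values at
non-integrable functions play no role. -/
structure IsVariation {X : ℕ → Type*} [∀ j, MeasurableSpace (X j)] (m : ∀ j, Measure (X j))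
    (var : ∀ j, (X j → ℝ) → ℝ≥0∞) : Prop where
  congr_ae : ∀ j (f g : X j → ℝ), Integrable f (m j) → f =ᵐ[m j] g → var j f = var j g
  smul : ∀ j (t : ℝ) (f : X j → ℝ), Integrable f (m j) →
    var j (fun x => t * f x) = ENNReal.ofReal |t| * var j f
  add_le : ∀ j (f g : X j → ℝ), Integrable f (m j) → Integrable g (m j) →
    var j (fun x => f x + g x) ≤ var j f + var j g
  /-- The supremum norm is controlled by the norm of `𝓑_j`, uniformly in `j`. -/
  sup_le : ∃ C : ℝ≥0, ∀ j (f : X j → ℝ), Integrable f (m j) →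
    eLpNorm f ∞ (m j) ≤ C * bNorm (m j) (var j) f
  one_lt_top : ∀ j, var j (fun _ => 1) < ∞
  /-- `𝓑_j` is dense in `L¹(m_j)`. -/
  dense : ∀ j (f : X j → ℝ), Integrable f (m j) → ∀ ε : ℝ≥0, 0 < ε →
    ∃ g : X j → ℝ, MemB (m j) (var j) g ∧ eLpNorm (fun x => f x - g x) 1 (m j) ≤ ε
  mul_le : ∃ C : ℝ≥0, ∀ j (f g : X j → ℝ), MemB (m j) (var j) f → MemB (m j) (var j) g →
    var j (fun x => f x * g x) ≤
      C * (eLpNorm f ∞ (m j) * var j g + eLpNorm g ∞ (m j) * var j f)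
  /-- `𝓑_j` is a Banach space. -/
  complete : ∀ j (u : ℕ → X j → ℝ), (∀ n, MemB (m j) (var j) (u n)) →
    (∀ ε : ℝ≥0, 0 < ε → ∃ N : ℕ, ∀ a b, N ≤ a → N ≤ b →
      bNorm (m j) (var j) (fun x => u a x - u b x) ≤ ε) →
    ∃ g : X j → ℝ, MemB (m j) (var j) g ∧
      Tendsto (fun n => bNorm (m j) (var j) (fun x => u n x - g x)) atTop (𝓝 0)

/-- The sequence of transfer operators of the maps `T_j : (X_j, m_j) → (X_{j+1}, m_{j+1})` is
admissible. -/
structure IsAdmissible {X : ℕ → Type*} [∀ j, MeasurableSpace (X j)] (m : ∀ j, Measure (X j))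
    (var : ∀ j, (X j → ℝ) → ℝ≥0∞) (T : ∀ j, X j → X (j + 1)) : Prop where
  bounded : ∃ K : ℝ≥0, 0 < K ∧ ∀ j (φ : X j → ℝ), MemB (m j) (var j) φ →
    bNorm (m (j + 1)) (var (j + 1)) (transfer (m j) (m (j + 1)) (T j) φ) ≤
      K * bNorm (m j) (var j) φ
  lasotaYorke : ∃ (N : ℕ) (α β : ℝ≥0), 1 ≤ N ∧ 0 < α ∧ α < 1 ∧ 0 < β ∧
    ∀ j (φ : X j → ℝ), MemB (m j) (var j) φ →
      bNorm (m (j + N)) (var (j + N)) (transferIter m T (Nat.le_add_right j N) φ) ≤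
        α * bNorm (m j) (var j) φ + β * eLpNorm φ 1 (m j)
  /-- For all `φ ≥ 0` in `𝓑_j` with `var_j φ ≤ a ∫ φ dm_j`, one has
  `ess inf 𝓛_j^{(n)} φ ≥ c ‖φ‖_{L¹}` as soon as `n ≥ n₀`. -/
  covering : ∀ a : ℝ, 0 < a → ∃ (c : ℝ) (n₀ : ℕ), 0 < c ∧
    ∀ (j n : ℕ), n₀ ≤ n → ∀ φ : X j → ℝ, MemB (m j) (var j) φ → 0 ≤ᵐ[m j] φ →
      var j φ ≤ ENNReal.ofReal (a * ∫ x, φ x ∂(m j)) →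
      ∀ᵐ y ∂(m (j + n)),
        c * ∫ x, |φ x| ∂(m j) ≤ transferIter m T (Nat.le_add_right j n) φ y

end SeqLivsic

end

open SeqLivsic

/-!
Covering and the Lasota–Yorke inequality make the iterates of `𝓛` contract on mean-zero functions,
measured by domination by the density `d_j` of the law of `T_0^{(j)}` together with the norm of
`𝓑_j`. With `f_j = F_j - ∫ F_j ∘ T_0^{(j)} dm_0`, the solution of
`W_{k+1} = 𝓛_k (W_k + d_k f_k)`, `W_0 = 0`, is therefore bounded in `𝓑`, and for large `j` so is
`U_j = W_j / d_j`, because covering bounds `d_j` below. Then `M_j = f_j - U_{j+1} ∘ T_j + U_j` gives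
bounded reverse martingale differences along the orbit, whose square function has a conditional
expectation that differs from its mean by a bounded amount.

If `F` is the coboundary of `H`, put `y = H - U`, suitably centered. The partial sums of the
martingale differences are `y_n ∘ T_0^{(n)} - y_0`, and `y_n ∘ T_0^{(n)}` is measurable with
respect to the `n`-th decreasing σ-algebra. If the variances of the partial sums were unbounded, a
second-moment argument would thus force the fixed function `y_0` to exceed every level with
probability bounded below. Hence the variances are bounded, the martingale converges almost surely
and in every `L^p`, and the limit of `y_n ∘ T_0^{(n)}` is constant by decay of correlations; this
is the formula for `H_n`.
-/

namespace SeqLivsic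

/-- A function that is bounded and measurable with respect to the σ-algebra `𝓜`. Integrals against
all such functions play the role of conditional expectations given `𝓜`. -/
def BddMeas {Ω : Type*} (𝓜 : MeasurableSpace Ω) (f : Ω → ℝ) : Prop :=
  Measurable[𝓜] f ∧ ∃ C, ∀ ω, |f ω| ≤ C

namespace BddMeas

variable {Ω : Type*} {𝓜 𝓜' : MeasurableSpace Ω} {f g : Ω → ℝ}

theorem mono (h : 𝓜 ≤ 𝓜') (hf : BddMeas 𝓜 f) : BddMeas 𝓜' f :=
  ⟨hf.1.mono h le_rfl, hf.2⟩

theorem const (c : ℝ) : BddMeas 𝓜 (fun _ => c) :=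
  ⟨measurable_const, |c|, fun _ => le_rfl⟩

theorem add (hf : BddMeas 𝓜 f) (hg : BddMeas 𝓜 g) : BddMeas 𝓜 (fun ω => f ω + g ω) := by
  obtain ⟨hfm, C, hC⟩ := hf
  obtain ⟨hgm, C', hC'⟩ := hg
  exact ⟨hfm.add hgm, C + C', fun ω => (abs_add_le _ _).trans (add_le_add (hC ω) (hC' ω))⟩

theorem mul (hf : BddMeas 𝓜 f) (hg : BddMeas 𝓜 g) : BddMeas 𝓜 (fun ω => f ω * g ω) := by
  obtain ⟨hfm, C, hC⟩ := hf
  obtain ⟨hgm, C', hC'⟩ := hg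
  refine ⟨hfm.mul hgm, C * C', fun ω => ?_⟩
  rw [abs_mul]
  exact mul_le_mul (hC ω) (hC' ω) (abs_nonneg _) ((abs_nonneg _).trans (hC ω))

theorem const_mul (c : ℝ) (hf : BddMeas 𝓜 f) : BddMeas 𝓜 (fun ω => c * f ω) :=
  (const c).mul hf

theorem sub (hf : BddMeas 𝓜 f) (hg : BddMeas 𝓜 g) : BddMeas 𝓜 (fun ω => f ω - g ω) := by
  simpa [sub_eq_add_neg] using hf.add (hg.const_mul (-1))

theorem pow (hf : BddMeas 𝓜 f) (n : ℕ) : BddMeas 𝓜 (fun ω => f ω ^ n) :=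
  ⟨hf.1.pow_const n, hf.2.elim fun C hC => ⟨C ^ n, fun ω => by
    rw [abs_pow]; exact pow_le_pow_left₀ (abs_nonneg _) (hC ω) n⟩⟩

theorem sum {ι : Type*} {s : Finset ι} {F : ι → Ω → ℝ} (h : ∀ i ∈ s, BddMeas 𝓜 (F i)) :
    BddMeas 𝓜 (fun ω => ∑ i ∈ s, F i ω) := by
  classical
  induction s using Finset.induction_on with
  | empty => simpa using const (𝓜 := 𝓜) 0
  | insert a s ha ih =>
    simp only [Finset.sum_insert ha]
    exact (h a (Finset.mem_insert_self _ _)).add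
      (ih fun i hi => h i (Finset.mem_insert_of_mem hi))

theorem integrable [mΩ : MeasurableSpace Ω] {P : Measure Ω} [IsFiniteMeasure P]
    (hf : BddMeas mΩ f) : Integrable f P := by
  obtain ⟨hm, C, hC⟩ := hf
  exact Integrable.of_bound hm.aestronglyMeasurable C (Eventually.of_forall hC)

end BddMeas

section RealInequalities

theorem abs_add_pow_sub_taylor_le (q : ℕ) (z x : ℝ) :
    |(z + x) ^ (q + 2) - z ^ (q + 2) - (q + 2) * z ^ (q + 1) * x| ≤
      (q + 2).choose 2 * (|z| + |x|) ^ q * x ^ 2 := by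
  induction q with
  | zero =>
    refine le_of_eq ?_
    rw [show (z + x) ^ (0 + 2) - z ^ (0 + 2) - ((0 : ℕ) + 2) * z ^ (0 + 1) * x = x ^ 2 by
      push_cast; ring]
    simp
  | succ q ih =>
    have hz : |z| ^ (q + 1) ≤ (|z| + |x|) ^ (q + 1) :=
      pow_le_pow_left₀ (abs_nonneg _) (le_add_of_nonneg_right (abs_nonneg _)) _
    have hchoose : ((q + 1 + 2).choose 2 : ℝ) = (q + 2) + (q + 2).choose 2 := by
      rw [Nat.choose_succ_succ (q + 2) 1, Nat.choose_one_right]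
      push_cast; ring
    calc |(z + x) ^ (q + 1 + 2) - z ^ (q + 1 + 2) - ((q + 1 : ℕ) + 2) * z ^ (q + 1 + 1) * x|
        = |(z + x) * ((z + x) ^ (q + 2) - z ^ (q + 2) - (q + 2) * z ^ (q + 1) * x)
            + (q + 2) * z ^ (q + 1) * x ^ 2| := by congr 1; push_cast; ring
      _ ≤ (|z| + |x|) * ((q + 2).choose 2 * (|z| + |x|) ^ q * x ^ 2)
            + (q + 2) * |z| ^ (q + 1) * x ^ 2 := by
          refine (abs_add_le _ _).trans (add_le_add ?_ (le_of_eq ?_))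
          · rw [abs_mul]
            exact mul_le_mul (abs_add_le _ _) ih (abs_nonneg _) (by positivity)
          · rw [abs_mul, abs_mul, abs_pow z, abs_of_nonneg (sq_nonneg x),
              abs_of_nonneg (by positivity : (0 : ℝ) ≤ q + 2)]
      _ ≤ (|z| + |x|) * ((q + 2).choose 2 * (|z| + |x|) ^ q * x ^ 2)
            + (q + 2) * (|z| + |x|) ^ (q + 1) * x ^ 2 := by gcongr
      _ = _ := by rw [hchoose]; ring

theorem add_add_two_mul_pow_le {a b c : ℝ} (ha : 0 ≤ a) (hb : 0 ≤ b) (hc : 0 ≤ c) (n : ℕ) :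
    (a + b + 2 * c) ^ n ≤ 4 ^ n * (a ^ n + b ^ n + c ^ n) := by
  have hle : ∀ t, a ≤ t → b ≤ t → c ≤ t → t ^ n ≤ a ^ n + b ^ n + c ^ n →
      (a + b + 2 * c) ^ n ≤ 4 ^ n * (a ^ n + b ^ n + c ^ n) := by
    intro t hat hbt hct htn
    calc (a + b + 2 * c) ^ n ≤ (4 * t) ^ n := pow_le_pow_left₀ (by positivity) (by linarith) _
      _ = 4 ^ n * t ^ n := mul_pow _ _ _
      _ ≤ _ := by gcongr
  have hpa := pow_nonneg ha n
  have hpb := pow_nonneg hb n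
  have hpc := pow_nonneg hc n
  rcases le_total a b with hab | hba
  · rcases le_total b c with hbc | hcb
    · exact hle c (hab.trans hbc) hbc le_rfl (by linarith)
    · exact hle b hab le_rfl hcb (by linarith)
  · rcases le_total a c with hac | hca
    · exact hle c hac (hba.trans hac) le_rfl (by linarith)
    · exact hle a le_rfl hba hca (by linarith)

theorem pow_mul_le_young {a y ε : ℝ} (ha : 0 ≤ a) (hy : 0 ≤ y) (hε : 0 < ε) (p : ℕ) :
    a ^ p * y ≤ ε * a ^ (p + 1) + (1 / ε) ^ p * y ^ (p + 1) := by
  rcases le_total y (ε * a) with h | h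
  · calc a ^ p * y ≤ a ^ p * (ε * a) := by gcongr
      _ = ε * a ^ (p + 1) := by ring
      _ ≤ _ := le_add_of_nonneg_right (by positivity)
  · have hay : a ≤ 1 / ε * y := by
      rw [one_div, ← div_eq_inv_mul, le_div_iff₀ hε]
      linarith
    calc a ^ p * y ≤ (1 / ε * y) ^ p * y := by gcongr
      _ = (1 / ε) ^ p * y ^ (p + 1) := by rw [mul_pow]; ring
      _ ≤ _ := le_add_of_nonneg_left (by positivity)

theorem sum_range_pow_succ_le {x : ℕ → ℝ} {B : ℝ} (hx : ∀ i, 0 ≤ x i) (hB : ∀ i, x i ≤ B)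
    (p k : ℕ) :
    (∑ i ∈ Finset.range k, x i) ^ (p + 1) ≤ ∑ i ∈ Finset.range k,
      (p + 1) * 2 ^ (p - 1) * ((∑ j ∈ Finset.range i, x j) ^ p + B ^ p) * x i := by
  induction k with
  | zero => simp
  | succ k ih =>
    rw [Finset.sum_range_succ x, Finset.sum_range_succ]
    set s := ∑ j ∈ Finset.range k, x j
    have hs : 0 ≤ s := Finset.sum_nonneg fun i _ => hx i
    have hdiff : (s + x k) ^ (p + 1) - s ^ (p + 1) ≤ x k * (p + 1) * (s + x k) ^ p := by
      have h := abs_pow_sub_pow_le (s + x k) s (p + 1)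
      rw [add_sub_cancel_left, abs_of_nonneg (hx k), abs_of_nonneg (add_nonneg hs (hx k)),
        abs_of_nonneg hs, max_eq_left (le_add_of_nonneg_right (hx k)), Nat.add_sub_cancel] at h
      exact_mod_cast (le_abs_self _).trans h
    have hpow : (s + x k) ^ p ≤ 2 ^ (p - 1) * (s ^ p + B ^ p) :=
      (add_pow_le hs (hx k) p).trans <| by
        have := pow_le_pow_left₀ (hx k) (hB k) p
        gcongr
    calc (s + x k) ^ (p + 1) ≤ s ^ (p + 1) + x k * (p + 1) * (s + x k) ^ p := by linarith
      _ ≤ (∑ i ∈ Finset.range k,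
              (p + 1) * 2 ^ (p - 1) * ((∑ j ∈ Finset.range i, x j) ^ p + B ^ p) * x i)
            + x k * (p + 1) * (2 ^ (p - 1) * (s ^ p + B ^ p)) := by
          have := hx k
          gcongr
      _ = _ := by ring

/-- The constant in the second-order expansion of the power `2 * p + 2`. -/
def taylorConst (p : ℕ) : ℝ := (2 * p + 2).choose 2 * 4 ^ (2 * p)

theorem taylorConst_pos (p : ℕ) : 0 < taylorConst p := by
  have : 0 < (2 * p + 2).choose 2 := Nat.choose_pos (by omega)
  unfold taylorConst
  positivity

theorem sub_pow_sub_sub_pow_le {s t x B : ℝ} (hx : x ^ 2 ≤ B) (p : ℕ) :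
    (s - t) ^ (2 * p + 2) - (s - (t + x)) ^ (2 * p + 2) ≤
      (2 * p + 2) * (x * (s - (t + x)) ^ (2 * p + 1))
        + taylorConst p * (s ^ (2 * p) + t ^ (2 * p) + B ^ p) * x ^ 2 := by
  set z := s - (t + x)
  have hz : |z| + |x| ≤ |s| + |t| + 2 * |x| := by
    have := abs_sub s (t + x)
    have := abs_add_le t x
    linarith
  have heven : ∀ y : ℝ, |y| ^ (2 * p) = y ^ (2 * p) := Even.pow_abs (even_two_mul p)
  have hpow : (|z| + |x|) ^ (2 * p) ≤ 4 ^ (2 * p) * (s ^ (2 * p) + t ^ (2 * p) + B ^ p) :=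
    calc (|z| + |x|) ^ (2 * p) ≤ (|s| + |t| + 2 * |x|) ^ (2 * p) := by gcongr
      _ ≤ 4 ^ (2 * p) * (|s| ^ (2 * p) + |t| ^ (2 * p) + |x| ^ (2 * p)) :=
          add_add_two_mul_pow_le (abs_nonneg _) (abs_nonneg _) (abs_nonneg _) _
      _ = 4 ^ (2 * p) * (s ^ (2 * p) + t ^ (2 * p) + (x ^ 2) ^ p) := by
          rw [heven, heven, heven, pow_mul x]
      _ ≤ _ := by gcongr
  have htaylor := (le_abs_self _).trans (abs_add_pow_sub_taylor_le (2 * p) z x)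
  rw [show z + x = s - t by ring] at htaylor
  push_cast at htaylor
  calc (s - t) ^ (2 * p + 2) - z ^ (2 * p + 2)
      ≤ (2 * p + 2) * (x * z ^ (2 * p + 1))
          + (2 * p + 2).choose 2 * (|z| + |x|) ^ (2 * p) * x ^ 2 := by linarith
    _ ≤ (2 * p + 2) * (x * z ^ (2 * p + 1)) + (2 * p + 2).choose 2 *
          (4 ^ (2 * p) * (s ^ (2 * p) + t ^ (2 * p) + B ^ p)) * x ^ 2 := by gcongr
    _ = _ := by rw [taylorConst]; ring

theorem sum_range_pow_two_mul_add_two_le {x : ℕ → ℝ} {B : ℝ} (hx : ∀ i, x i ^ 2 ≤ B) (p k : ℕ) :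
    (∑ i ∈ Finset.range k, x i) ^ (2 * p + 2) ≤
      2 * ((2 * p + 2) * ∑ i ∈ Finset.range k, x i *
          (∑ j ∈ Finset.range k, x j - ∑ j ∈ Finset.range (i + 1), x j) ^ (2 * p + 1)
        + ∑ i ∈ Finset.range k,
            taylorConst p * ((∑ j ∈ Finset.range i, x j) ^ (2 * p) + B ^ p) * x i ^ 2
        + taylorConst p * (2 * taylorConst p) ^ p *
            (∑ i ∈ Finset.range k, x i ^ 2) ^ (p + 1)) := by
  have hc := taylorConst_pos p
  set s := ∑ i ∈ Finset.range k, x i with hs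
  have htel : s ^ (2 * p + 2) ≤ ∑ i ∈ Finset.range k,
      ((2 * p + 2) * (x i * (s - ∑ j ∈ Finset.range (i + 1), x j) ^ (2 * p + 1))
        + taylorConst p * (s ^ (2 * p) + (∑ j ∈ Finset.range i, x j) ^ (2 * p) + B ^ p)
          * x i ^ 2) := by
    have h := Finset.sum_range_sub' (fun i => (s - ∑ j ∈ Finset.range i, x j) ^ (2 * p + 2)) k
    rw [← hs, sub_self, zero_pow (by omega), sub_zero, Finset.sum_range_zero, sub_zero] at h
    rw [← h]
    refine Finset.sum_le_sum fun i _ => ?_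
    rw [Finset.sum_range_succ]
    exact sub_pow_sub_sub_pow_le (hx i) p
  have hsplit : ∑ i ∈ Finset.range k,
      ((2 * p + 2) * (x i * (s - ∑ j ∈ Finset.range (i + 1), x j) ^ (2 * p + 1))
        + taylorConst p * (s ^ (2 * p) + (∑ j ∈ Finset.range i, x j) ^ (2 * p) + B ^ p)
          * x i ^ 2)
      = (2 * p + 2) * ∑ i ∈ Finset.range k,
          x i * (s - ∑ j ∈ Finset.range (i + 1), x j) ^ (2 * p + 1)
        + ∑ i ∈ Finset.range k,
            taylorConst p * ((∑ j ∈ Finset.range i, x j) ^ (2 * p) + B ^ p) * x i ^ 2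
        + taylorConst p * (s ^ (2 * p) * ∑ i ∈ Finset.range k, x i ^ 2) := by
    simp only [Finset.mul_sum, ← Finset.sum_add_distrib]
    exact Finset.sum_congr rfl fun i _ => by ring
  -- The term with the full sum `s` is absorbed in the left-hand side by Young's inequality.
  have hyoung : taylorConst p * (s ^ (2 * p) * ∑ i ∈ Finset.range k, x i ^ 2) ≤
      s ^ (2 * p + 2) / 2 + taylorConst p * (2 * taylorConst p) ^ p *
        (∑ i ∈ Finset.range k, x i ^ 2) ^ (p + 1) := by
    have h := pow_mul_le_young (sq_nonneg s)
      (Finset.sum_nonneg fun i (_ : i ∈ Finset.range k) => sq_nonneg (x i))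
      (by positivity : 0 < 1 / (2 * taylorConst p)) p
    rw [← pow_mul, ← pow_mul, one_div_one_div, mul_add_one] at h
    calc _ ≤ taylorConst p * _ := mul_le_mul_of_nonneg_left h hc.le
      _ = _ := by field_simp
  linarith

end RealInequalities

/-! ### Reverse martingale differences -/

/-- `f` is bounded and its conditional expectation given `𝓜` is at most `K`, expressed by testing
against nonnegative functions. -/
structure CondExpLE {Ω : Type*} [mΩ : MeasurableSpace Ω] (P : Measure Ω) (𝓜 : MeasurableSpace Ω)
    (f : Ω → ℝ) (K : ℝ) : Prop where
  bddMeas : BddMeas mΩ f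
  integral_mul_le : ∀ g : Ω → ℝ, BddMeas 𝓜 g → (∀ ω, 0 ≤ g ω) →
    ∫ ω, f ω * g ω ∂P ≤ K * ∫ ω, g ω ∂P

namespace CondExpLE

variable {Ω : Type*} {𝓜 : MeasurableSpace Ω} [mΩ : MeasurableSpace Ω] {P : Measure Ω}
  {f f' : Ω → ℝ} {K K' : ℝ}

theorem const (c : ℝ) : CondExpLE P 𝓜 (fun _ => c) c :=
  ⟨.const c, fun g _ _ => (integral_const_mul c g).le⟩

theorem const_mul {c : ℝ} (hc : 0 ≤ c) (hf : CondExpLE P 𝓜 f K) :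
    CondExpLE P 𝓜 (fun ω => c * f ω) (c * K) := by
  refine ⟨hf.bddMeas.const_mul c, fun g hg hg0 => ?_⟩
  simp only [mul_assoc]
  rw [integral_const_mul]
  exact mul_le_mul_of_nonneg_left (hf.integral_mul_le g hg hg0) hc

variable [IsFiniteMeasure P]

theorem add (h𝓜 : 𝓜 ≤ mΩ) (hf : CondExpLE P 𝓜 f K) (hf' : CondExpLE P 𝓜 f' K') :
    CondExpLE P 𝓜 (fun ω => f ω + f' ω) (K + K') := by
  refine ⟨hf.bddMeas.add hf'.bddMeas, fun g hg hg0 => ?_⟩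
  simp only [add_mul]
  rw [integral_add (hf.bddMeas.mul (hg.mono h𝓜)).integrable
    (hf'.bddMeas.mul (hg.mono h𝓜)).integrable]
  exact add_le_add (hf.integral_mul_le g hg hg0) (hf'.integral_mul_le g hg hg0)

theorem of_le (h𝓜 : 𝓜 ≤ mΩ) (hf' : BddMeas mΩ f') (hle : ∀ ω, f' ω ≤ f ω)
    (hf : CondExpLE P 𝓜 f K) : CondExpLE P 𝓜 f' K :=
  ⟨hf', fun g hg hg0 => (integral_mono (hf'.mul (hg.mono h𝓜)).integrable
    (hf.bddMeas.mul (hg.mono h𝓜)).integrable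
    fun ω => mul_le_mul_of_nonneg_right (hle ω) (hg0 ω)).trans (hf.integral_mul_le g hg hg0)⟩

end CondExpLE

/-- Bounded reverse martingale differences `ξ k` with respect to a decreasing sequence of
σ-algebras `𝓖 k`: the conditional expectation of `ξ k` given `𝓖 (k + 1)` vanishes. -/
structure IsRevMartDiff {Ω : Type*} [mΩ : MeasurableSpace Ω] (P : Measure Ω)
    (𝓖 : ℕ → MeasurableSpace Ω) (ξ : ℕ → Ω → ℝ) (D : ℝ) : Prop where
  anti : Antitone 𝓖
  le : ∀ k, 𝓖 k ≤ mΩ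
  meas : ∀ k, Measurable[𝓖 k] (ξ k)
  bound : ∀ k ω, |ξ k ω| ≤ D
  orth : ∀ k (g : Ω → ℝ), BddMeas (𝓖 (k + 1)) g → ∫ ω, ξ k ω * g ω ∂P = 0

/-- Partial sums of a sequence of functions. -/
def psum {Ω : Type*} (ξ : ℕ → Ω → ℝ) (n : ℕ) (ω : Ω) : ℝ := ∑ i ∈ Finset.range n, ξ i ω

/-- The square function: partial sums of the squares. -/
def qsum {Ω : Type*} (ξ : ℕ → Ω → ℝ) (n : ℕ) (ω : Ω) : ℝ := ∑ i ∈ Finset.range n, ξ i ω ^ 2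

namespace IsRevMartDiff

variable {Ω : Type*} [mΩ : MeasurableSpace Ω] {P : Measure Ω}
  {𝓖 : ℕ → MeasurableSpace Ω} {ξ : ℕ → Ω → ℝ} {D : ℝ}

theorem bddMeas_of_le (h : IsRevMartDiff P 𝓖 ξ D) {k n : ℕ} (hk : n ≤ k) : BddMeas (𝓖 n) (ξ k) :=
  BddMeas.mono (h.anti hk) ⟨h.meas k, D, h.bound k⟩

theorem bddMeas (h : IsRevMartDiff P 𝓖 ξ D) (k : ℕ) : BddMeas mΩ (ξ k) :=
  (h.bddMeas_of_le le_rfl).mono (h.le k)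

theorem bddMeas_psum (h : IsRevMartDiff P 𝓖 ξ D) (n : ℕ) : BddMeas mΩ (psum ξ n) :=
  BddMeas.sum fun i _ => h.bddMeas i

theorem bddMeas_qsum (h : IsRevMartDiff P 𝓖 ξ D) (n : ℕ) : BddMeas mΩ (qsum ξ n) :=
  BddMeas.sum fun i _ => (h.bddMeas i).pow 2

theorem bddMeas_psum_sub (h : IsRevMartDiff P 𝓖 ξ D) {i k : ℕ} (hik : i ≤ k) :
    BddMeas (𝓖 i) (fun ω => psum ξ k ω - psum ξ i ω) := by
  simp only [psum, ← Finset.sum_Ico_eq_sub _ hik]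
  exact BddMeas.sum fun l hl => h.bddMeas_of_le (Finset.mem_Ico.1 hl).1

theorem sq_le (h : IsRevMartDiff P 𝓖 ξ D) (k : ℕ) (ω : Ω) : ξ k ω ^ 2 ≤ D ^ 2 :=
  sq_le_sq.2 ((h.bound k ω).trans (le_abs_self D))

variable [IsFiniteMeasure P]

theorem integral_psum_mul (h : IsRevMartDiff P 𝓖 ξ D) {n : ℕ} {g : Ω → ℝ}
    (hg : BddMeas (𝓖 n) g) : ∫ ω, psum ξ n ω * g ω ∂P = 0 := by
  simp only [psum, Finset.sum_mul]
  rw [integral_finsetSum _ fun i _ => ((h.bddMeas i).mul (hg.mono (h.le n))).integrable]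
  exact Finset.sum_eq_zero fun i hi => h.orth i g (hg.mono (h.anti (Finset.mem_range.1 hi)))

theorem integral_psum_sq_mul (h : IsRevMartDiff P 𝓖 ξ D) {n : ℕ} {g : Ω → ℝ}
    (hg : BddMeas (𝓖 n) g) :
    ∫ ω, psum ξ n ω ^ 2 * g ω ∂P = ∫ ω, qsum ξ n ω * g ω ∂P := by
  induction n with
  | zero => simp [psum, qsum]
  | succ n ih =>
    have hgn := hg.mono (h.anti n.le_succ)
    have hgΩ := hg.mono (h.le (n + 1))
    have hpsq := (((h.bddMeas_psum n).pow 2).mul hgΩ).integrable (P := P)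
    have hcross :=
      (((h.bddMeas_psum n).mul ((h.bddMeas n).mul hgΩ)).const_mul 2).integrable (P := P)
    have hsq := (((h.bddMeas n).pow 2).mul hgΩ).integrable (P := P)
    have hq := ((h.bddMeas_qsum n).mul hgΩ).integrable (P := P)
    calc ∫ ω, psum ξ (n + 1) ω ^ 2 * g ω ∂P
        = ∫ ω, psum ξ n ω ^ 2 * g ω
            + (2 * (psum ξ n ω * (ξ n ω * g ω)) + ξ n ω ^ 2 * g ω) ∂P := by
          congr 1 with ω
          simp only [psum, Finset.sum_range_succ]
          ring
      _ = ∫ ω, qsum ξ n ω * g ω + ξ n ω ^ 2 * g ω ∂P := by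
          rw [integral_add hpsq (hcross.fun_add hsq), integral_add hcross hsq, integral_add hq hsq,
            integral_const_mul, h.integral_psum_mul ((h.bddMeas_of_le le_rfl).mul hgn), ih hgn]
          ring
      _ = ∫ ω, qsum ξ (n + 1) ω * g ω ∂P := by
          simp only [qsum, Finset.sum_range_succ, add_mul]

theorem condExpLE_sum_mul_sq (h : IsRevMartDiff P 𝓖 ξ D) {k : ℕ} {f : ℕ → Ω → ℝ} {K B : ℝ}
    (hK : 0 ≤ K) (hf : ∀ i < k, CondExpLE P (𝓖 i) (f i) K)
    (hB : CondExpLE P (𝓖 k) (qsum ξ k) B) :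
    CondExpLE P (𝓖 k) (fun ω => ∑ i ∈ Finset.range k, f i ω * ξ i ω ^ 2) (K * B) := by
  have hbdd : ∀ i ∈ Finset.range k, BddMeas mΩ fun ω => f i ω * ξ i ω ^ 2 := fun i hi =>
    (hf i (Finset.mem_range.1 hi)).bddMeas.mul ((h.bddMeas i).pow 2)
  refine ⟨BddMeas.sum hbdd, fun g hg hg0 => ?_⟩
  have hgΩ := hg.mono (h.le k)
  calc ∫ ω, (∑ i ∈ Finset.range k, f i ω * ξ i ω ^ 2) * g ω ∂P
      = ∑ i ∈ Finset.range k, ∫ ω, f i ω * (ξ i ω ^ 2 * g ω) ∂P := by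
        simp only [Finset.sum_mul]
        rw [integral_finsetSum _ fun i hi => ((hbdd i hi).mul hgΩ).integrable]
        simp only [mul_assoc]
    _ ≤ ∑ i ∈ Finset.range k, K * ∫ ω, ξ i ω ^ 2 * g ω ∂P := by
        refine Finset.sum_le_sum fun i hi => ?_
        have hik := Finset.mem_range.1 hi
        exact (hf i hik).integral_mul_le _
          (((h.bddMeas_of_le le_rfl).pow 2).mul (hg.mono (h.anti hik.le)))
          fun ω => mul_nonneg (sq_nonneg _) (hg0 ω)
    _ = K * ∫ ω, qsum ξ k ω * g ω ∂P := by
        simp only [qsum, Finset.sum_mul]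
        rw [← Finset.mul_sum,
          integral_finsetSum _ fun i _ => (((h.bddMeas i).pow 2).mul hgΩ).integrable]
    _ ≤ K * (B * ∫ ω, g ω ∂P) := mul_le_mul_of_nonneg_left (hB.integral_mul_le g hg hg0) hK
    _ = _ := by ring

theorem condExpLE_sum_mul_psum_sub_pow (h : IsRevMartDiff P 𝓖 ξ D) (k q : ℕ) :
    CondExpLE P (𝓖 k) (fun ω => ∑ i ∈ Finset.range k,
      ξ i ω * (psum ξ k ω - psum ξ (i + 1) ω) ^ q) 0 := by
  have hbdd : ∀ i, BddMeas mΩ fun ω => ξ i ω * (psum ξ k ω - psum ξ (i + 1) ω) ^ q := fun i =>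
    (h.bddMeas i).mul (((h.bddMeas_psum k).sub (h.bddMeas_psum (i + 1))).pow q)
  refine ⟨BddMeas.sum fun i _ => hbdd i, fun g hg _ => ?_⟩
  simp only [Finset.sum_mul]
  rw [integral_finsetSum _ fun i _ => ((hbdd i).mul (hg.mono (h.le k))).integrable, zero_mul]
  refine (Finset.sum_eq_zero fun i hi => ?_).le
  have hik := Finset.mem_range.1 hi
  simpa only [mul_assoc] using
    h.orth i _ (((h.bddMeas_psum_sub hik).pow q).mul (hg.mono (h.anti hik)))

theorem exists_condExpLE_qsum_pow (h : IsRevMartDiff P 𝓖 ξ D) (p : ℕ) :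
    ∃ C : ℝ, 0 ≤ C ∧ ∀ (N : ℕ) (B : ℝ), D ^ 2 ≤ B →
      (∀ k ≤ N, CondExpLE P (𝓖 k) (qsum ξ k) B) →
      ∀ k ≤ N, CondExpLE P (𝓖 k) (fun ω => qsum ξ k ω ^ p) (C * B ^ p) := by
  induction p with
  | zero => exact ⟨1, zero_le_one, fun N B _ _ k _ => by simpa using CondExpLE.const 1⟩
  | succ p ih =>
    obtain ⟨C, hC, ih⟩ := ih
    refine ⟨(p + 1) * 2 ^ (p - 1) * (C + 1), by positivity, fun N B hDB hB k hk => ?_⟩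
    have hB0 : 0 ≤ B := (sq_nonneg D).trans hDB
    have hcond : ∀ i < k, CondExpLE P (𝓖 i)
        (fun ω => (p + 1) * 2 ^ (p - 1) * (qsum ξ i ω ^ p + B ^ p))
        ((p + 1) * 2 ^ (p - 1) * (C * B ^ p + B ^ p)) := fun i hi =>
      ((ih N B hDB hB i (hi.le.trans hk)).add (h.le i) (.const _)).const_mul (by positivity)
    have hsum := (h.condExpLE_sum_mul_sq (by positivity) hcond (hB k hk)).of_le (h.le k)
      ((h.bddMeas_qsum k).pow (p + 1)) fun ω =>
        sum_range_pow_succ_le (fun i => sq_nonneg (ξ i ω)) (fun i => (h.sq_le i ω).trans hDB) p k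
    convert hsum using 1
    ring

theorem exists_condExpLE_psum_pow (h : IsRevMartDiff P 𝓖 ξ D) (p : ℕ) :
    ∃ C : ℝ, 0 ≤ C ∧ ∀ (N : ℕ) (B : ℝ), D ^ 2 ≤ B →
      (∀ k ≤ N, CondExpLE P (𝓖 k) (qsum ξ k) B) →
      ∀ k ≤ N, CondExpLE P (𝓖 k) (fun ω => psum ξ k ω ^ (2 * p)) (C * B ^ p) := by
  induction p with
  | zero => exact ⟨1, zero_le_one, fun N B _ _ k _ => by simpa using CondExpLE.const 1⟩
  | succ p ih =>
    obtain ⟨C, hC, ih⟩ := ih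
    obtain ⟨A, hA, hqsum⟩ := h.exists_condExpLE_qsum_pow (p + 1)
    have hc := taylorConst_pos p
    refine ⟨2 * (taylorConst p * (C + 1) + taylorConst p * (2 * taylorConst p) ^ p * A),
      by positivity, fun N B hDB hB k hk => ?_⟩
    have hB0 : 0 ≤ B := (sq_nonneg D).trans hDB
    have hcond : ∀ i < k, CondExpLE P (𝓖 i)
        (fun ω => taylorConst p * (psum ξ i ω ^ (2 * p) + B ^ p))
        (taylorConst p * (C * B ^ p + B ^ p)) := fun i hi =>
      ((ih N B hDB hB i (hi.le.trans hk)).add (h.le i) (.const _)).const_mul hc.le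
    have hmart := (h.condExpLE_sum_mul_psum_sub_pow k (2 * p + 1)).const_mul
      (by positivity : (0 : ℝ) ≤ 2 * p + 2)
    have hsq := h.condExpLE_sum_mul_sq (by positivity) hcond (hB k hk)
    have hq := (hqsum N B hDB hB k hk).const_mul
      (by positivity : 0 ≤ taylorConst p * (2 * taylorConst p) ^ p)
    have hsum := (((hmart.add (h.le k) hsq).add (h.le k) hq).const_mul zero_le_two).of_le (h.le k)
      ((h.bddMeas_psum k).pow (2 * p + 2)) fun ω =>
        sum_range_pow_two_mul_add_two_le (fun i => (h.sq_le i ω).trans hDB) p k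
    convert hsum using 1
    · rw [mul_add_one]
    · ring

end IsRevMartDiff

theorem sq_integral_sub_le_integral_sq_mul_measureReal_lt {Ω : Type*} [MeasurableSpace Ω]
    {P : Measure Ω} [IsFiniteMeasure P] {f g : Ω → ℝ} (hf : Measurable f) (hg : Measurable g)
    (hf2 : MemLp f 2 P) (hgi : Integrable g P) (hf0 : ∀ ω, 0 ≤ f ω) (hg0 : ∀ ω, 0 ≤ g ω)
    (hgf : ∫ ω, g ω ∂P ≤ ∫ ω, f ω ∂P) :
    (∫ ω, f ω ∂P - ∫ ω, g ω ∂P) ^ 2 ≤ (∫ ω, f ω ^ 2 ∂P) * P.real {ω | g ω < f ω} := by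
  set A : Set Ω := {ω | g ω < f ω}
  have hA : MeasurableSet A := measurableSet_lt hg hf
  have hfi : Integrable f P := hf2.integrable one_le_two
  have hsub : ∫ ω, f ω ∂P - ∫ ω, g ω ∂P ≤ ∫ ω in A, f ω * 1 ∂P := by
    rw [← integral_sub hfi hgi, ← integral_indicator hA]
    refine integral_mono (hfi.sub hgi) ((hfi.mul_const 1).indicator hA) fun ω => ?_
    by_cases hω : ω ∈ A
    · simpa [Set.indicator_of_mem hω] using hg0 ω
    · simpa [Set.indicator_of_notMem hω, A] using hω
  have hcs : ∫ ω in A, f ω * 1 ∂P ≤ √(∫ ω in A, f ω ^ 2 ∂P) * √(P.real A) := by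
    have h := integral_mul_le_Lp_mul_Lq_of_nonneg (μ := P.restrict A) Real.HolderConjugate.two_two
      (Eventually.of_forall hf0) (Eventually.of_forall fun _ => zero_le_one (α := ℝ))
      (by simpa using hf2.restrict A) (by simpa using memLp_const (1 : ℝ))
    simpa [Real.sqrt_eq_rpow] using h
  calc (∫ ω, f ω ∂P - ∫ ω, g ω ∂P) ^ 2
      ≤ (√(∫ ω in A, f ω ^ 2 ∂P) * √(P.real A)) ^ 2 :=
        pow_le_pow_left₀ (sub_nonneg.2 hgf) (hsub.trans hcs) 2
    _ = (∫ ω in A, f ω ^ 2 ∂P) * P.real A := by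
        rw [mul_pow, Real.sq_sqrt (integral_nonneg fun ω => sq_nonneg _),
          Real.sq_sqrt measureReal_nonneg]
    _ ≤ (∫ ω, f ω ^ 2 ∂P) * P.real A := by
        gcongr
        exacts [.of_forall fun ω => sq_nonneg _, hf2.integrable_sq, Measure.restrict_le_self]

theorem exists_measureReal_lt_sq_lt {Ω : Type*} [MeasurableSpace Ω] {P : Measure Ω}
    [IsFiniteMeasure P] {G : Ω → ℝ} (hG : Measurable G) {ε : ℝ} (hε : 0 < ε) :
    ∃ L : ℝ, 0 < L ∧ P.real {ω | L < G ω ^ 2} < ε := by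
  have htight := tendsto_measure_norm_gt_of_isTightMeasureSet
    (isTightMeasureSet_singleton (μ := P.map G))
  simp only [Set.mem_singleton_iff, iSup_iSup_eq_left] at htight
  obtain ⟨r, hr, hr0⟩ := ((htight.eventually_lt_const (ENNReal.ofReal_pos.2 hε)).and
    (eventually_gt_atTop 0)).exists
  refine ⟨r ^ 2, by positivity, (ENNReal.lt_ofReal_iff_toReal_lt (measure_ne_top _ _)).1 ?_⟩
  rw [Measure.map_apply hG (measurableSet_lt measurable_const measurable_norm)] at hr
  convert hr using 2
  ext ω
  simp only [Set.mem_preimage, Set.mem_ofPred_eq, Real.norm_eq_abs, sq_lt_sq, abs_of_pos hr0]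

/-- The conditional expectation of the square function given `𝓖 n` differs from its expectation by
at most `s`. -/
def CondVarDefectLE {Ω : Type*} [MeasurableSpace Ω] (P : Measure Ω) (𝓖 : ℕ → MeasurableSpace Ω)
    (ξ : ℕ → Ω → ℝ) (s : ℝ) : Prop :=
  ∀ n (g : Ω → ℝ), BddMeas (𝓖 n) g → (∀ ω, 0 ≤ g ω) →
    |∫ ω, qsum ξ n ω * g ω ∂P - (∫ ω, qsum ξ n ω ∂P) * ∫ ω, g ω ∂P| ≤ s * ∫ ω, g ω ∂P

theorem CondVarDefectLE.nonneg {Ω : Type*} [MeasurableSpace Ω] {P : Measure Ω}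
    [IsProbabilityMeasure P] {𝓖 : ℕ → MeasurableSpace Ω} {ξ : ℕ → Ω → ℝ} {s : ℝ}
    (h : CondVarDefectLE P 𝓖 ξ s) : 0 ≤ s := by
  simpa using (abs_nonneg _).trans (h 0 (fun _ => 1) (.const 1) fun _ => zero_le_one)

/-- The weight that makes a variance of size `v + y ^ 2` of order one. -/
noncomputable def varWeight (v y : ℝ) : ℝ := (v + y ^ 2)⁻¹

section varWeight

variable {v : ℝ} (hv : 0 < v) (y : ℝ)

include hv

theorem varWeight_nonneg : 0 ≤ varWeight v y := by
  unfold varWeight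
  positivity

theorem mul_varWeight_add_sq_mul_varWeight : v * varWeight v y + y ^ 2 * varWeight v y = 1 := by
  rw [← add_mul]
  exact mul_inv_cancel₀ (by positivity)

theorem mul_varWeight_le_one : v * varWeight v y ≤ 1 := by
  linarith [mul_varWeight_add_sq_mul_varWeight hv y,
    mul_nonneg (sq_nonneg y) (varWeight_nonneg hv y)]

theorem sq_mul_varWeight_le_one : y ^ 2 * varWeight v y ≤ 1 := by
  linarith [mul_varWeight_add_sq_mul_varWeight hv y, mul_nonneg hv.le (varWeight_nonneg hv y)]

theorem varWeight_le_inv : varWeight v y ≤ v⁻¹ := by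
  unfold varWeight
  gcongr
  exact le_add_of_nonneg_right (sq_nonneg y)

theorem sq_sub_sq_mul_varWeight_le (x : ℝ) :
    ((y - x) ^ 2 * varWeight v y) ^ 2 ≤ 8 * (1 + x ^ (2 * 2) * varWeight v y ^ 2) := by
  have hquad : (y - x) ^ 4 ≤ 8 * (y ^ 4 + x ^ 4) := by
    nlinarith [sq_nonneg (y ^ 2 - x ^ 2), sq_nonneg ((y + x) ^ 2),
      mul_nonneg (sq_nonneg (y + x)) (sq_nonneg (y - x))]
  calc ((y - x) ^ 2 * varWeight v y) ^ 2
      = (y - x) ^ 4 * varWeight v y ^ 2 := by ring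
    _ ≤ 8 * (y ^ 4 + x ^ 4) * varWeight v y ^ 2 := by gcongr
    _ = 8 * ((y ^ 2 * varWeight v y) ^ 2 + x ^ (2 * 2) * varWeight v y ^ 2) := by ring
    _ ≤ _ := by
        gcongr
        exact pow_le_one₀ (mul_nonneg (sq_nonneg _) (varWeight_nonneg hv _))
          (sq_mul_varWeight_le_one hv _)

variable {Ω : Type*} {𝓜 : MeasurableSpace Ω} {Y : Ω → ℝ}

theorem bddMeas_varWeight (hY : Measurable[𝓜] Y) : BddMeas 𝓜 fun ω => varWeight v (Y ω) :=
  ⟨(measurable_const.add (hY.pow_const 2)).inv, v⁻¹, fun ω => by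
    rw [abs_of_nonneg (varWeight_nonneg hv _)]
    exact varWeight_le_inv hv _⟩

theorem bddMeas_sq_mul_varWeight (hY : Measurable[𝓜] Y) :
    BddMeas 𝓜 fun ω => Y ω ^ 2 * varWeight v (Y ω) :=
  ⟨(hY.pow_const 2).mul (bddMeas_varWeight hv hY).1, 1, fun ω => by
    rw [abs_of_nonneg (mul_nonneg (sq_nonneg _) (varWeight_nonneg hv _))]
    exact sq_mul_varWeight_le_one hv _⟩

theorem bddMeas_mul_varWeight (hY : Measurable[𝓜] Y) :
    BddMeas 𝓜 fun ω => Y ω * varWeight v (Y ω) := by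
  refine ⟨hY.mul (bddMeas_varWeight hv hY).1, v⁻¹ + 1, fun ω => ?_⟩
  have hw := varWeight_nonneg hv (Y ω)
  have habs : |Y ω| ≤ 1 + Y ω ^ 2 := by
    rw [← sq_abs]
    nlinarith [sq_nonneg (|Y ω| - 1)]
  calc |Y ω * varWeight v (Y ω)| = |Y ω| * varWeight v (Y ω) := by rw [abs_mul, abs_of_nonneg hw]
    _ ≤ (1 + Y ω ^ 2) * varWeight v (Y ω) := by gcongr
    _ = varWeight v (Y ω) + Y ω ^ 2 * varWeight v (Y ω) := by ring
    _ ≤ _ := add_le_add (varWeight_le_inv hv _) (sq_mul_varWeight_le_one hv _)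

end varWeight

namespace IsRevMartDiff

variable {Ω : Type*} [mΩ : MeasurableSpace Ω] {P : Measure Ω}
  {𝓖 : ℕ → MeasurableSpace Ω} {ξ : ℕ → Ω → ℝ} {D s : ℝ}

theorem bddMeas_sub_psum_sq_mul_varWeight (h : IsRevMartDiff P 𝓖 ξ D) {n : ℕ} {Y : Ω → ℝ}
    (hY : Measurable[𝓖 n] Y) {v : ℝ} (hv : 0 < v) :
    BddMeas mΩ fun ω => (Y ω - psum ξ n ω) ^ 2 * varWeight v (Y ω) := by
  have hYΩ := hY.mono (h.le n) le_rfl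
  have hbdd := ((bddMeas_sq_mul_varWeight hv hYΩ).sub
    (((h.bddMeas_psum n).mul (bddMeas_mul_varWeight hv hYΩ)).const_mul 2)).add
      (((h.bddMeas_psum n).pow 2).mul (bddMeas_varWeight hv hYΩ))
  convert hbdd using 2
  ring

theorem integral_qsum_mono [IsFiniteMeasure P] (h : IsRevMartDiff P 𝓖 ξ D) {k n : ℕ}
    (hkn : k ≤ n) :
    ∫ ω, qsum ξ k ω ∂P ≤ ∫ ω, qsum ξ n ω ∂P :=
  integral_mono (h.bddMeas_qsum k).integrable (h.bddMeas_qsum n).integrable fun _ =>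
    Finset.sum_le_sum_of_subset_of_nonneg (Finset.range_mono hkn) fun _ _ _ => sq_nonneg _

theorem condExpLE_qsum (h : IsRevMartDiff P 𝓖 ξ D) (hvar : CondVarDefectLE P 𝓖 ξ s) {n : ℕ}
    {B : ℝ} (hB : ∫ ω, qsum ξ n ω ∂P + s ≤ B) : CondExpLE P (𝓖 n) (qsum ξ n) B := by
  refine ⟨h.bddMeas_qsum n, fun g hg hg0 => ?_⟩
  have hdef := (abs_le.1 (hvar n g hg hg0)).2
  have hmul := mul_le_mul_of_nonneg_right hB (integral_nonneg (μ := P) hg0)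
  linarith

variable [IsProbabilityMeasure P]

/-- The cross term disappears because `psum ξ n` is orthogonal to `𝓖 n`. -/
theorem half_le_integral_sub_psum_sq_mul_varWeight (h : IsRevMartDiff P 𝓖 ξ D)
    (hvar : CondVarDefectLE P 𝓖 ξ s) {n : ℕ} {Y : Ω → ℝ} (hY : Measurable[𝓖 n] Y) {v : ℝ}
    (hv : 0 < v) (hvn : v = ∫ ω, qsum ξ n ω ∂P) (hsv : 2 * s ≤ v) :
    1 / 2 ≤ ∫ ω, (Y ω - psum ξ n ω) ^ 2 * varWeight v (Y ω) ∂P := by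
  have hw := bddMeas_varWeight hv hY
  have hwΩ := hw.mono (h.le n)
  have hY2w := ((bddMeas_sq_mul_varWeight hv hY).mono (h.le n)).integrable (P := P)
  have hYw := bddMeas_mul_varWeight hv hY
  have hcross := (((h.bddMeas_psum n).mul (hYw.mono (h.le n))).const_mul (-2)).integrable (P := P)
  have hexpand : ∫ ω, (Y ω - psum ξ n ω) ^ 2 * varWeight v (Y ω) ∂P =
      ∫ ω, Y ω ^ 2 * varWeight v (Y ω) ∂P + ∫ ω, qsum ξ n ω * varWeight v (Y ω) ∂P := by
    calc _ = ∫ ω, (Y ω ^ 2 * varWeight v (Y ω) + -2 * (psum ξ n ω * (Y ω * varWeight v (Y ω))))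
            + psum ξ n ω ^ 2 * varWeight v (Y ω) ∂P := by congr 1 with ω; ring
      _ = _ := by
        rw [integral_add (hY2w.fun_add hcross) (((h.bddMeas_psum n).pow 2).mul hwΩ).integrable,
          integral_add hY2w hcross, integral_const_mul, h.integral_psum_mul hYw,
          h.integral_psum_sq_mul hw]
        ring
  have hone : v * ∫ ω, varWeight v (Y ω) ∂P + ∫ ω, Y ω ^ 2 * varWeight v (Y ω) ∂P = 1 := by
    rw [← integral_const_mul, ← integral_add (hwΩ.const_mul v).integrable hY2w]
    simp [mul_varWeight_add_sq_mul_varWeight hv]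
  have hdef := (abs_le.1 (hvar n _ hw fun ω => varWeight_nonneg hv _)).1
  have hsw : 2 * s * ∫ ω, varWeight v (Y ω) ∂P ≤ v * ∫ ω, varWeight v (Y ω) ∂P :=
    mul_le_mul_of_nonneg_right hsv (integral_nonneg fun ω => varWeight_nonneg hv _)
  have hY2w0 : 0 ≤ ∫ ω, Y ω ^ 2 * varWeight v (Y ω) ∂P :=
    integral_nonneg fun ω => mul_nonneg (sq_nonneg _) (varWeight_nonneg hv _)
  rw [← hvn] at hdef
  linarith

theorem exists_integral_sq_sub_psum_sq_mul_varWeight_le (h : IsRevMartDiff P 𝓖 ξ D) :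
    ∃ K : ℝ, 0 < K ∧ ∀ (n : ℕ) (v : ℝ), 0 < v → D ^ 2 ≤ 2 * v →
      (∀ k ≤ n, CondExpLE P (𝓖 k) (qsum ξ k) (2 * v)) → ∀ Y : Ω → ℝ, Measurable[𝓖 n] Y →
      ∫ ω, ((Y ω - psum ξ n ω) ^ 2 * varWeight v (Y ω)) ^ 2 ∂P ≤ K := by
  obtain ⟨C, hC, hmom⟩ := h.exists_condExpLE_psum_pow 2
  refine ⟨8 * (1 + 4 * C), by positivity, fun n v hv hDv hcond Y hY => ?_⟩
  have hw := bddMeas_varWeight hv hY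
  have hwΩ := hw.mono (h.le n)
  have hbdd : BddMeas mΩ fun ω => psum ξ n ω ^ (2 * 2) * varWeight v (Y ω) ^ 2 :=
    ((h.bddMeas_psum n).pow _).mul (hwΩ.pow 2)
  have hw2 : v ^ 2 * ∫ ω, varWeight v (Y ω) ^ 2 ∂P ≤ 1 := by
    rw [← integral_const_mul]
    simp only [← mul_pow]
    refine (integral_mono ((hwΩ.const_mul v).pow 2).integrable (integrable_const 1) fun ω =>
      pow_le_one₀ (mul_nonneg hv.le (varWeight_nonneg hv _)) (mul_varWeight_le_one hv _)).trans ?_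
    simp
  calc ∫ ω, ((Y ω - psum ξ n ω) ^ 2 * varWeight v (Y ω)) ^ 2 ∂P
      ≤ ∫ ω, 8 * (1 + psum ξ n ω ^ (2 * 2) * varWeight v (Y ω) ^ 2) ∂P :=
        integral_mono ((h.bddMeas_sub_psum_sq_mul_varWeight hY hv).pow 2).integrable
          (((BddMeas.const 1).add hbdd).const_mul 8).integrable
          fun ω => sq_sub_sq_mul_varWeight_le hv (Y ω) (psum ξ n ω)
    _ = 8 * (1 + ∫ ω, psum ξ n ω ^ (2 * 2) * varWeight v (Y ω) ^ 2 ∂P) := by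
        rw [integral_const_mul, integral_add (integrable_const 1) hbdd.integrable]
        simp
    _ ≤ 8 * (1 + C * (2 * v) ^ 2 * ∫ ω, varWeight v (Y ω) ^ 2 ∂P) := by
        gcongr
        exact (hmom n (2 * v) hDv hcond n le_rfl).integral_mul_le _ (hw.pow 2)
          fun ω => sq_nonneg _
    _ = 8 * (1 + 4 * C * (v ^ 2 * ∫ ω, varWeight v (Y ω) ^ 2 ∂P)) := by ring
    _ ≤ 8 * (1 + 4 * C * 1) := by gcongr
    _ = _ := by ring

/-- If the variances were unbounded, the normalized squares of `G`, whose expectations are bounded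
below and second moments bounded above, would keep `G` away from every bounded set with a
probability bounded below. -/
theorem exists_integral_qsum_le (h : IsRevMartDiff P 𝓖 ξ D)
    (hvar : CondVarDefectLE P 𝓖 ξ s) {G : Ω → ℝ} (hG : Measurable G) {Y : ℕ → Ω → ℝ}
    (hY : ∀ n, Measurable[𝓖 n] (Y n)) (hGY : ∀ n, ∀ᵐ ω ∂P, G ω = Y n ω - psum ξ n ω) :
    ∃ B, ∀ n, ∫ ω, qsum ξ n ω ∂P ≤ B := by
  obtain ⟨K, hK, hupper⟩ := h.exists_integral_sq_sub_psum_sq_mul_varWeight_le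
  obtain ⟨L, hL, hPL⟩ := exists_measureReal_lt_sq_lt (P := P) hG
    (by positivity : (0 : ℝ) < 1 / (16 * K))
  refine ⟨4 * L + 2 * s + D ^ 2, fun n => ?_⟩
  by_contra! hlarge
  set v : ℝ := ∫ ω, qsum ξ n ω ∂P with hvn
  have hD := sq_nonneg D
  have hs := hvar.nonneg
  have hv : 0 < v := by linarith
  have hlower := h.half_le_integral_sub_psum_sq_mul_varWeight hvar (hY n) hv hvn (by linarith)
  have hsq := hupper n v hv (by linarith) (fun k hk => h.condExpLE_qsum hvar (by
    linarith [h.integral_qsum_mono hk])) (Y n) (hY n)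
  have hXw := h.bddMeas_sub_psum_sq_mul_varWeight (hY n) hv
  have hLw := ((bddMeas_varWeight hv (hY n)).mono (h.le n)).const_mul L
  have hthr : ∫ ω, L * varWeight v (Y n ω) ∂P ≤ 1 / 4 := by
    refine (integral_mono hLw.integrable (integrable_const (L * v⁻¹)) fun ω =>
      mul_le_mul_of_nonneg_left (varWeight_le_inv hv _) hL.le).trans ?_
    simp only [integral_const, probReal_univ, one_smul]
    rw [← div_eq_mul_inv, div_le_iff₀ hv]
    linarith
  have hpz := sq_integral_sub_le_integral_sq_mul_measureReal_lt (P := P) hXw.1 hLw.1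
    (hXw.2.elim fun c hc => MemLp.of_bound hXw.1.aestronglyMeasurable c (Eventually.of_forall hc))
    hLw.integrable (fun ω => mul_nonneg (sq_nonneg _) (varWeight_nonneg hv _))
    (fun ω => mul_nonneg hL.le (varWeight_nonneg hv _)) (by linarith)
  have hset : P.real {ω | L * varWeight v (Y n ω) < (Y n ω - psum ξ n ω) ^ 2 * varWeight v (Y n ω)}
      = P.real {ω | L < G ω ^ 2} := by
    refine measureReal_congr ?_
    filter_upwards [hGY n] with ω hω
    have hw : 0 < varWeight v (Y n ω) := by unfold varWeight; positivity
    exact propext ((mul_lt_mul_iff_left₀ hw).trans (by rw [← hω]; rfl))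
  rw [hset] at hpz
  have hprob : (∫ ω, ((Y n ω - psum ξ n ω) ^ 2 * varWeight v (Y n ω)) ^ 2 ∂P)
      * P.real {ω | L < G ω ^ 2} < 1 / 16 :=
    calc _ ≤ K * P.real {ω | L < G ω ^ 2} := by gcongr
      _ < K * (1 / (16 * K)) := by gcongr
      _ = 1 / 16 := by field_simp
  nlinarith

theorem submartingale_psum_sub_sq (h : IsRevMartDiff P 𝓖 ξ D) (N : ℕ) :
    Submartingale (fun i ω => (psum ξ N ω - psum ξ (N - i) ω) ^ 2)
      (⟨fun i => 𝓖 (N - i), fun _ _ hij => h.anti (Nat.sub_le_sub_left hij N),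
        fun i => h.le (N - i)⟩ : Filtration ℕ mΩ) P := by
  have hbdd : ∀ i, BddMeas mΩ fun ω => (psum ξ N ω - psum ξ i ω) ^ 2 := fun i =>
    ((h.bddMeas_psum N).sub (h.bddMeas_psum i)).pow 2
  refine submartingale_of_setIntegral_le_succ
    (fun i => ((h.bddMeas_psum_sub (N.sub_le i)).pow 2).1.stronglyMeasurable)
    (fun i => (hbdd _).integrable) fun i A hA => ?_
  rcases le_or_gt N i with hNi | hiN
  · rw [Nat.sub_eq_zero_of_le hNi, Nat.sub_eq_zero_of_le (hNi.trans i.le_succ)]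
  obtain ⟨l, rfl⟩ : ∃ l, N = l + 1 + i := ⟨N - (i + 1), by omega⟩
  rw [Nat.add_sub_cancel, show l + 1 + i - (i + 1) = l by omega]
  replace hA : MeasurableSet[𝓖 (l + 1)] A := by
    rwa [← show l + 1 + i - i = l + 1 by omega]
  have hind : BddMeas (𝓖 (l + 1)) (A.indicator fun _ => (1 : ℝ)) :=
    ⟨measurable_const.indicator hA, 1, fun ω => by
      by_cases hω : ω ∈ A <;> simp [hω]⟩
  have hcross := h.orth l _ ((h.bddMeas_psum_sub (Nat.le_add_right (l + 1) i)).mul hind)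
  have hAΩ := h.le _ A hA
  have hci := ((h.bddMeas l).mul (((h.bddMeas_psum (l + 1 + i)).sub (h.bddMeas_psum (l + 1))).mul
    (hind.mono (h.le _)))).integrable (P := P)
  rw [← integral_indicator hAΩ, ← integral_indicator hAΩ]
  calc ∫ ω, A.indicator (fun ω => (psum ξ (l + 1 + i) ω - psum ξ (l + 1) ω) ^ 2) ω ∂P
      = ∫ ω, A.indicator (fun ω => (psum ξ (l + 1 + i) ω - psum ξ (l + 1) ω) ^ 2) ω
          + 2 * (ξ l ω * ((psum ξ (l + 1 + i) ω - psum ξ (l + 1) ω)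
            * A.indicator (fun _ => (1 : ℝ)) ω)) ∂P := by
        rw [integral_add ((hbdd _).integrable.indicator hAΩ) (hci.const_mul 2),
          integral_const_mul, hcross, mul_zero, add_zero]
    _ ≤ _ := by
        refine integral_mono (((hbdd _).integrable.indicator hAΩ).add (hci.const_mul 2))
          ((hbdd _).integrable.indicator hAΩ) fun ω => ?_
        by_cases hω : ω ∈ A
        · simp only [Set.indicator_of_mem hω, psum, Finset.sum_range_succ _ l]
          nlinarith [sq_nonneg (ξ l ω)]
        · simp [Set.indicator_of_notMem hω]

theorem measure_exists_le_abs_psum_sub_le (h : IsRevMartDiff P 𝓖 ξ D) {ε : ℝ} (hε : 0 < ε)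
    (n d : ℕ) :
    P {ω | ∃ i ∈ Set.Icc n (n + d), ε ≤ |psum ξ (n + d) ω - psum ξ i ω|} ≤
      ENNReal.ofReal ((∫ ω, (psum ξ (n + d) ω - psum ξ n ω) ^ 2 ∂P) / ε ^ 2) := by
  have hmax := maximal_ineq (h.submartingale_psum_sub_sq (n + d)) (fun _ _ => sq_nonneg _)
    (ε := (ε ^ 2).toNNReal) d
  have hsq : ((ε ^ 2).toNNReal : ℝ) = ε ^ 2 := Real.coe_toNNReal _ (sq_nonneg ε)
  rw [Nat.add_sub_cancel] at hmax
  rw [ENNReal.ofReal_div_of_pos (by positivity),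
    ENNReal.le_div_iff_mul_le (Or.inl (by simp [hε.ne'])) (Or.inl ENNReal.ofReal_ne_top), mul_comm]
  refine le_trans ?_ (hmax.trans (ENNReal.ofReal_le_ofReal (setIntegral_le_integral
    (((h.bddMeas_psum _).sub (h.bddMeas_psum _)).pow 2).integrable
    (Eventually.of_forall fun _ => sq_nonneg _))))
  refine mul_le_mul' le_rfl (measure_mono ?_)
  rintro ω ⟨i, ⟨hni, hin⟩, hi⟩
  refine hsq.trans_le (Finset.le_sup'_of_le _ (b := n + d - i)
    (Finset.mem_range.2 (by omega)) ?_)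
  rw [Nat.sub_sub_self hin, ← sq_abs (psum ξ _ ω - _)]
  gcongr

theorem integral_psum_sub_sq (h : IsRevMartDiff P 𝓖 ξ D) (n d : ℕ) :
    ∫ ω, (psum ξ (n + d) ω - psum ξ n ω) ^ 2 ∂P =
      ∑ i ∈ Finset.range d, ∫ ω, ξ (n + i) ω ^ 2 ∂P := by
  have hshift : IsRevMartDiff P (fun k => 𝓖 (n + k)) (fun k => ξ (n + k)) D :=
    ⟨fun a b hab => h.anti (Nat.add_le_add_left hab n), fun k => h.le _, fun k => h.meas _,
      fun k => h.bound _, fun k g hg => h.orth (n + k) g hg⟩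
  have hpsum : ∀ ω, psum ξ (n + d) ω - psum ξ n ω = psum (fun k => ξ (n + k)) d ω := fun ω => by
    simp only [psum, Finset.sum_range_add, add_sub_cancel_left]
  have hsq := hshift.integral_psum_sq_mul (n := d) (BddMeas.const 1)
  simp only [mul_one] at hsq
  simp only [hpsum, hsq, qsum]
  exact integral_finsetSum _ fun i _ => ((h.bddMeas (n + i)).pow 2).integrable

theorem summable_integral_sq (h : IsRevMartDiff P 𝓖 ξ D) {B : ℝ}
    (hB : ∀ n, ∫ ω, qsum ξ n ω ∂P ≤ B) : Summable fun k => ∫ ω, ξ k ω ^ 2 ∂P := by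
  refine summable_of_sum_range_le (c := B) (fun k => integral_nonneg fun ω => sq_nonneg _)
    fun n => ?_
  rw [← integral_finsetSum _ fun i _ => ((h.bddMeas i).pow 2).integrable]
  exact hB n

theorem measure_exists_ge_le_abs_psum_sub_le (h : IsRevMartDiff P 𝓖 ξ D)
    (hsum : Summable fun k => ∫ ω, ξ k ω ^ 2 ∂P) {ε : ℝ} (hε : 0 < ε) (n : ℕ) :
    P {ω | ∃ k ≥ n, ε ≤ dist (psum ξ k ω) (psum ξ n ω)} ≤
      ENNReal.ofReal ((∑' i, ∫ ω, ξ (i + n) ω ^ 2 ∂P) / (ε / 2) ^ 2) := by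
  have hunion : {ω | ∃ k ≥ n, ε ≤ dist (psum ξ k ω) (psum ξ n ω)} =
      ⋃ d : ℕ, {ω | ∃ k ∈ Set.Icc n (n + d), ε ≤ |psum ξ k ω - psum ξ n ω|} := by
    ext ω
    simp only [Set.mem_iUnion]
    exact ⟨fun ⟨k, hk, hkε⟩ => ⟨k - n, k, ⟨hk, by omega⟩, hkε⟩,
      fun ⟨_, k, hk, hkε⟩ => ⟨k, hk.1, hkε⟩⟩
  have hmono : Monotone fun d : ℕ =>
      {ω | ∃ k ∈ Set.Icc n (n + d), ε ≤ |psum ξ k ω - psum ξ n ω|} :=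
    fun a b hab ω ⟨k, hk, hkε⟩ => ⟨k, ⟨hk.1, hk.2.trans (by omega)⟩, hkε⟩
  rw [hunion, hmono.measure_iUnion]
  refine iSup_le fun d => ?_
  have hsub : {ω | ∃ k ∈ Set.Icc n (n + d), ε ≤ |psum ξ k ω - psum ξ n ω|} ⊆
      {ω | ∃ i ∈ Set.Icc n (n + d), ε / 2 ≤ |psum ξ (n + d) ω - psum ξ i ω|} := by
    rintro ω ⟨k, hk, hkε⟩
    by_contra! hlt
    have hlt' : ∀ i ∈ Set.Icc n (n + d), |psum ξ (n + d) ω - psum ξ i ω| < ε / 2 := by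
      simpa using hlt
    have htri := abs_sub_le (psum ξ k ω) (psum ξ (n + d) ω) (psum ξ n ω)
    rw [abs_sub_comm (psum ξ k ω) (psum ξ (n + d) ω)] at htri
    linarith [hlt' k hk, hlt' n ⟨le_rfl, n.le_add_right d⟩]
  refine (measure_mono hsub).trans ((h.measure_exists_le_abs_psum_sub_le (half_pos hε) n d).trans
    (ENNReal.ofReal_le_ofReal ?_))
  gcongr
  rw [h.integral_psum_sub_sq]
  simpa only [add_comm n] using ((summable_nat_add_iff n).2 hsum).sum_le_tsum (Finset.range d)
    fun i _ => integral_nonneg fun ω => sq_nonneg (ξ (i + n) ω)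

end IsRevMartDiff

theorem ae_exists_tendsto_of_tendsto_measure_exists_le_dist {Ω E : Type*} [MeasurableSpace Ω]
    {P : Measure Ω} [PseudoMetricSpace E] [CompleteSpace E] {f : ℕ → Ω → E}
    (hf : ∀ ε > 0, Tendsto (fun n => P {ω | ∃ k ≥ n, ε ≤ dist (f k ω) (f n ω)}) atTop (𝓝 0)) :
    ∀ᵐ ω ∂P, ∃ x, Tendsto (fun n => f n ω) atTop (𝓝 x) := by
  have hnull : ∀ l : ℕ, ∀ᵐ ω ∂P, ∃ n, ∀ k ≥ n, dist (f k ω) (f n ω) < 1 / ((l : ℝ) + 1) := by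
    intro l
    rw [ae_iff]
    refine le_antisymm (ge_of_tendsto' (hf (1 / (l + 1)) Nat.one_div_pos_of_nat)
      fun n => ?_) zero_le
    refine measure_mono fun ω hω => ?_
    simp only [Set.mem_ofPred_eq] at hω ⊢
    push Not at hω
    exact hω n
  filter_upwards [ae_all_iff.2 hnull] with ω hω
  refine cauchySeq_tendsto_of_complete (Metric.cauchySeq_iff'.2 fun ε hε => ?_)
  obtain ⟨l, hl⟩ := exists_nat_one_div_lt hε
  exact (hω l).imp fun n hn k hk => (hn k hk).trans hl

theorem unifIntegrable_of_eLpNorm_le {Ω ι E : Type*} [MeasurableSpace Ω] [NormedAddCommGroup E]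
    {P : Measure Ω} {f : ι → Ω → E} {p q : ℝ≥0∞} (hp : p ≠ 0) (hpq : p < q)
    (hf : ∀ i, AEStronglyMeasurable (f i) P) {K : ℝ≥0} (hK : ∀ i, eLpNorm (f i) q P ≤ K) :
    UnifIntegrable f p P := by
  intro ε hε
  set r : ℝ := 1 / p.toReal - 1 / q.toReal with hr
  have hp0 : 0 < p.toReal := ENNReal.toReal_pos hp hpq.ne_top
  have hr0 : 0 < r := by
    rw [hr, sub_pos]
    rcases eq_or_ne q ∞ with rfl | hq
    · simpa using hp0
    · exact one_div_lt_one_div_of_lt hp0 ((ENNReal.toReal_lt_toReal hpq.ne_top hq).2 hpq)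
  refine ⟨(ε / (K + 1)) ^ (1 / r), by positivity, fun i s hs hPs => ?_⟩
  rw [eLpNorm_indicator_eq_eLpNorm_restrict hs]
  calc eLpNorm (f i) p (P.restrict s)
      ≤ eLpNorm (f i) q (P.restrict s) * (P.restrict s Set.univ) ^ r :=
        eLpNorm_le_eLpNorm_mul_rpow_measure_univ hpq.le (hf i).restrict
    _ ≤ K * (ENNReal.ofReal ((ε / (K + 1)) ^ (1 / r))) ^ r := by
        rw [Measure.restrict_apply_univ]
        gcongr
        exact (eLpNorm_restrict_le _ _ _ _).trans (hK i)
    _ = ENNReal.ofReal (K * (ε / (K + 1))) := by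
        rw [ENNReal.ofReal_rpow_of_nonneg (by positivity) hr0.le, ← Real.rpow_mul (by positivity),
          one_div_mul_cancel hr0.ne', Real.rpow_one, ENNReal.ofReal_mul (by positivity)]
        simp
    _ ≤ ENNReal.ofReal ε := by
        refine ENNReal.ofReal_le_ofReal ?_
        rw [mul_div_assoc', div_le_iff₀ (by positivity)]
        nlinarith [K.coe_nonneg]

/-- `S` is the sum of the series `∑ ξ k`, almost everywhere and in `L^p` for all `1 ≤ p < ∞`. -/
structure IsPsumLimit {Ω : Type*} [MeasurableSpace Ω] (P : Measure Ω) (ξ : ℕ → Ω → ℝ)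
    (S : Ω → ℝ) : Prop where
  tendsto : ∀ᵐ ω ∂P, Tendsto (fun n => psum ξ n ω) atTop (𝓝 (S ω))
  memLp : ∀ p : ℝ≥0∞, 1 ≤ p → p ≠ ∞ → MemLp S p P
  exists_eLpNorm_le : ∀ p : ℝ≥0∞, 1 ≤ p → p ≠ ∞ → ∃ K : ℝ≥0, ∀ n, eLpNorm (psum ξ n) p P ≤ K
  tendsto_eLpNorm : ∀ p : ℝ≥0∞, 1 ≤ p → p ≠ ∞ →
    Tendsto (fun n => eLpNorm (fun ω => psum ξ n ω - S ω) p P) atTop (𝓝 0)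

namespace IsRevMartDiff

variable {Ω : Type*} [mΩ : MeasurableSpace Ω] {P : Measure Ω} [IsProbabilityMeasure P]
  {𝓖 : ℕ → MeasurableSpace Ω} {ξ : ℕ → Ω → ℝ} {D s : ℝ}

theorem ae_exists_tendsto_psum (h : IsRevMartDiff P 𝓖 ξ D) {B : ℝ}
    (hB : ∀ n, ∫ ω, qsum ξ n ω ∂P ≤ B) :
    ∀ᵐ ω ∂P, ∃ x, Tendsto (fun n => psum ξ n ω) atTop (𝓝 x) := by
  refine ae_exists_tendsto_of_tendsto_measure_exists_le_dist fun ε hε => ?_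
  have htail := ENNReal.tendsto_ofReal
    ((tendsto_sum_nat_add fun k => ∫ ω, ξ k ω ^ 2 ∂P).div_const ((ε / 2) ^ 2))
  rw [zero_div, ENNReal.ofReal_zero] at htail
  exact tendsto_of_tendsto_of_tendsto_of_le_of_le tendsto_const_nhds htail (fun _ => zero_le)
    (h.measure_exists_ge_le_abs_psum_sub_le (h.summable_integral_sq hB) hε)

theorem exists_eLpNorm_psum_le (h : IsRevMartDiff P 𝓖 ξ D)
    (hvar : CondVarDefectLE P 𝓖 ξ s) {B : ℝ} (hB : ∀ n, ∫ ω, qsum ξ n ω ∂P ≤ B) {p : ℝ≥0∞}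
    (hp : p ≠ ∞) : ∃ K : ℝ≥0, ∀ n, eLpNorm (psum ξ n) p P ≤ K := by
  obtain ⟨q, hq⟩ := ENNReal.exists_nat_gt hp
  obtain ⟨C, -, hmom⟩ := h.exists_condExpLE_psum_pow (q + 1)
  have hs := hvar.nonneg
  have hB0 : 0 ≤ B := by simpa [qsum] using hB 0
  have hD := sq_nonneg D
  have hr0 : ((2 * (q + 1) : ℕ) : ℝ≥0∞) ≠ 0 := by exact_mod_cast (by omega : 2 * (q + 1) ≠ 0)
  refine ⟨((C * (B + s + D ^ 2) ^ (q + 1)) ^ (((2 * (q + 1) : ℕ) : ℝ≥0∞).toReal)⁻¹).toNNReal,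
    fun n => ?_⟩
  obtain ⟨hm, c, hc⟩ := h.bddMeas_psum n
  have hpr : p ≤ ((2 * (q + 1) : ℕ) : ℝ≥0∞) := hq.le.trans (by exact_mod_cast by omega)
  refine (eLpNorm_le_eLpNorm_of_exponent_le hpr hm.aestronglyMeasurable).trans ?_
  rw [MemLp.eLpNorm_eq_integral_rpow_norm hr0 (ENNReal.natCast_ne_top _)
    (MemLp.of_bound hm.aestronglyMeasurable c (Eventually.of_forall hc))]
  refine ENNReal.ofReal_le_ofReal (Real.rpow_le_rpow (integral_nonneg fun ω => by positivity) ?_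
    (by positivity))
  have hmoment := (hmom n (B + s + D ^ 2) (by linarith)
    (fun k _ => h.condExpLE_qsum hvar (by linarith [hB k])) n le_rfl).integral_mul_le
      (fun _ => 1) (.const 1) fun _ => zero_le_one
  simp only [mul_one, integral_const, probReal_univ, smul_eq_mul] at hmoment
  simpa only [ENNReal.toReal_natCast, Real.rpow_natCast, Real.norm_eq_abs,
    Even.pow_abs (even_two_mul (q + 1))] using hmoment

theorem exists_isPsumLimit (h : IsRevMartDiff P 𝓖 ξ D) (hvar : CondVarDefectLE P 𝓖 ξ s)
    {G : Ω → ℝ} (hG : Measurable G) {Y : ℕ → Ω → ℝ} (hY : ∀ n, Measurable[𝓖 n] (Y n))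
    (hGY : ∀ n, ∀ᵐ ω ∂P, G ω = Y n ω - psum ξ n ω) :
    ∃ S : Ω → ℝ, IsPsumLimit P ξ S := by
  obtain ⟨B, hB⟩ := h.exists_integral_qsum_le hvar hG hY hGY
  have hm : ∀ n, AEStronglyMeasurable (psum ξ n) P := fun n =>
    (h.bddMeas_psum n).1.aestronglyMeasurable
  obtain ⟨S, -, hS⟩ := measurable_limit_of_tendsto_metrizable_ae
    (fun n => (hm n).aemeasurable) (h.ae_exists_tendsto_psum hB)
  have hSp (p : ℝ≥0∞) (hp : p ≠ ∞) : MemLp S p P := by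
    obtain ⟨K, hK⟩ := h.exists_eLpNorm_psum_le hvar hB hp
    exact ⟨aestronglyMeasurable_of_tendsto_ae atTop hm hS,
      ((Lp.eLpNorm_lim_le_liminf_eLpNorm hm S hS).trans
        (liminf_le_of_le (h := fun b hb => hb.exists.elim fun n hn => hn.trans (hK n)))).trans_lt
        ENNReal.coe_lt_top⟩
  refine ⟨S, hS, fun p _ hp => hSp p hp,
    fun p _ hp => h.exists_eLpNorm_psum_le hvar hB hp, fun p hp1 hp => ?_⟩
  obtain ⟨K, hK⟩ := h.exists_eLpNorm_psum_le hvar hB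
    (ENNReal.add_ne_top.2 ⟨hp, ENNReal.one_ne_top⟩)
  exact tendsto_Lp_finite_of_tendsto_ae hp1 hp hm (hSp p hp)
    (unifIntegrable_of_eLpNorm_le (by positivity) (ENNReal.lt_add_right hp one_ne_zero) hm hK) hS

end IsRevMartDiff

/-! ### Transfer operators -/

section Transfer

theorem mul_indicator_one {Y : Type*} (f : Y → ℝ) (s : Set Y) (y : Y) :
    f y * s.indicator (fun _ => (1 : ℝ)) y = s.indicator f y := by
  by_cases hy : y ∈ s <;> simp [hy]

variable {X Y : Type*} [MeasurableSpace X] [MeasurableSpace Y] {μ : Measure X} {ν : Measure Y}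
  {T : X → Y} {φ φ' : X → ℝ}

theorem memLp_top_comp (hT : Measure.QuasiMeasurePreserving T μ ν) {ψ : Y → ℝ}
    (hψ : MemLp ψ ∞ ν) : MemLp (fun x => ψ (T x)) ∞ μ := by
  refine ⟨hψ.1.comp_quasiMeasurePreserving hT, lt_of_le_of_lt ?_ hψ.2⟩
  rw [eLpNorm_exponent_top, eLpNorm_exponent_top]
  exact essSup_le_of_ae_le _ (hT.ae (ae_le_eLpNormEssSup (f := ψ) (μ := ν)))

theorem integrable_mul_comp (hT : Measure.QuasiMeasurePreserving T μ ν) (hφ : Integrable φ μ)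
    {ψ : Y → ℝ} (hψ : MemLp ψ ∞ ν) : Integrable (fun x => φ x * ψ (T x)) μ :=
  hφ.mul_of_top_left (memLp_top_comp hT hψ)

variable [IsProbabilityMeasure ν]

theorem memLp_top_indicator {s : Set Y} (hs : MeasurableSet s) :
    MemLp (s.indicator fun _ => (1 : ℝ)) ∞ ν :=
  memLp_indicator_const ∞ hs 1 (Or.inr (measure_ne_top ν s))

variable [IsProbabilityMeasure μ]

theorem ae_eq_transfer (hT : Measure.QuasiMeasurePreserving T μ ν) (hφ : Integrable φ μ)
    {f : Y → ℝ} (hf : Integrable f ν)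
    (h : ∀ ψ : Y → ℝ, MemLp ψ ∞ ν → ∫ y, f y * ψ y ∂ν = ∫ x, φ x * ψ (T x) ∂μ) :
    f =ᵐ[ν] transfer μ ν T φ := by
  refine Integrable.ae_eq_of_forall_setIntegral_eq _ _ hf (transfer_integrable hφ) fun s hs _ => ?_
  have hdual := h _ (memLp_top_indicator hs)
  rw [← transfer_duality hT hφ (memLp_top_indicator hs)] at hdual
  simpa only [mul_indicator_one, integral_indicator hs] using hdual

theorem integral_transfer (hT : Measure.QuasiMeasurePreserving T μ ν) (hφ : Integrable φ μ) :
    ∫ y, transfer μ ν T φ y ∂ν = ∫ x, φ x ∂μ := by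
  simpa using transfer_duality hT hφ (memLp_const 1 : MemLp (fun _ : Y => (1 : ℝ)) ∞ ν)

theorem transfer_add (hT : Measure.QuasiMeasurePreserving T μ ν) (hφ : Integrable φ μ)
    (hφ' : Integrable φ' μ) :
    transfer μ ν T (fun x => φ x + φ' x) =ᵐ[ν]
      fun y => transfer μ ν T φ y + transfer μ ν T φ' y := by
  have hint {f : X → ℝ} (hf : Integrable f μ) {ψ : Y → ℝ} (hψ : MemLp ψ ∞ ν) :
      Integrable (fun y => transfer μ ν T f y * ψ y) ν :=
    (transfer_integrable hf).mul_of_top_left hψ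
  refine (ae_eq_transfer hT (hφ.add hφ')
    ((transfer_integrable hφ).add (transfer_integrable hφ')) fun ψ hψ => ?_).symm
  simp only [Pi.add_apply, add_mul]
  rw [integral_add (hint hφ hψ) (hint hφ' hψ),
    integral_add (integrable_mul_comp hT hφ hψ) (integrable_mul_comp hT hφ' hψ),
    transfer_duality hT hφ hψ, transfer_duality hT hφ' hψ]

theorem transfer_const_mul (hT : Measure.QuasiMeasurePreserving T μ ν) (hφ : Integrable φ μ)
    (c : ℝ) :
    transfer μ ν T (fun x => c * φ x) =ᵐ[ν] fun y => c * transfer μ ν T φ y := by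
  refine (ae_eq_transfer hT (hφ.const_mul c)
    ((transfer_integrable hφ).const_mul c) fun ψ hψ => ?_).symm
  simp only [mul_assoc]
  rw [integral_const_mul, integral_const_mul, transfer_duality hT hφ hψ]

theorem transfer_sub (hT : Measure.QuasiMeasurePreserving T μ ν) (hφ : Integrable φ μ)
    (hφ' : Integrable φ' μ) :
    transfer μ ν T (fun x => φ x - φ' x) =ᵐ[ν]
      fun y => transfer μ ν T φ y - transfer μ ν T φ' y := by
  have hadd := transfer_add hT hφ (hφ'.const_mul (-1))
  have hneg := transfer_const_mul (ν := ν) hT hφ' (-1)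
  simp only [neg_one_mul, ← sub_eq_add_neg] at hadd hneg
  filter_upwards [hadd, hneg] with y hadd hneg
  rw [hadd, hneg, sub_eq_add_neg]

theorem transfer_nonneg (hT : Measure.QuasiMeasurePreserving T μ ν) (hφ : Integrable φ μ)
    (h0 : ∀ᵐ x ∂μ, 0 ≤ φ x) : ∀ᵐ y ∂ν, 0 ≤ transfer μ ν T φ y := by
  refine ae_nonneg_of_forall_setIntegral_nonneg (transfer_integrable hφ) fun s hs _ => ?_
  have hdual := transfer_duality hT hφ (memLp_top_indicator (ν := ν) hs)
  simp only [mul_indicator_one, integral_indicator hs] at hdual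
  rw [hdual]
  exact integral_nonneg_of_ae (h0.mono fun x hx =>
    mul_nonneg hx (Set.indicator_nonneg (fun _ _ => zero_le_one) _))

theorem transfer_mono (hT : Measure.QuasiMeasurePreserving T μ ν) (hφ : Integrable φ μ)
    (hφ' : Integrable φ' μ) (h : ∀ᵐ x ∂μ, φ x ≤ φ' x) :
    ∀ᵐ y ∂ν, transfer μ ν T φ y ≤ transfer μ ν T φ' y := by
  have hnonneg := transfer_nonneg (ν := ν) hT (hφ'.sub hφ) (h.mono fun x hx => sub_nonneg.2 hx)
  filter_upwards [hnonneg, transfer_sub hT hφ' hφ] with y hnonneg hsub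
  exact sub_nonneg.1 (hsub ▸ hnonneg)

theorem abs_transfer_le (hT : Measure.QuasiMeasurePreserving T μ ν) (hφ : Integrable φ μ)
    (hφ' : Integrable φ' μ) (h : ∀ᵐ x ∂μ, |φ x| ≤ φ' x) :
    ∀ᵐ y ∂ν, |transfer μ ν T φ y| ≤ transfer μ ν T φ' y := by
  have hupper := transfer_mono hT hφ hφ' (h.mono fun x hx => (abs_le.1 hx).2)
  have hlower := transfer_mono hT (hφ'.const_mul (-1)) hφ
    (h.mono fun x hx => by simpa using (abs_le.1 hx).1)
  filter_upwards [hupper, hlower, transfer_const_mul (ν := ν) hT hφ' (-1)] with y hupper hlower hneg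
  rw [hneg, neg_one_mul] at hlower
  exact abs_le.2 ⟨hlower, hupper⟩

end Transfer

section Iterates

variable {X : ℕ → Type*} (T : ∀ j, X j → X (j + 1))

@[simp]
theorem orbit_self {j : ℕ} (h : j ≤ j) (x : X j) : orbit T h x = x :=
  Nat.leRecOn_self x

theorem orbit_succ {j k : ℕ} (h : j ≤ k) (h' : j ≤ k + 1) (x : X j) :
    orbit T h' x = T k (orbit T h x) :=
  Nat.leRecOn_succ h x

theorem orbit_trans {i j k : ℕ} (h : i ≤ j) (h' : j ≤ k) (h'' : i ≤ k) (x : X i) :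
    orbit T h'' x = orbit T h' (orbit T h x) :=
  Nat.leRecOn_trans h h' x

theorem orbit_succ_left {j k : ℕ} (h : j ≤ k) (h' : j + 1 ≤ k) (x : X j) :
    orbit T h x = orbit T h' (T j x) := by
  rw [orbit_trans T (Nat.le_succ j) h' h, orbit_succ T le_rfl (Nat.le_succ j), orbit_self]

variable [∀ j, MeasurableSpace (X j)] (m : ∀ j, Measure (X j))

@[simp]
theorem transferIter_self {j : ℕ} (h : j ≤ j) (φ : X j → ℝ) : transferIter m T h φ = φ :=
  Nat.leRecOn_self (C := fun i => X i → ℝ) φ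

theorem transferIter_succ {j k : ℕ} (h : j ≤ k) (h' : j ≤ k + 1) (φ : X j → ℝ) :
    transferIter m T h' φ = transfer (m k) (m (k + 1)) (T k) (transferIter m T h φ) :=
  Nat.leRecOn_succ (C := fun i => X i → ℝ) h φ

theorem transferIter_trans {i j k : ℕ} (h : i ≤ j) (h' : j ≤ k) (h'' : i ≤ k) (φ : X i → ℝ) :
    transferIter m T h'' φ = transferIter m T h' (transferIter m T h φ) :=
  Nat.leRecOn_trans (C := fun i => X i → ℝ) h h' φ

/-- The density with respect to `m j` of the law of `T_0^{(j)}` under `m 0`. -/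
noncomputable def dens (j : ℕ) : X j → ℝ :=
  transferIter m T (Nat.zero_le j) fun _ => 1

theorem dens_zero : dens T m 0 = fun _ => 1 := transferIter_self T m _ _

theorem dens_succ (j : ℕ) :
    dens T m (j + 1) = transfer (m j) (m (j + 1)) (T j) (dens T m j) :=
  transferIter_succ T m (Nat.zero_le j) _ _

theorem transferIter_dens {j k : ℕ} (h : j ≤ k) : transferIter m T h (dens T m j) = dens T m k :=
  (transferIter_trans T m (Nat.zero_le j) h (Nat.zero_le k) _).symm

variable {T m}

theorem quasiMeasurePreserving_orbit
    (hT : ∀ j, Measure.QuasiMeasurePreserving (T j) (m j) (m (j + 1))) {j k : ℕ} (h : j ≤ k) :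
    Measure.QuasiMeasurePreserving (orbit T h) (m j) (m k) := by
  induction k, h using Nat.le_induction with
  | base =>
    rw [show orbit T (le_refl j) = id from funext fun x => orbit_self T _ x]
    exact .id _
  | succ k h ih =>
    rw [show orbit T (Nat.le_succ_of_le h) = T k ∘ orbit T h from
      funext fun x => orbit_succ T h _ x]
    exact (hT k).comp ih

variable [∀ j, IsProbabilityMeasure (m j)]

theorem transferIter_integrable {j k : ℕ} (h : j ≤ k) {φ : X j → ℝ} (hφ : Integrable φ (m j)) :
    Integrable (transferIter m T h φ) (m k) := by
  induction k, h using Nat.le_induction with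
  | base => simpa
  | succ k h ih =>
    rw [transferIter_succ T m h]
    exact transfer_integrable ih

theorem integral_transferIter_mul
    (hT : ∀ j, Measure.QuasiMeasurePreserving (T j) (m j) (m (j + 1))) {j k : ℕ} (h : j ≤ k)
    {φ : X j → ℝ} (hφ : Integrable φ (m j)) {ψ : X k → ℝ} (hψ : MemLp ψ ∞ (m k)) :
    ∫ y, transferIter m T h φ y * ψ y ∂(m k) = ∫ x, φ x * ψ (orbit T h x) ∂(m j) := by
  induction k, h using Nat.le_induction with
  | base => simp
  | succ k h ih =>
    rw [transferIter_succ T m h, transfer_duality (hT k) (transferIter_integrable h hφ) hψ,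
      ih (memLp_top_comp (hT k) hψ)]
    simp only [orbit_succ T h]

theorem transferIter_ae_eq
    (hT : ∀ j, Measure.QuasiMeasurePreserving (T j) (m j) (m (j + 1))) {j k : ℕ} (h : j ≤ k)
    {φ : X j → ℝ} (hφ : Integrable φ (m j)) :
    transferIter m T h φ =ᵐ[m k] transfer (m j) (m k) (orbit T h) φ :=
  ae_eq_transfer (quasiMeasurePreserving_orbit hT h) hφ (transferIter_integrable h hφ)
    fun _ => integral_transferIter_mul hT h hφ

theorem dens_integrable (j : ℕ) : Integrable (dens T m j) (m j) :=
  transferIter_integrable _ (integrable_const _)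

theorem integral_dens_mul
    (hT : ∀ j, Measure.QuasiMeasurePreserving (T j) (m j) (m (j + 1))) (j : ℕ)
    {ψ : X j → ℝ} (hψ : MemLp ψ ∞ (m j)) :
    ∫ y, dens T m j y * ψ y ∂(m j) = ∫ x, ψ (orbit T (Nat.zero_le j) x) ∂(m 0) := by
  simpa [dens] using integral_transferIter_mul hT (Nat.zero_le j) (integrable_const (1 : ℝ)) hψ

theorem integral_dens
    (hT : ∀ j, Measure.QuasiMeasurePreserving (T j) (m j) (m (j + 1))) (j : ℕ) :
    ∫ y, dens T m j y ∂(m j) = 1 := by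
  simpa using integral_dens_mul hT j (memLp_const (1 : ℝ))

theorem dens_nonneg
    (hT : ∀ j, Measure.QuasiMeasurePreserving (T j) (m j) (m (j + 1))) (j : ℕ) :
    ∀ᵐ y ∂(m j), 0 ≤ dens T m j y := by
  filter_upwards [transferIter_ae_eq hT (Nat.zero_le j) (integrable_const (1 : ℝ)),
    transfer_nonneg (quasiMeasurePreserving_orbit hT (Nat.zero_le j))
      (integrable_const (1 : ℝ)) (.of_forall fun _ => zero_le_one)] with y heq hnonneg
  exact hnonneg.trans_eq heq.symm

theorem transferIter_add (hT : ∀ j, Measure.QuasiMeasurePreserving (T j) (m j) (m (j + 1)))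
    {j k : ℕ} (h : j ≤ k) {φ φ' : X j → ℝ} (hφ : Integrable φ (m j))
    (hφ' : Integrable φ' (m j)) :
    transferIter m T h (fun x => φ x + φ' x) =ᵐ[m k]
      fun y => transferIter m T h φ y + transferIter m T h φ' y := by
  filter_upwards [transferIter_ae_eq hT h hφ, transferIter_ae_eq hT h hφ',
    transferIter_ae_eq hT h (hφ.fun_add hφ'),
    transfer_add (quasiMeasurePreserving_orbit hT h) hφ hφ'] with y hy hy' hsum hadd
  rw [hsum, hadd, hy, hy']

theorem transferIter_const_mul
    (hT : ∀ j, Measure.QuasiMeasurePreserving (T j) (m j) (m (j + 1)))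
    {j k : ℕ} (h : j ≤ k) {φ : X j → ℝ} (hφ : Integrable φ (m j)) (c : ℝ) :
    transferIter m T h (fun x => c * φ x) =ᵐ[m k] fun y => c * transferIter m T h φ y := by
  filter_upwards [transferIter_ae_eq hT h hφ, transferIter_ae_eq hT h (hφ.const_mul c),
    transfer_const_mul (quasiMeasurePreserving_orbit hT h) hφ c] with y hy hprod hmul
  rw [hprod, hmul, hy]

theorem abs_transferIter_le (hT : ∀ j, Measure.QuasiMeasurePreserving (T j) (m j) (m (j + 1)))
    {j k : ℕ} (h : j ≤ k) {φ : X j → ℝ} (hφ : Integrable φ (m j)) {s : ℝ}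
    (hs : ∀ᵐ x ∂(m j), |φ x| ≤ s * dens T m j x) :
    ∀ᵐ y ∂(m k), |transferIter m T h φ y| ≤ s * dens T m k y := by
  have hdens := dens_integrable (m := m) (T := T) j
  filter_upwards [transferIter_ae_eq hT h hφ, transferIter_ae_eq hT h (hdens.const_mul s),
    transferIter_const_mul hT h hdens s,
    abs_transfer_le (quasiMeasurePreserving_orbit hT h) hφ (hdens.const_mul s) hs]
    with y hφy hprod hmul hle
  rwa [← hφy, ← hprod, hmul, transferIter_dens] at hle

theorem eLpNorm_one_le_of_abs_le_dens
    (hT : ∀ j, Measure.QuasiMeasurePreserving (T j) (m j) (m (j + 1))) {j : ℕ} {φ : X j → ℝ}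
    (hφ : Integrable φ (m j)) {s : ℝ≥0} (hs : ∀ᵐ x ∂(m j), |φ x| ≤ s * dens T m j x) :
    eLpNorm φ 1 (m j) ≤ s := by
  have hint : ∫ x, ‖φ x‖ ∂(m j) ≤ s :=
    calc ∫ x, ‖φ x‖ ∂(m j) ≤ ∫ x, s * dens T m j x ∂(m j) :=
          integral_mono_ae hφ.norm ((dens_integrable j).const_mul _) hs
      _ = s := by rw [integral_const_mul, integral_dens hT, mul_one]
  rw [eLpNorm_one_eq_lintegral_enorm, ← ofReal_integral_norm_eq_lintegral_enorm hφ]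
  exact ENNReal.ofReal_le_of_le_toReal hint

end Iterates

section Norm

theorem eLpNorm_le_of_ae_abs_le {Y : Type*} [MeasurableSpace Y] {μ : Measure Y}
    [IsProbabilityMeasure μ] {f : Y → ℝ} {a : ℝ≥0} (h : ∀ᵐ x ∂μ, |f x| ≤ a) (p : ℝ≥0∞) :
    eLpNorm f p μ ≤ a := by
  simpa using eLpNorm_le_of_ae_bound (f := f) (p := p) h

variable {X : ℕ → Type*} [∀ j, MeasurableSpace (X j)] {m : ∀ j, Measure (X j)}
  {var : ∀ j, (X j → ℝ) → ℝ≥0∞}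

/-- `φ ∈ 𝓑_j` with norm at most `b`. Finite bounds are kept explicit because all estimates have to
be uniform in `j`. -/
def BNormLE (m : ∀ j, Measure (X j)) (var : ∀ j, (X j → ℝ) → ℝ≥0∞) (j : ℕ) (φ : X j → ℝ)
    (b : ℝ≥0) : Prop :=
  Integrable φ (m j) ∧ bNorm (m j) (var j) φ ≤ b

/-- A common constant in the sup-norm bound and in the product inequality of a sequence of notions
of variation. -/
structure IsVarConst (m : ∀ j, Measure (X j)) (var : ∀ j, (X j → ℝ) → ℝ≥0∞) (C : ℝ≥0) :
    Prop where
  one_le : 1 ≤ C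
  sup_le : ∀ j (f : X j → ℝ), Integrable f (m j) → eLpNorm f ∞ (m j) ≤ C * bNorm (m j) (var j) f
  mul_le : ∀ j (f g : X j → ℝ), MemB (m j) (var j) f → MemB (m j) (var j) g →
    var j (fun x => f x * g x) ≤
      C * (eLpNorm f ∞ (m j) * var j g + eLpNorm g ∞ (m j) * var j f)

theorem IsVariation.exists_isVarConst (hv : IsVariation m var) : ∃ C, IsVarConst m var C := by
  obtain ⟨C, hC⟩ := hv.sup_le
  obtain ⟨C', hC'⟩ := hv.mul_le
  refine ⟨1 + C + C', le_add_right le_self_add, fun j f hf => (hC j f hf).trans ?_,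
    fun j f g hf hg => (hC' j f g hf hg).trans ?_⟩
  · gcongr
    exact le_add_right le_add_self
  · gcongr
    exact le_add_self

namespace BNormLE

variable {j : ℕ} {f g : X j → ℝ} {a b C : ℝ≥0}

theorem mono (hf : BNormLE m var j f a) (h : a ≤ b) : BNormLE m var j f b :=
  ⟨hf.1, hf.2.trans (by exact_mod_cast h)⟩

theorem of_memB (hf : MemB (m j) (var j) f) :
    BNormLE m var j f (bNorm (m j) (var j) f).toNNReal := by
  refine ⟨hf.1, ?_⟩
  rw [ENNReal.coe_toNNReal]
  exact (ENNReal.add_lt_top.2 ⟨(memLp_one_iff_integrable.2 hf.1).2, hf.2⟩).ne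

theorem memB (hf : BNormLE m var j f a) : MemB (m j) (var j) f :=
  ⟨hf.1, (le_add_self.trans hf.2).trans_lt ENNReal.coe_lt_top⟩

theorem var_le (hf : BNormLE m var j f a) : var j f ≤ a := le_add_self.trans hf.2

theorem eLpNorm_one_le (hf : BNormLE m var j f a) : eLpNorm f 1 (m j) ≤ a :=
  le_self_add.trans hf.2

theorem congr_ae (hv : IsVariation m var) (hf : BNormLE m var j f a) (h : f =ᵐ[m j] g) :
    BNormLE m var j g a := by
  refine ⟨hf.1.congr h, le_of_eq_of_le ?_ hf.2⟩
  rw [bNorm, bNorm, hv.congr_ae j f g hf.1 h, eLpNorm_congr_ae h]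

theorem add (hv : IsVariation m var) (hf : BNormLE m var j f a) (hg : BNormLE m var j g b) :
    BNormLE m var j (fun x => f x + g x) (a + b) := by
  refine ⟨hf.1.add hg.1, ?_⟩
  calc bNorm (m j) (var j) (fun x => f x + g x)
      ≤ (eLpNorm f 1 (m j) + eLpNorm g 1 (m j)) + (var j f + var j g) :=
        add_le_add (eLpNorm_add_le hf.1.1 hg.1.1 le_rfl) (hv.add_le j f g hf.1 hg.1)
    _ = bNorm (m j) (var j) f + bNorm (m j) (var j) g := by simp only [bNorm]; ring
    _ ≤ (a + b : ℝ≥0) := by push_cast; exact add_le_add hf.2 hg.2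

theorem const_mul (hv : IsVariation m var) (hf : BNormLE m var j f a) (t : ℝ) :
    BNormLE m var j (fun x => t * f x) (‖t‖₊ * a) := by
  refine ⟨hf.1.const_mul t, ?_⟩
  have hnorm : eLpNorm (fun x => t * f x) 1 (m j) = ‖t‖ₑ * eLpNorm f 1 (m j) :=
    eLpNorm_const_smul t f 1 (m j)
  rw [bNorm, hnorm, hv.smul j t f hf.1, ← Real.enorm_eq_ofReal_abs, ← mul_add]
  push_cast
  exact mul_le_mul_right hf.2 _

theorem sub (hv : IsVariation m var) (hf : BNormLE m var j f a) (hg : BNormLE m var j g b) :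
    BNormLE m var j (fun x => f x - g x) (a + b) := by
  simpa [sub_eq_add_neg] using hf.add hv (hg.const_mul hv (-1))

theorem zero (hv : IsVariation m var) (j : ℕ) : BNormLE m var j (fun _ => 0) 0 := by
  have hvar : var j (fun _ => 0) = 0 := by
    simpa using hv.smul j 0 (fun _ => 0) (integrable_zero _ _ _)
  exact ⟨integrable_zero _ _ _, by simp [bNorm, hvar]⟩

theorem sum (hv : IsVariation m var) {ι : Type*} {f : ι → X j → ℝ} {a : ι → ℝ≥0}
    (hf : ∀ i, BNormLE m var j (f i) (a i)) (s : Finset ι) :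
    BNormLE m var j (fun x => ∑ i ∈ s, f i x) (∑ i ∈ s, a i) := by
  classical
  induction s using Finset.induction_on with
  | empty => simpa using zero hv j
  | insert i s hi ih =>
    simp only [Finset.sum_insert hi]
    exact (hf i).add hv ih

theorem eLpNorm_top_le (hC : IsVarConst m var C) (hf : BNormLE m var j f a) :
    eLpNorm f ∞ (m j) ≤ C * a :=
  (hC.sup_le j f hf.1).trans (mul_le_mul_right hf.2 _)

theorem ae_abs_le (hC : IsVarConst m var C) (hf : BNormLE m var j f a) :
    ∀ᵐ x ∂(m j), |f x| ≤ C * a := by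
  have hsup := hf.eLpNorm_top_le hC
  rw [eLpNorm_exponent_top] at hsup
  filter_upwards [ae_le_eLpNormEssSup (f := f) (μ := m j)] with x hx
  have hx := hx.trans hsup
  rw [enorm_eq_nnnorm] at hx
  exact_mod_cast hx

theorem memLp_top (hC : IsVarConst m var C) (hf : BNormLE m var j f a) : MemLp f ∞ (m j) :=
  memLp_top_of_bound hf.1.1 _ (hf.ae_abs_le hC)

theorem mul (hC : IsVarConst m var C) (hf : BNormLE m var j f a) (hg : BNormLE m var j g b) :
    BNormLE m var j (fun x => f x * g x) (3 * C ^ 2 * (a * b)) := by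
  refine ⟨hf.1.mul_of_top_left (hg.memLp_top hC), ?_⟩
  have hnorm : eLpNorm (fun x => f x * g x) 1 (m j) ≤ C * a * b :=
    calc eLpNorm (fun x => f x * g x) 1 (m j)
        ≤ eLpNorm f ∞ (m j) * eLpNorm g 1 (m j) := by
          simpa only [smul_eq_mul] using!
            eLpNorm_smul_le_mul_eLpNorm (p := ∞) (q := 1) (r := 1) hg.1.1 hf.1.1
      _ ≤ C * a * b := mul_le_mul' (hf.eLpNorm_top_le hC) hg.eLpNorm_one_le
  have hvar : var j (fun x => f x * g x) ≤ C * (C * a * b + C * b * a) := by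
    refine (hC.mul_le j f g hf.memB hg.memB).trans ?_
    gcongr
    exacts [hf.eLpNorm_top_le hC, hg.var_le, hg.eLpNorm_top_le hC, hf.var_le]
  have hconst : C * a * b + C * (C * a * b + C * b * a) ≤ 3 * C ^ 2 * (a * b) :=
    calc C * a * b + C * (C * a * b + C * b * a) = C * (a * b) + 2 * C ^ 2 * (a * b) := by ring
      _ ≤ C ^ 2 * (a * b) + 2 * C ^ 2 * (a * b) := by
        gcongr
        exact le_self_pow₀ hC.one_le two_ne_zero
      _ = 3 * C ^ 2 * (a * b) := by ring
  exact (add_le_add hnorm hvar).trans (by exact_mod_cast hconst)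

theorem var_comp_le {T : ∀ j, X j → X (j + 1)} (hv : IsVariation m var) {c : ℝ≥0}
    (hc : ∀ j (h : X (j + 1) → ℝ), Integrable h (m (j + 1)) →
      var (j + 1) h ≤ 1 → var j (fun x => h (T j x)) ≤ c)
    {f : X (j + 1) → ℝ} (hf : BNormLE m var (j + 1) f a)
    (hfT : Integrable (fun x => f (T j x)) (m j)) :
    var j (fun x => f (T j x)) ≤ ((a + 1) * c : ℝ≥0) := by
  set t : ℝ := ((a + 1 : ℝ≥0) : ℝ) with ht_def
  have ht : 0 < t := by positivity
  have hunit : ‖t⁻¹‖₊ * a ≤ 1 := by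
    rw [ht_def, nnnorm_inv, NNReal.nnnorm_eq, inv_mul_le_iff₀ (by positivity), mul_one]
    exact le_self_add
  have hscaled := hc j (fun x => t⁻¹ * f x) (hf.1.const_mul _)
    (((hf.const_mul hv t⁻¹).mono hunit).var_le.trans_eq ENNReal.coe_one)
  calc var j (fun x => f (T j x)) = var j (fun x => t * (t⁻¹ * f (T j x))) := by
        simp only [mul_inv_cancel_left₀ ht.ne']
    _ = ENNReal.ofReal |t| * var j (fun x => t⁻¹ * f (T j x)) :=
        hv.smul j _ _ (hfT.const_mul _)
    _ ≤ ((a + 1) * c : ℝ≥0) := by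
        rw [abs_of_pos ht, ENNReal.ofReal_coe_nnreal, ENNReal.coe_mul]
        gcongr

theorem comp [∀ j, IsProbabilityMeasure (m j)] {T : ∀ j, X j → X (j + 1)}
    (hT : ∀ j, Measure.QuasiMeasurePreserving (T j) (m j) (m (j + 1)))
    (hv : IsVariation m var) (hC : IsVarConst m var C) {c : ℝ≥0}
    (hc : ∀ j (h : X (j + 1) → ℝ), Integrable h (m (j + 1)) →
      var (j + 1) h ≤ 1 → var j (fun x => h (T j x)) ≤ c)
    {f : X (j + 1) → ℝ} (hf : BNormLE m var (j + 1) f a) :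
    BNormLE m var j (fun x => f (T j x)) (C * a + (a + 1) * c) := by
  have hbound : ∀ᵐ x ∂(m j), ‖f (T j x)‖ ≤ (C * a : ℝ≥0) := (hT j).ae (hf.ae_abs_le hC)
  have hint : Integrable (fun x => f (T j x)) (m j) :=
    .of_bound (hf.1.1.comp_quasiMeasurePreserving (hT j)) _ hbound
  refine ⟨hint, ?_⟩
  rw [ENNReal.coe_add]
  exact add_le_add (eLpNorm_le_of_ae_abs_le hbound 1) (hf.var_comp_le hv hc hint)

end BNormLE

end Norm

/-! ### Inversion in `𝓑_j` -/

section Inverse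

variable {X : ℕ → Type*} [∀ j, MeasurableSpace (X j)] {m : ∀ j, Measure (X j)}
  {var : ∀ j, (X j → ℝ) → ℝ≥0∞} {C : ℝ≥0} {j : ℕ}

theorem IsVariation.bNorm_sub_comm (hv : IsVariation m var) {f g : X j → ℝ}
    (hf : Integrable f (m j)) (hg : Integrable g (m j)) :
    bNorm (m j) (var j) (fun x => f x - g x) = bNorm (m j) (var j) (fun x => g x - f x) := by
  have hvar := hv.smul j (-1) (fun x => g x - f x) (hg.sub hf)
  simp only [neg_one_mul, neg_sub, abs_neg, abs_one, ENNReal.ofReal_one, one_mul] at hvar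
  rw [bNorm, bNorm, hvar]
  congr 1
  exact eLpNorm_sub_comm f g 1 (m j)

theorem BNormLE.of_hasSum (hv : IsVariation m var) {f : ℕ → X j → ℝ} {a : ℕ → ℝ≥0} {g : X j → ℝ}
    (hf : ∀ i, BNormLE m var j (f i) (a i)) (ha : Summable a)
    (hg : ∀ᵐ x ∂(m j), HasSum (fun i => f i x) (g x)) :
    BNormLE m var j g (∑' i, a i) := by
  set s : ℕ → X j → ℝ := fun k x => ∑ i ∈ Finset.range k, f i x
  have hsB (k : ℕ) : BNormLE m var j (s k) (∑ i ∈ Finset.range k, a i) := .sum hv hf _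
  have hsub {k l : ℕ} (h : k ≤ l) :
      bNorm (m j) (var j) (fun x => s l x - s k x) ≤ (∑' i, a (i + k) : ℝ≥0) := by
    have hIco := BNormLE.sum hv hf (Finset.Ico k l)
    simp only [Finset.sum_Ico_eq_sub _ h] at hIco
    refine hIco.2.trans (ENNReal.coe_le_coe.2 ?_)
    rw [Finset.sum_Ico_eq_sum_range]
    simp only [add_comm k]
    exact ((NNReal.summable_nat_add_iff k).2 ha).sum_le_tsum _ fun _ _ => zero_le
  have htail : Tendsto (fun k => ∑' i, a (i + k)) atTop (𝓝 0) := NNReal.tendsto_sum_nat_add a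
  obtain ⟨g', hg'B, hlim⟩ := hv.complete j s (fun k => (hsB k).memB) fun ε hε => by
    obtain ⟨N, hN⟩ := (htail.eventually_le_const hε).exists_forall_of_atTop
    refine ⟨N, fun k l hk hl => ?_⟩
    rcases le_total k l with h | h
    · rw [hv.bNorm_sub_comm (hsB k).1 (hsB l).1]
      exact (hsub h).trans (by exact_mod_cast hN k hk)
    · exact (hsub h).trans (by exact_mod_cast hN l hl)
  have hgg' : g' =ᵐ[m j] g := by
    have hL1 : Tendsto (fun k => eLpNorm (s k - g') 1 (m j)) atTop (𝓝 0) :=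
      tendsto_of_tendsto_of_tendsto_of_le_of_le tendsto_const_nhds hlim (fun _ => zero_le)
        fun _ => le_self_add
    obtain ⟨k, hk, hae⟩ := (tendstoInMeasure_of_tendsto_eLpNorm one_ne_zero
      (fun k => (hsB k).1.1) hg'B.1.1 hL1).exists_seq_tendsto_ae
    filter_upwards [hae, hg] with x hx hgx
    exact tendsto_nhds_unique hx (hgx.tendsto_sum_nat.comp hk.tendsto_atTop)
  refine BNormLE.congr_ae hv ⟨hg'B.1, ?_⟩ hgg'
  refine ENNReal.le_of_forall_pos_le_add fun ε hε _ => ?_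
  obtain ⟨k, hk⟩ := (hlim.eventually_le_const (ENNReal.coe_pos.2 hε)).exists
  have hrem : BNormLE m var j (fun x => s k x - g' x) ε := ⟨(hsB k).1.sub hg'B.1, hk⟩
  have hdecomp := ((hsB k).sub hv hrem).2
  simp only [sub_sub_cancel] at hdecomp
  refine hdecomp.trans ?_
  rw [ENNReal.coe_add]
  gcongr
  exact ha.sum_le_tsum _ fun _ _ => zero_le

theorem IsVarConst.exists_bNormLE_one_sub_pow (hC : IsVarConst m var C) (hv : IsVariation m var)
    (b : ℝ≥0) (k : ℕ) : ∃ β : ℝ≥0, ∀ j (u : X j → ℝ), BNormLE m var j u b →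
      BNormLE m var j (fun x => 1 - (1 - u x) ^ k) β := by
  induction k with
  | zero => exact ⟨0, fun j u _ => by simpa using BNormLE.zero hv j⟩
  | succ k ih =>
    obtain ⟨β, hβ⟩ := ih
    refine ⟨β + b + 3 * C ^ 2 * (β * b), fun j u hu => ?_⟩
    convert ((hβ j u hu).add hv hu).sub hv ((hβ j u hu).mul hC hu) using 2 with x
    ring

theorem IsVarConst.exists_bNormLE_geom_sum (hC : IsVarConst m var C) (hv : IsVariation m var)
    (K : ℝ≥0) (n : ℕ) : ∃ β : ℝ≥0, ∀ j (w : X j → ℝ), BNormLE m var j (fun _ => (1 : ℝ)) K →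
      BNormLE m var j w K → BNormLE m var j (fun x => ∑ i ∈ Finset.range n, w x ^ i) β := by
  induction n with
  | zero => exact ⟨0, fun j w _ _ => by simpa using BNormLE.zero hv j⟩
  | succ n ih =>
    obtain ⟨β, hβ⟩ := ih
    refine ⟨3 * C ^ 2 * (K * β) + K, fun j w hone hw => ?_⟩
    simp only [geom_sum_succ]
    exact (hw.mul hC (hβ j w hone hw)).add hv hone

variable [∀ j, IsProbabilityMeasure (m j)]

theorem IsVariation.exists_bNormLE_one (hv : IsVariation m var) (j : ℕ) :
    ∃ a, BNormLE m var j (fun _ => (1 : ℝ)) a :=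
  ⟨_, .of_memB ⟨integrable_const _, hv.one_lt_top j⟩⟩

theorem BNormLE.of_ae_abs_le {f : X j → ℝ} {a v : ℝ≥0} (hf : Integrable f (m j))
    (ha : ∀ᵐ x ∂(m j), |f x| ≤ a) (hv : var j f ≤ v) : BNormLE m var j f (a + v) :=
  ⟨hf, by push_cast; exact add_le_add (eLpNorm_le_of_ae_abs_le ha 1) hv⟩

theorem IsVarConst.var_mul_le (hC : IsVarConst m var C) {f g : X j → ℝ} {a b u v : ℝ≥0}
    (hf : MemB (m j) (var j) f) (hg : MemB (m j) (var j) g) (ha : ∀ᵐ x ∂(m j), |f x| ≤ a)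
    (hb : ∀ᵐ x ∂(m j), |g x| ≤ b) (hu : var j f ≤ u) (hv : var j g ≤ v) :
    var j (fun x => f x * g x) ≤ (C * (a * v + b * u) : ℝ≥0) := by
  refine (hC.mul_le j f g hf hg).trans ?_
  push_cast
  gcongr
  exacts [eLpNorm_le_of_ae_abs_le ha _, eLpNorm_le_of_ae_abs_le hb _]

/-- `var (w ^ 2) ≤ (1/2) var w` for a function this small, so `w - w ^ 2` controls `w`. -/
theorem IsVarConst.var_le_of_sub_sq (hC : IsVarConst m var C) (hv : IsVariation m var)
    {w : X j → ℝ} {E : ℝ≥0} (hw : MemB (m j) (var j) w)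
    (hsmall : ∀ᵐ x ∂(m j), |w x| ≤ (1 / (4 * C) : ℝ≥0))
    (hE : BNormLE m var j (fun x => w x - w x * w x) E) : var j w ≤ (2 * E : ℝ≥0) := by
  obtain ⟨V, hV⟩ : ∃ V : ℝ≥0, var j w = V := ⟨_, (ENNReal.coe_toNNReal hw.2.ne).symm⟩
  have hCpos : 0 < C := one_pos.trans_le hC.one_le
  have hsq : var j (fun x => w x * w x) ≤ (V / 2 : ℝ≥0) := by
    convert hC.var_mul_le hw hw hsmall hsmall hV.le hV.le using 2
    field_simp
    ring
  have hsum : V ≤ V / 2 + E := by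
    have hww := (BNormLE.of_memB hw).mul hC (BNormLE.of_memB hw)
    have := hv.add_le j _ _ hww.1 hE.1
    simp only [add_sub_cancel] at this
    rw [hV] at this
    exact_mod_cast this.trans (add_le_add hsq hE.var_le)
  rw [hV, ENNReal.coe_le_coe]
  rw [← NNReal.coe_le_coe] at hsum ⊢
  push_cast at hsum ⊢
  linarith

theorem IsVarConst.var_pow_le (hC : IsVarConst m var C) {w : X j → ℝ} {K : ℝ≥0}
    (hone : BNormLE m var j (fun _ => (1 : ℝ)) K) (hw : BNormLE m var j w K)
    (hsmall : ∀ᵐ x ∂(m j), |w x| ≤ (1 / (4 * C) : ℝ≥0)) (k : ℕ) :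
    MemB (m j) (var j) (fun x => w x ^ k) ∧ (∀ᵐ x ∂(m j), |w x ^ k| ≤ ((1 / 2) ^ k : ℝ≥0)) ∧
      var j (fun x => w x ^ k) ≤ (4 * C * K * (1 / 2) ^ k : ℝ≥0) := by
  have hCpos : 0 < C := one_pos.trans_le hC.one_le
  have hhalf : 1 / (4 * C) ≤ 1 / 2 := by
    gcongr
    linarith [hC.one_le]
  have hKB : K ≤ 4 * C * K :=
    le_mul_of_one_le_left' (one_le_mul (by norm_num) hC.one_le)
  induction k with
  | zero =>
    simp only [pow_zero, mul_one]
    exact ⟨hone.memB, by simp, hone.var_le.trans (ENNReal.coe_le_coe.2 hKB)⟩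
  | succ k ih =>
    obtain ⟨hmem, hbound, hvar⟩ := ih
    simp only [pow_succ' (w _)]
    refine ⟨((BNormLE.of_memB hw.memB).mul hC (BNormLE.of_memB hmem)).memB, ?_, ?_⟩
    · filter_upwards [hsmall, hbound] with x hx hxk
      rw [abs_mul, pow_succ', NNReal.coe_mul]
      gcongr
      exact hx.trans (by exact_mod_cast hhalf)
    · refine (hC.var_mul_le hw.memB hmem hsmall hbound hw.var_le hvar).trans
        (ENNReal.coe_le_coe.2 (le_of_eq ?_))
      field_simp
      ring

theorem IsVarConst.exists_bNormLE_one_sub_inv (hC : IsVarConst m var C) (hv : IsVariation m var)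
    (K : ℝ≥0) : ∃ K' : ℝ≥0, ∀ j (w : X j → ℝ), BNormLE m var j (fun _ => (1 : ℝ)) K →
      BNormLE m var j w K → (∀ᵐ x ∂(m j), |w x| ≤ (1 / (4 * C) : ℝ≥0)) →
      BNormLE m var j (fun x => (1 - w x)⁻¹) K' := by
  refine ⟨∑' k, ((1 / 2) ^ k + 4 * C * K * (1 / 2) ^ k), fun j w hone hw hsmall => ?_⟩
  have hpow (k : ℕ) :
      BNormLE m var j (fun x => w x ^ k) ((1 / 2) ^ k + 4 * C * K * (1 / 2) ^ k) := by
    obtain ⟨hmem, hbound, hvar⟩ := hC.var_pow_le hone hw hsmall k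
    exact .of_ae_abs_le hmem.1 hbound hvar
  have hgeom : Summable fun k : ℕ => (1 / 2 : ℝ≥0) ^ k :=
    NNReal.summable_geometric (by norm_num)
  refine .of_hasSum hv hpow (hgeom.add (hgeom.mul_left _)) ?_
  filter_upwards [(hC.var_pow_le hone hw hsmall 1).2.1] with x hx
  refine hasSum_geometric_of_abs_lt_one (lt_of_le_of_lt (by simpa using hx) ?_)
  norm_num

/-- No uniform bound on `‖1‖` is assumed: it follows from the existence of functions that are
bounded in `𝓑_j` and bounded below. -/
theorem IsVarConst.exists_bNormLE_one_and_pow (hC : IsVarConst m var C) (hv : IsVariation m var)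
    (b : ℝ≥0) (n : ℕ) : ∃ K : ℝ≥0, ∀ j (u : X j → ℝ), BNormLE m var j u b →
      (∀ᵐ x ∂(m j), |(1 - u x) ^ n| ≤ (1 / (4 * C) : ℝ≥0)) →
      BNormLE m var j (fun _ => (1 : ℝ)) K ∧ BNormLE m var j (fun x => (1 - u x) ^ n) K := by
  obtain ⟨β, hβ⟩ := hC.exists_bNormLE_one_sub_pow hv b n
  set E : ℝ≥0 := β + 3 * C ^ 2 * (β * β)
  set δ : ℝ≥0 := 1 / (4 * C)
  refine ⟨δ + 2 * E + β, fun j u hu hsmall => ?_⟩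
  have hdiff := hβ j u hu
  obtain ⟨a, hone⟩ := hv.exists_bNormLE_one j
  have hpow : MemB (m j) (var j) (fun x => (1 - u x) ^ n) := by
    simpa only [sub_sub_cancel] using (hone.sub hv hdiff).memB
  have hE : BNormLE m var j (fun x => (1 - u x) ^ n - (1 - u x) ^ n * (1 - u x) ^ n) E := by
    convert hdiff.sub hv (hdiff.mul hC hdiff) using 2 with x
    ring
  have hpowB : BNormLE m var j (fun x => (1 - u x) ^ n) (δ + 2 * E) :=
    .of_ae_abs_le hpow.1 hsmall (hC.var_le_of_sub_sq hv hpow hsmall hE)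
  refine ⟨?_, hpowB.mono le_self_add⟩
  simpa only [add_sub_cancel] using hpowB.add hv hdiff

theorem IsVarConst.exists_bNormLE_inv_of_le_one (hC : IsVarConst m var C)
    (hv : IsVariation m var) (b : ℝ≥0) {c : ℝ} (hc : 0 < c) :
    ∃ K : ℝ≥0, ∀ j (u : X j → ℝ), BNormLE m var j u b → (∀ᵐ x ∂(m j), c ≤ u x ∧ u x ≤ 1) →
      BNormLE m var j (fun _ => (1 : ℝ)) K ∧ BNormLE m var j (fun x => (u x)⁻¹) K := by
  have hCpos : 0 < C := one_pos.trans_le hC.one_le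
  obtain ⟨n, hn⟩ := exists_pow_lt_of_lt_one (by positivity : (0 : ℝ) < (1 / (4 * C) : ℝ≥0))
    (sub_lt_self 1 hc)
  obtain ⟨K, hK⟩ := hC.exists_bNormLE_one_and_pow hv b n
  obtain ⟨K', hK'⟩ := hC.exists_bNormLE_one_sub_inv hv K
  obtain ⟨β, hβ⟩ := hC.exists_bNormLE_geom_sum hv (K + b) n
  refine ⟨K + 3 * C ^ 2 * (β * K'), fun j u hu hcu => ?_⟩
  have hsmall : ∀ᵐ x ∂(m j), |(1 - u x) ^ n| ≤ (1 / (4 * C) : ℝ≥0) := by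
    filter_upwards [hcu] with x hx
    rw [abs_of_nonneg (pow_nonneg (sub_nonneg.2 hx.2) n)]
    exact (pow_le_pow_left₀ (sub_nonneg.2 hx.2) (by linarith [hx.1]) n).trans hn.le
  obtain ⟨hone, hpow⟩ := hK j u hu hsmall
  have hgeom := hβ j _ (hone.mono le_self_add) (hone.sub hv hu)
  refine ⟨hone.mono le_self_add, ?_⟩
  refine ((hgeom.mul hC (hK' j _ hone hpow hsmall)).mono le_add_self).congr_ae hv ?_
  have hlt : 1 / (4 * C) < 1 := (div_lt_one (by positivity)).2 (by linarith [hC.one_le])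
  filter_upwards [hsmall] with x hx
  have hne : 1 - (1 - u x) ^ n ≠ 0 :=
    (sub_pos.2 ((le_abs_self _).trans_lt (hx.trans_lt (by exact_mod_cast hlt)))).ne'
  have hgeom_sum := mul_neg_geom_sum (1 - u x) n
  rw [sub_sub_cancel] at hgeom_sum
  refine eq_inv_of_mul_eq_one_left ?_
  rw [mul_comm, ← mul_assoc, hgeom_sum, mul_inv_cancel₀ hne]

theorem IsVarConst.exists_bNormLE_inv (hC : IsVarConst m var C) (hv : IsVariation m var)
    (b : ℝ≥0) {c : ℝ} (hc : 0 < c) :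
    ∃ K : ℝ≥0, ∀ j (h : X j → ℝ), BNormLE m var j h b → (∀ᵐ x ∂(m j), c ≤ h x) →
      BNormLE m var j (fun _ => (1 : ℝ)) K ∧ BNormLE m var j (fun x => (h x)⁻¹) K := by
  set M : ℝ := C * b + c
  have hM : 0 < M := by positivity
  obtain ⟨K, hK⟩ := hC.exists_bNormLE_inv_of_le_one hv (‖M⁻¹‖₊ * b) (div_pos hc hM)
  refine ⟨K + ‖M⁻¹‖₊ * K, fun j h hh hch => ?_⟩
  obtain ⟨hone, hinv⟩ := hK j (fun x => M⁻¹ * h x) (hh.const_mul hv _) (by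
    filter_upwards [hch, hh.ae_abs_le hC] with x hcx hbx
    rw [inv_mul_eq_div]
    refine ⟨by gcongr, (div_le_one hM).2 ?_⟩
    linarith [le_abs_self (h x)])
  refine ⟨hone.mono le_self_add, ?_⟩
  convert (hinv.const_mul hv M⁻¹).mono le_add_self using 2 with x
  rw [mul_inv, inv_inv, inv_mul_cancel_left₀ hM.ne']

end Inverse

/-! ### Decay of the iterates -/

section CenteredLE

variable {X : ℕ → Type*} [∀ j, MeasurableSpace (X j)] {m : ∀ j, Measure (X j)}
  {var : ∀ j, (X j → ℝ) → ℝ≥0∞} {T : ∀ j, X j → X (j + 1)}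

/-- The function `φ` has mean zero, is dominated by `s` times the density `dens T m j`, and has norm
at most `R * s` in `𝓑_j`. For a suitable fixed `R`, the gauge `s` is contracted by the iterates of
the transfer operators. -/
structure CenteredLE (m : ∀ j, Measure (X j)) (var : ∀ j, (X j → ℝ) → ℝ≥0∞)
    (T : ∀ j, X j → X (j + 1)) (R : ℝ≥0) (j : ℕ) (φ : X j → ℝ) (s : ℝ≥0) : Prop where
  integral_eq_zero : ∫ x, φ x ∂(m j) = 0
  ae_abs_le : ∀ᵐ x ∂(m j), |φ x| ≤ s * dens T m j x
  bNormLE : BNormLE m var j φ (R * s)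

namespace CenteredLE

variable {R : ℝ≥0} {j : ℕ} {φ φ' : X j → ℝ} {s s' : ℝ≥0}

theorem integrable (h : CenteredLE m var T R j φ s) : Integrable φ (m j) := h.bNormLE.1

theorem congr_ae (hv : IsVariation m var) (h : CenteredLE m var T R j φ s) (he : φ =ᵐ[m j] φ') :
    CenteredLE m var T R j φ' s where
  integral_eq_zero := by rw [← integral_congr_ae he, h.integral_eq_zero]
  ae_abs_le := by
    filter_upwards [h.ae_abs_le, he] with x hx hex
    rwa [← hex]
  bNormLE := h.bNormLE.congr_ae hv he

theorem zero (hv : IsVariation m var) : CenteredLE m var T R j (fun _ => 0) 0 where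
  integral_eq_zero := integral_zero _ _
  ae_abs_le := by simp
  bNormLE := (BNormLE.zero hv j).mono zero_le

theorem neg (hv : IsVariation m var) (h : CenteredLE m var T R j φ s) :
    CenteredLE m var T R j (fun x => -1 * φ x) s where
  integral_eq_zero := by rw [integral_const_mul, h.integral_eq_zero, mul_zero]
  ae_abs_le := by simpa using h.ae_abs_le
  bNormLE := by simpa using h.bNormLE.const_mul hv (-1)

theorem add (hv : IsVariation m var) (h : CenteredLE m var T R j φ s)
    (h' : CenteredLE m var T R j φ' s') :
    CenteredLE m var T R j (fun x => φ x + φ' x) (s + s') where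
  integral_eq_zero := by
    rw [integral_add h.integrable h'.integrable, h.integral_eq_zero, h'.integral_eq_zero, add_zero]
  ae_abs_le := by
    filter_upwards [h.ae_abs_le, h'.ae_abs_le] with x hx hx'
    refine (abs_add_le _ _).trans ((add_le_add hx hx').trans_eq ?_)
    push_cast
    ring
  bNormLE := by simpa only [mul_add] using h.bNormLE.add hv h'.bNormLE

theorem of_bNormLE {C : ℝ≥0} (hC : IsVarConst m var C) {c b : ℝ≥0} (hc : 0 < c) (hR : 1 ≤ R)
    (hd : ∀ᵐ x ∂(m j), (c : ℝ) ≤ dens T m j x) (hφ : BNormLE m var j φ b)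
    (h0 : ∫ x, φ x ∂(m j) = 0) : CenteredLE m var T R j φ (b + C * b / c) where
  integral_eq_zero := h0
  ae_abs_le := by
    filter_upwards [hφ.ae_abs_le hC, hd] with x hx hdx
    calc |φ x| ≤ (C * b / c : ℝ≥0) * c := by
          push_cast
          rwa [div_mul_cancel₀ _ (NNReal.coe_pos.2 hc).ne']
      _ ≤ (b + C * b / c : ℝ≥0) * dens T m j x := by
          gcongr
          exact le_add_self
  bNormLE := hφ.mono (le_mul_of_one_le_of_le hR le_self_add)

end CenteredLE

end CenteredLE

section Decay

variable {X : ℕ → Type*} [∀ j, MeasurableSpace (X j)] {m : ∀ j, Measure (X j)}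
  [∀ j, IsProbabilityMeasure (m j)] {var : ∀ j, (X j → ℝ) → ℝ≥0∞} {C : ℝ≥0}
  {T : ∀ j, X j → X (j + 1)}

theorem exists_le_and_mul_add_le {α : ℝ≥0} (hα : α < 1) (a β : ℝ≥0) :
    ∃ x : ℝ≥0, a ≤ x ∧ α * x + β ≤ x := by
  obtain ⟨δ, hδ⟩ := le_iff_exists_add.1 hα.le
  have hδ0 : δ ≠ 0 := by
    rintro rfl
    exact hα.ne (by simpa using hδ.symm)
  refine ⟨a + β / δ, le_self_add, ?_⟩
  calc α * (a + β / δ) + β = α * (a + β / δ) + δ * (β / δ) := by rw [mul_div_cancel₀ _ hδ0]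
    _ ≤ α * (a + β / δ) + δ * (a + β / δ) := by
      gcongr
      exact le_add_self
    _ = a + β / δ := by rw [← add_mul, ← hδ, one_mul]

theorem IsAdmissible.exists_bNormLE_transfer (hadm : IsAdmissible m var T) :
    ∃ K : ℝ≥0, 1 ≤ K ∧ ∀ j (φ : X j → ℝ) (a : ℝ≥0), BNormLE m var j φ a →
      BNormLE m var (j + 1) (transfer (m j) (m (j + 1)) (T j) φ) (K * a) := by
  obtain ⟨K, -, hK⟩ := hadm.bounded
  refine ⟨max K 1, le_max_right _ _, fun j φ a h => ⟨transfer_integrable h.1, ?_⟩⟩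
  rw [ENNReal.coe_mul]
  exact (hK j φ h.memB).trans (mul_le_mul' (ENNReal.coe_le_coe.2 (le_max_left K 1)) h.2)

theorem IsAdmissible.exists_bNormLE_transferIter
    (hT : ∀ j, Measure.QuasiMeasurePreserving (T j) (m j) (m (j + 1)))
    (hadm : IsAdmissible m var T) :
    ∃ (N : ℕ) (α β : ℝ≥0), 1 ≤ N ∧ α < 1 ∧ ∀ (j : ℕ) (φ : X j → ℝ) (a s : ℝ≥0),
      BNormLE m var j φ a → (∀ᵐ x ∂(m j), |φ x| ≤ s * dens T m j x) →
      BNormLE m var (j + N) (transferIter m T (Nat.le_add_right j N) φ) (α * a + β * s) := by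
  obtain ⟨N, α, β, hN, -, hα, -, hLY⟩ := hadm.lasotaYorke
  refine ⟨N, α, β, hN, hα, fun j φ a s hφ hs => ⟨transferIter_integrable _ hφ.1, ?_⟩⟩
  push_cast
  refine (hLY j φ hφ.memB).trans (add_le_add (mul_le_mul_right hφ.2 _) ?_)
  exact mul_le_mul_right (eLpNorm_one_le_of_abs_le_dens hT hφ.1 hs) _

theorem exists_bNormLE_dens (hT : ∀ j, Measure.QuasiMeasurePreserving (T j) (m j) (m (j + 1)))
    (hv : IsVariation m var) (hadm : IsAdmissible m var T) :
    ∃ b : ℝ≥0, ∀ j, BNormLE m var j (dens T m j) b := by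
  obtain ⟨K, hK1, hK⟩ := hadm.exists_bNormLE_transfer
  obtain ⟨N, α, β, hN, hα, hLY⟩ := hadm.exists_bNormLE_transferIter hT
  obtain ⟨b₀, hb₀⟩ := hv.exists_bNormLE_one 0
  obtain ⟨b, hb, hb'⟩ := exists_le_and_mul_add_le hα (K ^ N * b₀) β
  have hcrude (j : ℕ) : BNormLE m var j (dens T m j) (K ^ j * b₀) := by
    induction j with
    | zero => simpa [dens_zero] using hb₀
    | succ j ih => simpa only [dens_succ, pow_succ', mul_assoc] using hK j _ _ ih
  refine ⟨b, fun j => ?_⟩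
  induction j using Nat.strong_induction_on with
  | _ j ih =>
    rcases lt_or_ge j N with hj | hj
    · exact (hcrude j).mono (le_trans (by gcongr) hb)
    · obtain ⟨i, rfl⟩ := Nat.exists_eq_add_of_le' hj
      have hdens : ∀ᵐ x ∂(m i), |dens T m i x| ≤ (1 : ℝ≥0) * dens T m i x := by
        filter_upwards [dens_nonneg hT i] with x hx
        rw [abs_of_nonneg hx, NNReal.coe_one, one_mul]
      have hstep := hLY i _ b 1 (ih i (by omega)) hdens
      rw [transferIter_dens, mul_one] at hstep
      exact hstep.mono hb'

theorem IsAdmissible.exists_bNormLE_transferIter_mul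
    (hT : ∀ j, Measure.QuasiMeasurePreserving (T j) (m j) (m (j + 1)))
    (hadm : IsAdmissible m var T) :
    ∃ (N : ℕ) (α B : ℝ≥0), 1 ≤ N ∧ α < 1 ∧ ∀ (q j : ℕ) (φ : X j → ℝ) (a s : ℝ≥0),
      BNormLE m var j φ a → (∀ᵐ x ∂(m j), |φ x| ≤ s * dens T m j x) →
      ∀ k (h : j ≤ k), k = j + q * N →
        BNormLE m var k (transferIter m T h φ) (α ^ q * a + B * s) := by
  obtain ⟨N, α, β, hN, hα, hLY⟩ := hadm.exists_bNormLE_transferIter hT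
  obtain ⟨B, -, hB⟩ := exists_le_and_mul_add_le hα 0 β
  refine ⟨N, α, B, hN, hα, fun q => ?_⟩
  induction q with
  | zero =>
    intro j φ a s hφ _ k h hk
    obtain rfl : k = j := by omega
    rw [transferIter_self, pow_zero, one_mul]
    exact hφ.mono le_self_add
  | succ q ih =>
    intro j φ a s hφ hs k h hk
    obtain rfl : k = (j + q * N) + N := by rw [hk]; ring
    have hj : j ≤ j + q * N := Nat.le_add_right _ _
    rw [transferIter_trans T m hj (Nat.le_add_right _ _)]
    refine (hLY _ _ _ s (ih j φ a s hφ hs _ hj rfl) (abs_transferIter_le hT hj hφ.1 hs)).mono ?_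
    calc α * (α ^ q * a + B * s) + β * s = α ^ (q + 1) * a + (α * B + β) * s := by ring
      _ ≤ α ^ (q + 1) * a + B * s := by gcongr

namespace CenteredLE

variable {R : ℝ≥0} {j : ℕ} {φ : X j → ℝ} {s s' : ℝ≥0}

theorem mono (hT : ∀ j, Measure.QuasiMeasurePreserving (T j) (m j) (m (j + 1)))
    (h : CenteredLE m var T R j φ s) (hs : s ≤ s') : CenteredLE m var T R j φ s' where
  integral_eq_zero := h.integral_eq_zero
  ae_abs_le := by
    filter_upwards [h.ae_abs_le, dens_nonneg hT j] with x hx hdens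
    exact hx.trans (mul_le_mul_of_nonneg_right (by exact_mod_cast hs) hdens)
  bNormLE := h.bNormLE.mono (by gcongr)

theorem transfer (hT : ∀ j, Measure.QuasiMeasurePreserving (T j) (m j) (m (j + 1)))
    {K : ℝ≥0} (hK1 : 1 ≤ K)
    (hK : ∀ j (φ : X j → ℝ) (a : ℝ≥0), BNormLE m var j φ a →
      BNormLE m var (j + 1) (transfer (m j) (m (j + 1)) (T j) φ) (K * a))
    (h : CenteredLE m var T R j φ s) :
    CenteredLE m var T R (j + 1) (SeqLivsic.transfer (m j) (m (j + 1)) (T j) φ) (K * s) where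
  integral_eq_zero := by rw [integral_transfer (hT j) h.integrable, h.integral_eq_zero]
  ae_abs_le := by
    have hle := abs_transferIter_le hT (Nat.le_succ j) h.integrable h.ae_abs_le
    rw [transferIter_succ T m le_rfl, transferIter_self] at hle
    filter_upwards [hle, dens_nonneg hT (j + 1)] with y hle hdens
    exact hle.trans (mul_le_mul_of_nonneg_right
      (by exact_mod_cast le_mul_of_one_le_left' hK1) hdens)
  bNormLE := (hK j φ _ h.bNormLE).mono (mul_left_comm _ _ _).le

end CenteredLE

/-- Covering is applied to the nonnegative function `s * dens T m j + φ`, whose integral is `s`. -/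
theorem IsAdmissible.exists_le_mul_dens_add_transferIter
    (hT : ∀ j, Measure.QuasiMeasurePreserving (T j) (m j) (m (j + 1)))
    (hv : IsVariation m var) (hadm : IsAdmissible m var T) {b : ℝ≥0}
    (hb : ∀ j, BNormLE m var j (dens T m j) b) {R : ℝ≥0} (hR : 0 < R) :
    ∃ (c : ℝ) (n₀ : ℕ), 0 < c ∧ ∀ (j n : ℕ), n₀ ≤ n → ∀ (φ : X j → ℝ) (s : ℝ≥0),
      CenteredLE m var T R j φ s → ∀ᵐ y ∂(m (j + n)),
        c * s ≤ s * dens T m (j + n) y + transferIter m T (Nat.le_add_right j n) φ y := by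
  obtain ⟨c, n₀, hc, hcov⟩ := hadm.covering (b + R) (by positivity)
  refine ⟨c, n₀, hc, fun j n hn φ s h => ?_⟩
  have hdens := (dens_integrable (m := m) (T := T) j).const_mul (s : ℝ)
  set ψ : X j → ℝ := fun x => s * dens T m j x + φ x
  have hψB : BNormLE m var j ψ (s * b + R * s) := by
    simpa only [NNReal.nnnorm_eq] using ((hb j).const_mul hv (s : ℝ)).add hv h.bNormLE
  have hψ_nonneg : 0 ≤ᵐ[m j] ψ := by
    filter_upwards [h.ae_abs_le] with x hx
    exact neg_le_iff_add_nonneg'.1 (abs_le.1 hx).1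
  have hψ_integral : ∫ x, ψ x ∂(m j) = s := by
    rw [integral_add hdens h.integrable, integral_const_mul, h.integral_eq_zero, integral_dens hT,
      mul_one, add_zero]
  have hψ_abs : ∫ x, |ψ x| ∂(m j) = s := by
    rw [← hψ_integral]
    exact integral_congr_ae (hψ_nonneg.mono fun x hx => abs_of_nonneg hx)
  have hψ_var : var j ψ ≤ ENNReal.ofReal ((b + R) * ∫ x, ψ x ∂(m j)) := by
    refine hψB.var_le.trans_eq ?_
    rw [hψ_integral, ← ENNReal.ofReal_coe_nnreal]
    push_cast
    ring_nf
  filter_upwards [hcov j n hn ψ hψB.memB hψ_nonneg hψ_var,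
    transferIter_add hT (Nat.le_add_right j n) hdens h.integrable,
    transferIter_const_mul hT (Nat.le_add_right j n) (dens_integrable j) (s : ℝ)]
    with y hcov hadd hmul
  rw [hψ_abs] at hcov
  rwa [hadd, hmul, transferIter_dens] at hcov

theorem IsAdmissible.exists_abs_transferIter_le_mul_dens
    (hT : ∀ j, Measure.QuasiMeasurePreserving (T j) (m j) (m (j + 1)))
    (hv : IsVariation m var) (hC : IsVarConst m var C) (hadm : IsAdmissible m var T) {R : ℝ≥0}
    (hR : 0 < R) :
    ∃ (γ : ℝ≥0) (n₀ : ℕ), γ < 1 ∧ ∀ (j n : ℕ), n₀ ≤ n → ∀ (φ : X j → ℝ) (s : ℝ≥0),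
      CenteredLE m var T R j φ s → ∀ᵐ y ∂(m (j + n)),
        |transferIter m T (Nat.le_add_right j n) φ y| ≤ (γ * s : ℝ≥0) * dens T m (j + n) y := by
  obtain ⟨b, hb⟩ := exists_bNormLE_dens hT hv hadm
  obtain ⟨c, n₀, hc, hcov⟩ := hadm.exists_le_mul_dens_add_transferIter hT hv hb hR
  set M : ℝ := C * b + 1
  have hM0 : 0 < M := by positivity
  refine ⟨(1 - c / M).toNNReal, n₀, Real.toNNReal_lt_one.2 (sub_lt_self 1 (by positivity)),
    fun j n hn φ s h => ?_⟩
  filter_upwards [hcov j n hn φ s h, hcov j n hn _ s (h.neg hv), (hb (j + n)).ae_abs_le hC,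
    dens_nonneg hT (j + n),
    transferIter_const_mul hT (Nat.le_add_right j n) h.integrable (-1)]
    with y hlower hupper hdens_le hdens hneg
  rw [hneg, neg_one_mul] at hupper
  set d := dens T m (j + n) y
  have hcd : c / M * d ≤ c := by
    rw [div_mul_eq_mul_div, div_le_iff₀ hM0]
    gcongr
    linarith [le_abs_self d]
  calc |transferIter m T (Nat.le_add_right j n) φ y| ≤ s * (d - c) :=
        abs_le.2 ⟨by linarith, by linarith⟩
    _ ≤ s * ((1 - c / M) * d) := by
        gcongr
        linarith
    _ ≤ s * ((1 - c / M).toNNReal * d) := by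
        gcongr
        exact Real.le_coe_toNNReal _
    _ = ((1 - c / M).toNNReal * s : ℝ≥0) * d := by
        push_cast
        ring

/-- The covering condition contracts the gauge of the pointwise domination by the density, and the
Lasota–Yorke inequality that of the norm in `𝓑_j`. -/
theorem IsAdmissible.exists_contraction
    (hT : ∀ j, Measure.QuasiMeasurePreserving (T j) (m j) (m (j + 1)))
    (hv : IsVariation m var) (hC : IsVarConst m var C) (hadm : IsAdmissible m var T) :
    ∃ (R : ℝ≥0) (n : ℕ) (γ : ℝ≥0), 1 ≤ R ∧ 1 ≤ n ∧ γ < 1 ∧ ∀ j (φ : X j → ℝ) (s : ℝ≥0),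
      CenteredLE m var T R j φ s →
      CenteredLE m var T R (j + n) (transferIter m T (Nat.le_add_right j n) φ) (γ * s) := by
  obtain ⟨N, α, B, hN, hα, hLY⟩ := hadm.exists_bNormLE_transferIter_mul hT
  set R : ℝ≥0 := 4 * B + 1 with hR
  obtain ⟨γ, n₀, hγ, hdom⟩ := hadm.exists_abs_transferIter_le_mul_dens hT hv hC
    (by positivity : 0 < R)
  obtain ⟨q₀, hq₀⟩ := exists_pow_lt_of_lt_one (by norm_num : (0 : ℝ≥0) < 1 / 4) hα
  set q : ℕ := q₀ + n₀ + 1 with hq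
  have hαq : α ^ q ≤ 1 / 4 := (pow_le_pow_of_le_one zero_le hα.le (by omega)).trans hq₀.le
  have hR_half : α ^ q * R + B ≤ 1 / 2 * R := by
    have hαR : α ^ q * R ≤ 1 / 4 * R := by gcongr
    refine (add_le_add_left hαR B).trans ?_
    rw [hR]
    linarith
  refine ⟨R, q * N, max (1 / 2) γ, le_add_self, by nlinarith,
    max_lt (by norm_num) hγ, fun j φ s h => ⟨?_, ?_, ?_⟩⟩
  · simpa [h.integral_eq_zero] using
      integral_transferIter_mul hT (Nat.le_add_right j (q * N)) h.integrable (memLp_const (1 : ℝ))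
  · filter_upwards [hdom j (q * N) (by nlinarith) φ s h, dens_nonneg hT (j + q * N)] with y hy hd
    refine hy.trans ?_
    gcongr
    exact le_max_right _ _
  · refine (hLY q j φ _ s h.bNormLE h.ae_abs_le _ _ rfl).mono ?_
    calc α ^ q * (R * s) + B * s = (α ^ q * R + B) * s := by ring
      _ ≤ (1 / 2 * R) * s := by gcongr
      _ = R * (1 / 2 * s) := by ring
      _ ≤ R * (max (1 / 2) γ * s) := by
        gcongr
        exact le_max_left _ _

/-- The solution of `W_{k+1} = 𝓛_k (W_k + φ_k)` with `W_0 = 0`, that is,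
`W_k = ∑_{i<k} 𝓛_i^{(k-i)} φ_i`. It turns the martingale–coboundary decomposition of the `F_j`
into an explicit formula. -/
noncomputable def transferSum (m : ∀ j, Measure (X j)) (T : ∀ j, X j → X (j + 1))
    (φ : ∀ k, X k → ℝ) : ∀ k, X k → ℝ
  | 0 => fun _ => 0
  | k + 1 => transfer (m k) (m (k + 1)) (T k) fun x => transferSum m T φ k x + φ k x

theorem mul_geom_sum_succ {S : Type*} [CommSemiring S] (x y : S) (n : ℕ) :
    x * (y * (x * ∑ l ∈ Finset.range n, x ^ l) + y) =
      y * (x * ∑ l ∈ Finset.range (n + 1), x ^ l) := by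
  rw [geom_sum_succ]
  ring

theorem centeredLE_transferSum
    (hT : ∀ j, Measure.QuasiMeasurePreserving (T j) (m j) (m (j + 1)))
    (hv : IsVariation m var) {R K s₀ : ℝ≥0} (hK1 : 1 ≤ K)
    (hK : ∀ j (φ : X j → ℝ) (a : ℝ≥0), BNormLE m var j φ a →
      BNormLE m var (j + 1) (SeqLivsic.transfer (m j) (m (j + 1)) (T j) φ) (K * a))
    {φ : ∀ k, X k → ℝ} (hφ : ∀ k, CenteredLE m var T R k (φ k) s₀) (k : ℕ) :
    CenteredLE m var T R k (transferSum m T φ k)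
      (s₀ * (K * ∑ l ∈ Finset.range k, K ^ l)) := by
  induction k with
  | zero => exact (CenteredLE.zero hv).mono hT zero_le
  | succ k ih =>
    rw [← mul_geom_sum_succ]
    exact (ih.add hv (hφ k)).transfer hT hK1 hK

theorem centeredLE_transferSum_sub_transferIter
    (hT : ∀ j, Measure.QuasiMeasurePreserving (T j) (m j) (m (j + 1)))
    (hv : IsVariation m var) {R K s₀ : ℝ≥0} (hK1 : 1 ≤ K)
    (hK : ∀ j (φ : X j → ℝ) (a : ℝ≥0), BNormLE m var j φ a →
      BNormLE m var (j + 1) (SeqLivsic.transfer (m j) (m (j + 1)) (T j) φ) (K * a))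
    {φ : ∀ k, X k → ℝ} (hφ : ∀ k, CenteredLE m var T R k (φ k) s₀) {j : ℕ}
    (hj : Integrable (transferSum m T φ j) (m j)) (i : ℕ) :
    CenteredLE m var T R (j + i) (fun x => transferSum m T φ (j + i) x -
      transferIter m T (Nat.le_add_right j i) (transferSum m T φ j) x)
      (s₀ * (K * ∑ l ∈ Finset.range i, K ^ l)) := by
  induction i with
  | zero =>
    refine ((CenteredLE.zero hv).mono hT zero_le).congr_ae hv (.of_forall fun x => ?_)
    exact (sub_eq_zero.2
      (congrFun (transferIter_self T m le_rfl (transferSum m T φ j)) x).symm).symm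
  | succ i ih =>
    have hiter := transferIter_integrable (T := T) (Nat.le_add_right j i) hj
    have hcum : Integrable (transferSum m T φ (j + i)) (m (j + i)) := by
      simpa only [sub_add_cancel] using ih.integrable.fun_add hiter
    have hsub := transfer_sub (hT (j + i)) (hcum.fun_add (hφ (j + i)).integrable) hiter
    simp only [add_sub_right_comm] at hsub
    rw [← mul_geom_sum_succ]
    refine ((ih.add hv (hφ (j + i))).transfer hT hK1 hK).congr_ae hv
      (hsub.trans (.of_forall fun y => ?_))
    change _ = transferSum m T φ (j + i + 1) y - transferIter m T _ (transferSum m T φ j) y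
    rw [transferIter_succ T m (Nat.le_add_right j i)]
    rfl

theorem IsAdmissible.exists_centeredLE_transferSum
    (hT : ∀ j, Measure.QuasiMeasurePreserving (T j) (m j) (m (j + 1)))
    (hv : IsVariation m var) (hadm : IsAdmissible m var T) {R γ : ℝ≥0} {n : ℕ} (hn : 1 ≤ n)
    (hγ : γ < 1)
    (hcon : ∀ j (φ : X j → ℝ) (s : ℝ≥0), CenteredLE m var T R j φ s →
      CenteredLE m var T R (j + n) (transferIter m T (Nat.le_add_right j n) φ) (γ * s))
    (s₀ : ℝ≥0) :
    ∃ s : ℝ≥0, ∀ φ : ∀ k, X k → ℝ, (∀ k, CenteredLE m var T R k (φ k) s₀) →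
      ∀ k, CenteredLE m var T R k (transferSum m T φ k) s := by
  obtain ⟨K, hK1, hK⟩ := hadm.exists_bNormLE_transfer
  obtain ⟨s, hs, hs'⟩ := exists_le_and_mul_add_le hγ
    (s₀ * (K * ∑ l ∈ Finset.range n, K ^ l)) (s₀ * (K * ∑ l ∈ Finset.range n, K ^ l))
  refine ⟨s, fun φ hφ k => ?_⟩
  induction k using Nat.strong_induction_on with
  | _ k ih =>
    rcases lt_or_ge k n with hk | hk
    · refine (centeredLE_transferSum hT hv hK1 hK hφ k).mono hT (le_trans ?_ hs)
      gcongr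
    · obtain ⟨j, rfl⟩ := Nat.exists_eq_add_of_le' hk
      have hj := ih j (by omega)
      have hblock := (centeredLE_transferSum_sub_transferIter hT hv hK1 hK hφ hj.integrable
        n).add hv (hcon j _ s hj)
      simp only [sub_add_cancel] at hblock
      exact hblock.mono hT (by rwa [add_comm])

end Decay

/-! ### The martingale–coboundary decomposition -/

section Decomposition

variable {X : ℕ → Type*} [∀ j, MeasurableSpace (X j)] {m : ∀ j, Measure (X j)}
  {var : ∀ j, (X j → ℝ) → ℝ≥0∞} {T : ∀ j, X j → X (j + 1)} {C : ℝ≥0}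

/-- A Borel function on `X_j`, bounded by `b` everywhere and of norm at most `b` in `𝓑_j`. Since
elements of `𝓑_j` are only determined up to null sets, this is the form in which they enter the
martingale arguments. -/
structure IsBoundedRep (m : ∀ j, Measure (X j)) (var : ∀ j, (X j → ℝ) → ℝ≥0∞) (j : ℕ)
    (φ : X j → ℝ) (b : ℝ≥0) : Prop where
  measurable : Measurable φ
  abs_le : ∀ x, |φ x| ≤ b
  bNormLE : BNormLE m var j φ b

theorem exists_measurable_abs_le_ae_eq {Y : Type*} [MeasurableSpace Y] {μ : Measure Y}
    {f : Y → ℝ} (hf : AEStronglyMeasurable f μ) {D : ℝ} (hD : 0 ≤ D)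
    (hfD : ∀ᵐ y ∂μ, |f y| ≤ D) :
    ∃ g : Y → ℝ, Measurable g ∧ (∀ y, |g y| ≤ D) ∧ f =ᵐ[μ] g := by
  refine ⟨fun y => max (-D) (min D (hf.mk f y)),
    measurable_const.max (measurable_const.min hf.stronglyMeasurable_mk.measurable),
    fun y => abs_le.2 ⟨le_max_left _ _, max_le (by linarith) (min_le_left _ _)⟩, ?_⟩
  filter_upwards [hf.ae_eq_mk, hfD] with y hy hyD
  rw [← hy, min_eq_right (abs_le.1 hyD).2, max_eq_right (abs_le.1 hyD).1]

theorem BNormLE.exists_isBoundedRep (hv : IsVariation m var) (hC : IsVarConst m var C) {j : ℕ}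
    {φ : X j → ℝ} {b : ℝ≥0} (h : BNormLE m var j φ b) :
    ∃ g, IsBoundedRep m var j g (C * b) ∧ φ =ᵐ[m j] g := by
  obtain ⟨g, hgm, hgb, hφg⟩ :=
    exists_measurable_abs_le_ae_eq h.1.1 (by positivity) (h.ae_abs_le hC)
  exact ⟨g, ⟨hgm, by exact_mod_cast hgb,
    (h.congr_ae hv hφg).mono (le_mul_of_one_le_left' hC.one_le)⟩, hφg⟩

theorem BNormLE.exists_forall_of_forall_ge {g : ∀ j, X j → ℝ} {n₀ : ℕ} {a : ℝ≥0}
    (h : ∀ j ≥ n₀, BNormLE m var j (g j) a) (hg : ∀ j, ∃ b, BNormLE m var j (g j) b) :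
    ∃ b, ∀ j, BNormLE m var j (g j) b := by
  choose b hb using hg
  refine ⟨a + ∑ j ∈ Finset.range n₀, b j, fun j => ?_⟩
  rcases le_or_gt n₀ j with hj | hj
  · exact (h j hj).mono le_self_add
  · exact (hb j).mono ((Finset.single_le_sum (fun _ _ => zero_le)
      (Finset.mem_range.2 hj)).trans le_add_self)

/-- A martingale–coboundary decomposition `f_j = U_{j+1} ∘ T_j - U_j + M_j` of a sequence of
functions: `orthogonal` says that the `M_j ∘ T_0^{(j)}` are reverse martingale differences on
`(X_0, m_0)`, and `U_j ∘ T_0^{(j)}` has mean zero. Both are expressed through the density of the law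
of `T_0^{(j)}`. The functions `M_j` vanish for `j < n₀`, where this density may fail to be
invertible. -/
structure IsMartingaleCoboundary (m : ∀ j, Measure (X j)) (T : ∀ j, X j → X (j + 1))
    (f U M : ∀ j, X j → ℝ) (n₀ : ℕ) : Prop where
  eq : ∀ j, ∀ᵐ x ∂(m j), f j x = U (j + 1) (T j x) - U j x + M j x
  integral_eq_zero : ∀ j, ∫ x, dens T m j x * U j x ∂(m j) = 0
  orthogonal : ∀ j (ψ : X (j + 1) → ℝ), MemLp ψ ∞ (m (j + 1)) →
    ∫ x, dens T m j x * (M j x * ψ (T j x)) ∂(m j) = 0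
  eq_zero : ∀ j < n₀, M j =ᵐ[m j] fun _ => 0

theorem IsMartingaleCoboundary.congr_ae
    (hT : ∀ j, Measure.QuasiMeasurePreserving (T j) (m j) (m (j + 1)))
    {f U M U' M' : ∀ j, X j → ℝ} {n₀ : ℕ} (h : IsMartingaleCoboundary m T f U M n₀)
    (hU : ∀ j, U j =ᵐ[m j] U' j) (hM : ∀ j, M j =ᵐ[m j] M' j) :
    IsMartingaleCoboundary m T f U' M' n₀ where
  eq j := by
    filter_upwards [h.eq j, hU j, hM j, (hT j).ae (hU (j + 1))] with x hx hUx hMx hUT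
    rw [hx, hUx, hMx, hUT]
  integral_eq_zero j := by
    rw [← h.integral_eq_zero j]
    exact integral_congr_ae ((hU j).mono fun x hx => by simp only [hx])
  orthogonal j ψ hψ := by
    rw [← h.orthogonal j ψ hψ]
    exact integral_congr_ae ((hM j).mono fun x hx => by simp only [hx])
  eq_zero j hj := (hM j).symm.trans (h.eq_zero j hj)

/-- The functions `f_k` weighted by the density of the law of `T_0^{(k)}`, cut off below `n₀`. -/
noncomputable def densSource (m : ∀ j, Measure (X j)) (T : ∀ j, X j → X (j + 1)) (n₀ : ℕ)
    (f : ∀ j, X j → ℝ) (k : ℕ) : X k → ℝ :=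
  if n₀ ≤ k then fun x => dens T m k x * f k x else fun _ => 0

/-- The coboundary part of the decomposition of `f`. For `j ≥ n₀` it is
`(∑_{n₀ ≤ i < j} 𝓛_i^{(j-i)} (d_i f_i)) / d_j`, where `d_i` is the density of the law of
`T_0^{(i)}`; below `n₀` it is continued by `U_j = U_{j+1} ∘ T_j - f_j`. -/
noncomputable def coboundaryPart (m : ∀ j, Measure (X j)) (T : ∀ j, X j → X (j + 1)) (n₀ : ℕ)
    (f : ∀ j, X j → ℝ) (j : ℕ) : X j → ℝ :=
  if n₀ ≤ j then fun x => transferSum m T (densSource m T n₀ f) j x * (dens T m j x)⁻¹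
  else fun x => coboundaryPart m T n₀ f (j + 1) (T j x) - f j x
termination_by n₀ - j

/-- The martingale part of the decomposition of `f`. -/
noncomputable def martingalePart (m : ∀ j, Measure (X j)) (T : ∀ j, X j → X (j + 1)) (n₀ : ℕ)
    (f : ∀ j, X j → ℝ) (j : ℕ) (x : X j) : ℝ :=
  f j x + coboundaryPart m T n₀ f j x - coboundaryPart m T n₀ f (j + 1) (T j x)

section Parts

variable {c : ℝ≥0} {n₀ : ℕ} {f : ∀ j, X j → ℝ}

theorem coboundaryPart_of_lt {j : ℕ} (hj : j < n₀) (x : X j) :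
    coboundaryPart m T n₀ f j x = coboundaryPart m T n₀ f (j + 1) (T j x) - f j x := by
  rw [coboundaryPart, if_neg hj.not_ge]

theorem martingalePart_of_lt {j : ℕ} (hj : j < n₀) (x : X j) :
    martingalePart m T n₀ f j x = 0 := by
  rw [martingalePart, coboundaryPart_of_lt hj]
  ring

theorem dens_mul_coboundaryPart (hc : 0 < c) {j : ℕ} (hj : n₀ ≤ j)
    (hd : ∀ᵐ x ∂(m j), (c : ℝ) ≤ dens T m j x) :
    ∀ᵐ x ∂(m j), dens T m j x * coboundaryPart m T n₀ f j x =
      transferSum m T (densSource m T n₀ f) j x := by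
  filter_upwards [hd] with x hx
  have hpos : 0 < dens T m j x := (NNReal.coe_pos.2 hc).trans_le hx
  rw [coboundaryPart, if_pos hj]
  field_simp

end Parts

variable [∀ j, IsProbabilityMeasure (m j)]

theorem IsAdmissible.exists_le_dens (hv : IsVariation m var) (hadm : IsAdmissible m var T) :
    ∃ (c : ℝ≥0) (n₀ : ℕ), 0 < c ∧ ∀ j ≥ n₀, ∀ᵐ x ∂(m j), (c : ℝ) ≤ dens T m j x := by
  obtain ⟨a, ha⟩ := hv.exists_bNormLE_one 0
  obtain ⟨c, n₀, hc, hcov⟩ := hadm.covering (a + 1) (by positivity)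
  refine ⟨c.toNNReal, n₀, Real.toNNReal_pos.2 hc, fun j hj => ?_⟩
  obtain ⟨n, rfl⟩ : ∃ n, j = 0 + n := ⟨j, by simp⟩
  have hvar : var 0 (fun _ => 1) ≤ ENNReal.ofReal ((a + 1) * ∫ _, (1 : ℝ) ∂(m 0)) := by
    refine ha.var_le.trans ?_
    rw [integral_const, probReal_univ, smul_eq_mul, mul_one, mul_one,
      ENNReal.ofReal_add a.coe_nonneg zero_le_one, ENNReal.ofReal_coe_nnreal]
    exact le_self_add
  filter_upwards [hcov 0 n (by omega) _ ha.memB (.of_forall fun _ => zero_le_one) hvar] with x hx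
  simpa [Real.coe_toNNReal _ hc.le, dens] using hx

theorem BNormLE.integrable_comp_orbit
    (hT : ∀ j, Measure.QuasiMeasurePreserving (T j) (m j) (m (j + 1))) (hC : IsVarConst m var C)
    {j : ℕ} {f : X j → ℝ} {a : ℝ≥0} (hf : BNormLE m var j f a) :
    Integrable (fun x => f (orbit T (Nat.zero_le j) x)) (m 0) :=
  have horbit := quasiMeasurePreserving_orbit hT (Nat.zero_le j)
  .of_bound (hf.1.1.comp_quasiMeasurePreserving horbit) _ (horbit.ae (hf.ae_abs_le hC))

theorem BNormLE.abs_integral_comp_orbit_le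
    (hT : ∀ j, Measure.QuasiMeasurePreserving (T j) (m j) (m (j + 1))) (hC : IsVarConst m var C)
    {j : ℕ} {f : X j → ℝ} {a : ℝ≥0} (hf : BNormLE m var j f a) :
    |∫ x, f (orbit T (Nat.zero_le j) x) ∂(m 0)| ≤ C * a := by
  simpa using norm_integral_le_of_norm_le_const (μ := m 0)
    (f := fun x => f (orbit T (Nat.zero_le j) x))
    ((quasiMeasurePreserving_orbit hT (Nat.zero_le j)).ae (hf.ae_abs_le hC))

theorem BNormLE.sub_integral_comp_orbit
    (hT : ∀ j, Measure.QuasiMeasurePreserving (T j) (m j) (m (j + 1))) (hv : IsVariation m var)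
    (hC : IsVarConst m var C) {j : ℕ} {f : X j → ℝ} {a K : ℝ≥0} (hf : BNormLE m var j f a)
    (hone : BNormLE m var j (fun _ => (1 : ℝ)) K) :
    BNormLE m var j (fun x => f x - ∫ y, f (orbit T (Nat.zero_le j) y) ∂(m 0))
      (a + C * a * K) := by
  have hmean : ‖∫ y, f (orbit T (Nat.zero_le j) y) ∂(m 0)‖₊ ≤ C * a := by
    exact_mod_cast hf.abs_integral_comp_orbit_le hT hC
  simpa only [mul_one] using (hf.sub hv (hone.const_mul hv _)).mono
    (b := a + C * a * K) (by gcongr)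

theorem BNormLE.integral_dens_mul_sub_integral_comp_orbit
    (hT : ∀ j, Measure.QuasiMeasurePreserving (T j) (m j) (m (j + 1))) (hC : IsVarConst m var C)
    {j : ℕ} {f : X j → ℝ} {a : ℝ≥0} (hf : BNormLE m var j f a) :
    ∫ x, dens T m j x * (f x - ∫ y, f (orbit T (Nat.zero_le j) y) ∂(m 0)) ∂(m j) = 0 := by
  rw [integral_dens_mul hT j (ψ := fun x => f x - ∫ y, f (orbit T (Nat.zero_le j) y) ∂(m 0))
    ((hf.memLp_top hC).sub (memLp_const _)),
    integral_sub (hf.integrable_comp_orbit hT hC) (integrable_const _)]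
  simp

theorem IsAdmissible.exists_bNormLE_one_and_inv_dens
    (hT : ∀ j, Measure.QuasiMeasurePreserving (T j) (m j) (m (j + 1)))
    (hv : IsVariation m var) (hadm : IsAdmissible m var T) {c : ℝ≥0} {n₀ : ℕ} (hc : 0 < c)
    (hd : ∀ j ≥ n₀, ∀ᵐ x ∂(m j), (c : ℝ) ≤ dens T m j x) :
    ∃ K : ℝ≥0, (∀ j, BNormLE m var j (fun _ => (1 : ℝ)) K) ∧
      ∀ j ≥ n₀, BNormLE m var j (fun x => (dens T m j x)⁻¹) K := by
  obtain ⟨C, hC⟩ := hv.exists_isVarConst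
  obtain ⟨b, hb⟩ := exists_bNormLE_dens hT hv hadm
  obtain ⟨K, hK⟩ := hC.exists_bNormLE_inv hv b (NNReal.coe_pos.2 hc)
  obtain ⟨L, hL⟩ := BNormLE.exists_forall_of_forall_ge
    (fun j hj => (hK j _ (hb j) (hd j hj)).1) hv.exists_bNormLE_one
  exact ⟨L + K, fun j => (hL j).mono le_self_add,
    fun j hj => (hK j _ (hb j) (hd j hj)).2.mono le_add_self⟩

theorem IsAdmissible.exists_centeredLE_one_transferSum
    (hT : ∀ j, Measure.QuasiMeasurePreserving (T j) (m j) (m (j + 1)))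
    (hv : IsVariation m var) (hadm : IsAdmissible m var T) {c : ℝ≥0} {n₀ : ℕ} (hc : 0 < c)
    (hd : ∀ j ≥ n₀, ∀ᵐ x ∂(m j), (c : ℝ) ≤ dens T m j x) (a : ℝ≥0) :
    ∃ s : ℝ≥0, ∀ φ : ∀ k, X k → ℝ, (∀ k < n₀, φ k =ᵐ[m k] fun _ => 0) →
      (∀ k ≥ n₀, BNormLE m var k (φ k) a) → (∀ k ≥ n₀, ∫ x, φ k x ∂(m k) = 0) →
      ∀ k, CenteredLE m var T 1 k (transferSum m T φ k) s := by
  obtain ⟨C, hC⟩ := hv.exists_isVarConst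
  obtain ⟨R, n, γ, hR, hn, hγ, hcon⟩ := hadm.exists_contraction hT hv hC
  obtain ⟨s, hs⟩ := hadm.exists_centeredLE_transferSum hT hv hn hγ hcon (a + C * a / c)
  refine ⟨R * s, fun φ hzero hbound hmean k => ?_⟩
  have hφ (k : ℕ) : CenteredLE m var T R k (φ k) (a + C * a / c) := by
    rcases lt_or_ge k n₀ with hk | hk
    · exact ((CenteredLE.zero hv).mono hT zero_le).congr_ae hv (hzero k hk).symm
    · exact .of_bNormLE hC hc hR (hd k hk) (hbound k hk) (hmean k hk)
  have hW := hs φ hφ k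
  exact ⟨hW.integral_eq_zero, (hW.mono hT (le_mul_of_one_le_left' hR)).ae_abs_le,
    by simpa only [one_mul] using hW.bNormLE⟩

section Parts

variable {c : ℝ≥0} {n₀ : ℕ} {f : ∀ j, X j → ℝ}

theorem IsAdmissible.exists_centeredLE_transferSum_densSource
    (hT : ∀ j, Measure.QuasiMeasurePreserving (T j) (m j) (m (j + 1)))
    (hv : IsVariation m var) (hadm : IsAdmissible m var T) (hc : 0 < c)
    (hd : ∀ j ≥ n₀, ∀ᵐ x ∂(m j), (c : ℝ) ≤ dens T m j x) {a : ℝ≥0}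
    (hf : ∀ j, BNormLE m var j (f j) a) (hf0 : ∀ j, ∫ x, dens T m j x * f j x ∂(m j) = 0) :
    ∃ s, ∀ k, CenteredLE m var T 1 k (transferSum m T (densSource m T n₀ f) k) s := by
  obtain ⟨C, hC⟩ := hv.exists_isVarConst
  obtain ⟨b, hb⟩ := exists_bNormLE_dens hT hv hadm
  obtain ⟨s, hs⟩ := hadm.exists_centeredLE_one_transferSum hT hv hc hd (3 * C ^ 2 * (b * a))
  refine ⟨s, hs _ (fun k hk => ?_) (fun k hk => ?_) fun k hk => ?_⟩
  · rw [densSource, if_neg hk.not_ge]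
  · rw [densSource, if_pos hk]
    exact (hb k).mul hC (hf k)
  · rw [densSource, if_pos hk, hf0]

theorem IsAdmissible.exists_bNormLE_coboundaryPart
    (hT : ∀ j, Measure.QuasiMeasurePreserving (T j) (m j) (m (j + 1)))
    (hv : IsVariation m var) (hadm : IsAdmissible m var T) (hc : 0 < c)
    (hd : ∀ j ≥ n₀, ∀ᵐ x ∂(m j), (c : ℝ) ≤ dens T m j x) {b : ℝ≥0}
    (hcomp : ∀ j (h : X (j + 1) → ℝ), Integrable h (m (j + 1)) →
      var (j + 1) h ≤ 1 → var j (fun x => h (T j x)) ≤ b) {a : ℝ≥0}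
    (hf : ∀ j, BNormLE m var j (f j) a) (hf0 : ∀ j, ∫ x, dens T m j x * f j x ∂(m j) = 0) :
    ∃ B, ∀ j, BNormLE m var j (coboundaryPart m T n₀ f j) B := by
  obtain ⟨C, hC⟩ := hv.exists_isVarConst
  obtain ⟨K, -, hK⟩ := hadm.exists_bNormLE_one_and_inv_dens hT hv hc hd
  obtain ⟨s, hs⟩ := hadm.exists_centeredLE_transferSum_densSource hT hv hc hd hf hf0
  have hge : ∀ j ≥ n₀, BNormLE m var j (coboundaryPart m T n₀ f j)
      (3 * C ^ 2 * (1 * s * K)) := fun j hj => by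
    rw [coboundaryPart, if_pos hj]
    exact (hs j).bNormLE.mul hC (hK j hj)
  refine BNormLE.exists_forall_of_forall_ge hge fun j => ?_
  induction j using coboundaryPart.induct (n₀ := n₀) with
  | case1 j hj => exact ⟨_, hge j hj⟩
  | case2 j hj ih =>
    obtain ⟨B, hB⟩ := ih
    refine ⟨_, ((hB.comp hT hv hC hcomp).sub hv (hf j)).congr_ae hv (.of_forall fun x => ?_)⟩
    exact (coboundaryPart_of_lt (not_le.1 hj) x).symm

theorem integral_dens_mul_coboundaryPart
    (hT : ∀ j, Measure.QuasiMeasurePreserving (T j) (m j) (m (j + 1))) (hc : 0 < c)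
    (hd : ∀ j ≥ n₀, ∀ᵐ x ∂(m j), (c : ℝ) ≤ dens T m j x)
    (hf : ∀ j, Integrable (fun x => dens T m j x * f j x) (m j))
    (hf0 : ∀ j, ∫ x, dens T m j x * f j x ∂(m j) = 0)
    (hU : ∀ j, MemLp (coboundaryPart m T n₀ f j) ∞ (m j))
    (hW : ∀ j, ∫ x, transferSum m T (densSource m T n₀ f) j x ∂(m j) = 0) (j : ℕ) :
    ∫ x, dens T m j x * coboundaryPart m T n₀ f j x ∂(m j) = 0 := by
  induction j using coboundaryPart.induct (n₀ := n₀) with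
  | case1 j hj => rw [integral_congr_ae (dens_mul_coboundaryPart hc hj (hd j hj)), hW]
  | case2 j hj ih =>
    simp only [coboundaryPart_of_lt (not_le.1 hj), mul_sub]
    rw [integral_sub (integrable_mul_comp (hT j) (dens_integrable j) (hU (j + 1))) (hf j), hf0,
      ← transfer_duality (hT j) (dens_integrable j) (hU (j + 1)), ← dens_succ, ih, sub_zero]

theorem integral_dens_mul_martingalePart_mul_comp
    (hT : ∀ j, Measure.QuasiMeasurePreserving (T j) (m j) (m (j + 1))) (hc : 0 < c)
    (hd : ∀ j ≥ n₀, ∀ᵐ x ∂(m j), (c : ℝ) ≤ dens T m j x)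
    (hf : ∀ j, Integrable (fun x => dens T m j x * f j x) (m j))
    (hU : ∀ j, MemLp (coboundaryPart m T n₀ f j) ∞ (m j))
    (hW : ∀ j, Integrable (transferSum m T (densSource m T n₀ f) j) (m j)) (j : ℕ)
    {ψ : X (j + 1) → ℝ} (hψ : MemLp ψ ∞ (m (j + 1))) :
    ∫ x, dens T m j x * (martingalePart m T n₀ f j x * ψ (T j x)) ∂(m j) = 0 := by
  rcases lt_or_ge j n₀ with hj | hj
  · simp [martingalePart_of_lt hj]
  · set U := coboundaryPart m T n₀ f
    set W := transferSum m T (densSource m T n₀ f) with hWdef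
    have hsource : densSource m T n₀ f j = fun x => dens T m j x * f j x := if_pos hj
    have hUψ : MemLp (fun y => U (j + 1) y * ψ y) ∞ (m (j + 1)) := hψ.mul (hU (j + 1))
    have hWf : Integrable (fun x => W j x + densSource m T n₀ f j x) (m j) :=
      (hW j).fun_add (by rw [hsource]; exact hf j)
    calc ∫ x, dens T m j x * (martingalePart m T n₀ f j x * ψ (T j x)) ∂(m j)
        = ∫ x, ((W j x + densSource m T n₀ f j x) * ψ (T j x) -
            dens T m j x * (U (j + 1) (T j x) * ψ (T j x))) ∂(m j) := by
          refine integral_congr_ae ?_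
          filter_upwards [dens_mul_coboundaryPart (f := f) hc hj (hd j hj)] with x hx
          rw [hWdef, ← hx, hsource, martingalePart]
          ring
      _ = ∫ y, W (j + 1) y * ψ y ∂(m (j + 1)) -
            ∫ y, dens T m (j + 1) y * (U (j + 1) y * ψ y) ∂(m (j + 1)) := by
          rw [integral_sub (integrable_mul_comp (hT j) hWf hψ)
            (integrable_mul_comp (hT j) (dens_integrable j) hUψ),
            ← transfer_duality (hT j) hWf hψ, ← transfer_duality (hT j) (dens_integrable j) hUψ,
            ← dens_succ]
          rfl
      _ = 0 := by
          rw [sub_eq_zero]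
          refine integral_congr_ae ?_
          have hj' : n₀ ≤ j + 1 := Nat.le_succ_of_le hj
          filter_upwards [dens_mul_coboundaryPart (f := f) hc hj' (hd (j + 1) hj')] with y hy
          rw [← mul_assoc, hy]

theorem IsAdmissible.isMartingaleCoboundary_parts
    (hT : ∀ j, Measure.QuasiMeasurePreserving (T j) (m j) (m (j + 1)))
    (hv : IsVariation m var) (hadm : IsAdmissible m var T) (hc : 0 < c)
    (hd : ∀ j ≥ n₀, ∀ᵐ x ∂(m j), (c : ℝ) ≤ dens T m j x) {a B : ℝ≥0}
    (hf : ∀ j, BNormLE m var j (f j) a) (hf0 : ∀ j, ∫ x, dens T m j x * f j x ∂(m j) = 0)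
    (hU : ∀ j, BNormLE m var j (coboundaryPart m T n₀ f j) B) :
    IsMartingaleCoboundary m T f (coboundaryPart m T n₀ f) (martingalePart m T n₀ f) n₀ := by
  obtain ⟨C, hC⟩ := hv.exists_isVarConst
  obtain ⟨s, hs⟩ := hadm.exists_centeredLE_transferSum_densSource hT hv hc hd hf hf0
  have hdf (j : ℕ) := (dens_integrable (T := T) j).mul_of_top_left ((hf j).memLp_top hC)
  have hUtop (j : ℕ) := (hU j).memLp_top hC
  exact {
    eq := fun j => .of_forall fun x => by rw [martingalePart]; ring
    integral_eq_zero := integral_dens_mul_coboundaryPart hT hc hd hdf hf0 hUtop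
      fun j => (hs j).integral_eq_zero
    orthogonal := fun j ψ => integral_dens_mul_martingalePart_mul_comp hT hc hd hdf hUtop
      (fun j => (hs j).integrable) j
    eq_zero := fun j hj => .of_forall (martingalePart_of_lt hj) }

end Parts

theorem IsAdmissible.exists_isMartingaleCoboundary
    (hT : ∀ j, Measure.QuasiMeasurePreserving (T j) (m j) (m (j + 1)))
    (hv : IsVariation m var) (hadm : IsAdmissible m var T) {c : ℝ≥0} {n₀ : ℕ} (hc : 0 < c)
    (hd : ∀ j ≥ n₀, ∀ᵐ x ∂(m j), (c : ℝ) ≤ dens T m j x) {b : ℝ≥0}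
    (hcomp : ∀ j (h : X (j + 1) → ℝ), Integrable h (m (j + 1)) →
      var (j + 1) h ≤ 1 → var j (fun x => h (T j x)) ≤ b)
    {F : ∀ j, X j → ℝ} {a : ℝ≥0} (hF : ∀ j, BNormLE m var j (F j) a) :
    ∃ (U M : ∀ j, X j → ℝ) (B : ℝ≥0), (∀ j, IsBoundedRep m var j (U j) B) ∧
      (∀ j, IsBoundedRep m var j (M j) B) ∧
      IsMartingaleCoboundary m T
        (fun j x => F j x - ∫ y, F j (orbit T (Nat.zero_le j) y) ∂(m 0)) U M n₀ := by
  obtain ⟨C, hC⟩ := hv.exists_isVarConst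
  obtain ⟨K, hone, -⟩ := hadm.exists_bNormLE_one_and_inv_dens hT hv hc hd
  have hf (j : ℕ) := (hF j).sub_integral_comp_orbit hT hv hC (hone j)
  have hf0 (j : ℕ) := (hF j).integral_dens_mul_sub_integral_comp_orbit hT hC
  obtain ⟨B, hB⟩ := hadm.exists_bNormLE_coboundaryPart hT hv hc hd hcomp hf hf0
  have hM (j : ℕ) := ((hf j).add hv (hB j)).sub hv ((hB (j + 1)).comp hT hv hC hcomp)
  have hle := le_max_right B (a + C * a * K + B + (C * B + (B + 1) * b))
  choose U hU hUe using fun j => ((hB j).mono (le_max_left _ _)).exists_isBoundedRep hv hC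
  choose M hM hMe using fun j => ((hM j).mono hle).exists_isBoundedRep hv hC
  exact ⟨U, M, _, hU, hM,
    (hadm.isMartingaleCoboundary_parts hT hv hc hd hf hf0 hB).congr_ae hT hUe hMe⟩

end Decomposition

theorem BddMeas.memLp_top {Y : Type*} [mY : MeasurableSpace Y] {μ : Measure Y} {f : Y → ℝ}
    (hf : BddMeas mY f) : MemLp f ∞ μ := by
  obtain ⟨hm, C, hC⟩ := hf
  exact memLp_top_of_bound hm.aestronglyMeasurable C (.of_forall hC)

theorem BddMeas.comp {Y Z : Type*} [mY : MeasurableSpace Y] [mZ : MeasurableSpace Z] {f : Z → ℝ}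
    (hf : BddMeas mZ f) {S : Y → Z} (hS : Measurable S) : BddMeas mY fun y => f (S y) :=
  ⟨hf.1.comp hS, hf.2.imp fun _ hC y => hC (S y)⟩

theorem BddMeas.exists_eq_comp {Y Z : Type*} [mZ : MeasurableSpace Z] {S : Y → Z} {g : Y → ℝ}
    (hg : BddMeas (MeasurableSpace.comap S mZ) g) :
    ∃ ψ : Z → ℝ, BddMeas mZ ψ ∧ ∀ y, g y = ψ (S y) := by
  obtain ⟨hm, C, hC⟩ := hg
  obtain ⟨h, hh, rfl⟩ := hm.exists_eq_measurable_comp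
  refine ⟨fun z => max (-|C|) (min |C| (h z)),
    ⟨measurable_const.max (measurable_const.min hh), |C|, fun z => abs_le.2
      ⟨le_max_left _ _, max_le (by linarith [abs_nonneg C]) (min_le_left _ _)⟩⟩, fun y => ?_⟩
  obtain ⟨hlower, hupper⟩ := abs_le.1 ((hC y).trans (le_abs_self C))
  simp only [Function.comp_apply] at hlower hupper ⊢
  rw [min_eq_right hupper, max_eq_right hlower]

theorem IsRevMartDiff.condExp_ae_eq_zero {Ω : Type*} [mΩ : MeasurableSpace Ω] {P : Measure Ω}
    [IsProbabilityMeasure P] {𝓖 : ℕ → MeasurableSpace Ω} {ξ : ℕ → Ω → ℝ} {D : ℝ}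
    (h : IsRevMartDiff P 𝓖 ξ D) (k : ℕ) : P[ξ k | 𝓖 (k + 1)] =ᵐ[P] 0 := by
  refine (ae_eq_condExp_of_forall_setIntegral_eq (h.le _) (h.bddMeas k).integrable
    (fun s _ _ => integrableOn_zero) (fun s hs _ => ?_) aestronglyMeasurable_zero).symm
  have horth := h.orth k (s.indicator fun _ => (1 : ℝ))
    ⟨measurable_const.indicator hs, 1, fun ω => by by_cases hω : ω ∈ s <;> simp [hω]⟩
  simp only [mul_indicator_one] at horth
  rw [integral_indicator (h.le _ _ hs)] at horth
  simp [horth]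

section OrbitProcess

variable {X : ℕ → Type*} [mX : ∀ j, MeasurableSpace (X j)] {m : ∀ j, Measure (X j)}
  {var : ∀ j, (X j → ℝ) → ℝ≥0∞} {T : ∀ j, X j → X (j + 1)}

/-- The σ-algebra on `X_0` generated by `T_0^{(k)}`. -/
abbrev orbitAlgebra (T : ∀ j, X j → X (j + 1)) (k : ℕ) : MeasurableSpace (X 0) :=
  MeasurableSpace.comap (orbit T (Nat.zero_le k)) (mX k)

/-- The function `f_k ∘ T_0^{(k)}`, through which functions on `X_k` become random variables on
`(X_0, m_0)`. -/
abbrev alongOrbit (T : ∀ j, X j → X (j + 1)) (f : ∀ k, X k → ℝ) (k : ℕ) (x : X 0) : ℝ :=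
  f k (orbit T (Nat.zero_le k) x)

theorem IsBoundedRep.bddMeas {j : ℕ} {φ : X j → ℝ} {b : ℝ≥0} (h : IsBoundedRep m var j φ b) :
    BddMeas (mX j) φ :=
  ⟨h.measurable, b, h.abs_le⟩

theorem antitone_orbitAlgebra (hT : ∀ j, Measurable (T j)) : Antitone (orbitAlgebra T) := by
  refine antitone_nat_of_succ_le fun k => ?_
  rw [orbitAlgebra, show orbit T (Nat.zero_le (k + 1)) = T k ∘ orbit T (Nat.zero_le k) from
    funext fun x => orbit_succ T _ _ x, ← MeasurableSpace.comap_comp]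
  exact MeasurableSpace.comap_mono (hT k).comap_le

theorem IsBoundedRep.bddMeas_alongOrbit
    (hT : ∀ j, Measure.QuasiMeasurePreserving (T j) (m j) (m (j + 1))) {f : ∀ j, X j → ℝ} {k : ℕ}
    {b : ℝ≥0} (hf : IsBoundedRep m var k (f k) b) : BddMeas (mX 0) (alongOrbit T f k) :=
  hf.bddMeas.comp (quasiMeasurePreserving_orbit hT (Nat.zero_le k)).measurable

variable [∀ j, IsProbabilityMeasure (m j)]

theorem IsMartingaleCoboundary.integral_alongOrbit_eq_zero
    (hT : ∀ j, Measure.QuasiMeasurePreserving (T j) (m j) (m (j + 1)))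
    {f U M : ∀ j, X j → ℝ} {n₀ : ℕ} (h : IsMartingaleCoboundary m T f U M n₀) {j : ℕ} {B : ℝ≥0}
    (hU : IsBoundedRep m var j (U j) B) : ∫ x, alongOrbit T U j x ∂(m 0) = 0 := by
  rw [← h.integral_eq_zero j, integral_dens_mul hT j hU.bddMeas.memLp_top]

theorem IsMartingaleCoboundary.isRevMartDiff
    (hT : ∀ j, Measure.QuasiMeasurePreserving (T j) (m j) (m (j + 1)))
    {f U M : ∀ j, X j → ℝ} {n₀ : ℕ} (h : IsMartingaleCoboundary m T f U M n₀) {B : ℝ≥0}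
    (hM : ∀ j, IsBoundedRep m var j (M j) B) :
    IsRevMartDiff (m 0) (orbitAlgebra T) (alongOrbit T M) B where
  anti := antitone_orbitAlgebra fun j => (hT j).measurable
  le k := (quasiMeasurePreserving_orbit hT (Nat.zero_le k)).measurable.comap_le
  meas k := (hM k).measurable.comp (comap_measurable _)
  bound k x := (hM k).abs_le _
  orth k g hg := by
    obtain ⟨ψ, hψ, hgψ⟩ := BddMeas.exists_eq_comp hg
    rw [← h.orthogonal k ψ hψ.memLp_top, integral_dens_mul hT k
      (((hM k).bddMeas.mul (hψ.comp (hT k).measurable)).memLp_top)]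
    simp only [hgψ, orbit_succ T (Nat.zero_le k)]

theorem integral_transferSum_dens_mul_mul
    (hT : ∀ j, Measure.QuasiMeasurePreserving (T j) (m j) (m (j + 1))) {f : ∀ k, X k → ℝ}
    (hf : ∀ k, BddMeas (mX k) (f k))
    (hint : ∀ k, Integrable (transferSum m T (fun k x => dens T m k x * f k x) k) (m k))
    (n : ℕ) {ψ : X n → ℝ} (hψ : BddMeas (mX n) ψ) :
    ∫ y, transferSum m T (fun k x => dens T m k x * f k x) n y * ψ y ∂(m n) =
      ∫ x, psum (alongOrbit T f) n x * ψ (orbit T (Nat.zero_le n) x) ∂(m 0) := by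
  have horbit (k : ℕ) := (quasiMeasurePreserving_orbit hT (Nat.zero_le k)).measurable
  induction n with
  | zero => simp [transferSum, psum]
  | succ n ih =>
    have hψT : BddMeas (mX n) fun x => ψ (T n x) := hψ.comp (hT n).measurable
    have hdf : Integrable (fun x => dens T m n x * f n x) (m n) :=
      (dens_integrable n).mul_of_top_left (hf n).memLp_top
    have hpsum : BddMeas (mX 0) (psum (alongOrbit T f) n) :=
      BddMeas.sum fun i _ => (hf i).comp (horbit i)
    rw [transferSum, transfer_duality (hT n) ((hint n).fun_add hdf) hψ.memLp_top]
    simp only [add_mul]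
    rw [integral_add (integrable_mul_comp (hT n) (hint n) hψ.memLp_top)
      (integrable_mul_comp (hT n) hdf hψ.memLp_top), ih hψT]
    simp only [mul_assoc]
    rw [integral_dens_mul hT n ((hf n).mul hψT).memLp_top,
      ← integral_add (hpsum.mul (hψT.comp (horbit n))).integrable
        (((hf n).mul hψT).comp (horbit n)).integrable]
    simp only [psum, Finset.sum_range_succ, add_mul, orbit_succ T (Nat.zero_le n)]

theorem CenteredLE.abs_integral_mul_le
    (hT : ∀ j, Measure.QuasiMeasurePreserving (T j) (m j) (m (j + 1))) {R s : ℝ≥0} {j : ℕ}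
    {φ : X j → ℝ} (hφ : CenteredLE m var T R j φ s) {ψ : X j → ℝ} (hψ : MemLp ψ ∞ (m j)) :
    |∫ x, φ x * ψ x ∂(m j)| ≤ s * ∫ x, |ψ (orbit T (Nat.zero_le j) x)| ∂(m 0) := by
  have habs : MemLp (fun x => |ψ x|) ∞ (m j) := hψ.norm
  rw [← integral_dens_mul hT j habs, ← integral_const_mul]
  refine abs_integral_le_integral_abs.trans (integral_mono_ae
    (hφ.integrable.mul_of_top_left hψ).abs
    (((dens_integrable j).mul_of_top_left habs).const_mul _) ?_)
  filter_upwards [hφ.ae_abs_le] with x hx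
  rw [abs_mul, ← mul_assoc]
  exact mul_le_mul_of_nonneg_right hx (abs_nonneg _)

theorem integral_psum_sub_integral_mul {Ω : Type*} [mΩ : MeasurableSpace Ω] {P : Measure Ω}
    [IsFiniteMeasure P] {η : ℕ → Ω → ℝ} (hη : ∀ k, BddMeas mΩ (η k)) {g : Ω → ℝ}
    (hg : BddMeas mΩ g) (n : ℕ) :
    ∫ ω, psum (fun k ω => η k ω - ∫ ω', η k ω' ∂P) n ω * g ω ∂P =
      ∫ ω, psum η n ω * g ω ∂P - (∫ ω, psum η n ω ∂P) * ∫ ω, g ω ∂P := by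
  have hsum : BddMeas mΩ (psum η n) := BddMeas.sum fun i _ => hη i
  have hpsum : ∫ ω, psum η n ω ∂P = ∑ k ∈ Finset.range n, ∫ ω, η k ω ∂P :=
    integral_finsetSum _ fun k _ => (hη k).integrable
  rw [hpsum, ← integral_const_mul, ← integral_sub (hsum.mul hg).integrable
    (hg.const_mul _).integrable]
  simp only [psum, Finset.sum_sub_distrib, sub_mul]

theorem IsAdmissible.exists_condVarDefectLE
    (hT : ∀ j, Measure.QuasiMeasurePreserving (T j) (m j) (m (j + 1)))
    (hv : IsVariation m var) (hadm : IsAdmissible m var T) {c : ℝ≥0} {n₀ : ℕ} (hc : 0 < c)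
    (hd : ∀ j ≥ n₀, ∀ᵐ x ∂(m j), (c : ℝ) ≤ dens T m j x) {M : ∀ j, X j → ℝ} {B : ℝ≥0}
    (hM : ∀ j, IsBoundedRep m var j (M j) B) (hM0 : ∀ j < n₀, M j =ᵐ[m j] fun _ => 0) :
    ∃ s : ℝ≥0, CondVarDefectLE (m 0) (orbitAlgebra T) (alongOrbit T M) s := by
  obtain ⟨C, hC⟩ := hv.exists_isVarConst
  obtain ⟨b, hb⟩ := exists_bNormLE_dens hT hv hadm
  obtain ⟨K, hone, -⟩ := hadm.exists_bNormLE_one_and_inv_dens hT hv hc hd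
  have hsq (k : ℕ) : BNormLE m var k (fun x => M k x ^ 2) (3 * C ^ 2 * (B * B)) := by
    simpa only [sq (M k _)] using (hM k).bNormLE.mul hC (hM k).bNormLE
  set f : ∀ k, X k → ℝ := fun k x => M k x ^ 2 - ∫ y, alongOrbit T M k y ^ 2 ∂(m 0) with hf
  have hfB (k : ℕ) := (hsq k).sub_integral_comp_orbit hT hv hC (hone k)
  have hfm (k : ℕ) : BddMeas (mX k) (f k) := ((hM k).bddMeas.pow 2).sub (.const _)
  have hdf0 : ∀ k < n₀, (fun x => dens T m k x * f k x) =ᵐ[m k] fun _ => 0 := fun k hk => by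
    have hzero : ∫ y, alongOrbit T M k y ^ 2 ∂(m 0) = 0 := integral_eq_zero_of_ae <| by
      filter_upwards [(quasiMeasurePreserving_orbit hT (Nat.zero_le k)).ae (hM0 k hk)] with x hx
      simp [alongOrbit, hx]
    filter_upwards [hM0 k hk] with x hx
    simp only [hf, hx, hzero]
    ring
  obtain ⟨s, hs⟩ := hadm.exists_centeredLE_one_transferSum hT hv hc hd _
  have hW := hs _ hdf0 (fun k _ => (hb k).mul hC (hfB k)) fun k _ =>
    (hsq k).integral_dens_mul_sub_integral_comp_orbit hT hC
  refine ⟨s, fun n g hg hg0 => ?_⟩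
  have hgm := hg.mono (quasiMeasurePreserving_orbit hT (Nat.zero_le n)).measurable.comap_le
  obtain ⟨ψ, hψ, hgψ⟩ := BddMeas.exists_eq_comp hg
  have hle := (hW n).abs_integral_mul_le hT hψ.memLp_top
  rw [integral_transferSum_dens_mul_mul hT hfm (fun k => (hW k).integrable) n hψ] at hle
  simp only [← hgψ, abs_of_nonneg (hg0 _)] at hle
  have hdefect := integral_psum_sub_integral_mul (P := m 0)
    (fun k => ((hM k).bddMeas_alongOrbit hT).pow 2) hgm n
  exact (congrArg abs hdefect).ge.trans hle

end OrbitProcess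

/-! ### Exactness -/

section Exactness

variable {X : ℕ → Type*} [∀ j, MeasurableSpace (X j)] {m : ∀ j, Measure (X j)}
  {var : ∀ j, (X j → ℝ) → ℝ≥0∞} {T : ∀ j, X j → X (j + 1)}

theorem CenteredLE.transferIter_iterate {R γ : ℝ≥0} {n : ℕ}
    (hcontract : ∀ j (φ : X j → ℝ) (s : ℝ≥0), CenteredLE m var T R j φ s →
      CenteredLE m var T R (j + n) (transferIter m T (Nat.le_add_right j n) φ) (γ * s))
    {j : ℕ} {φ : X j → ℝ} {s : ℝ≥0} (h : CenteredLE m var T R j φ s) (i : ℕ) {k : ℕ}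
    (hk : k = j + i * n) (hjk : j ≤ k) :
    CenteredLE m var T R k (transferIter m T hjk φ) (γ ^ i * s) := by
  induction i generalizing k with
  | zero =>
    obtain rfl : k = j := by simpa using hk
    simpa using h
  | succ i ih =>
    obtain rfl : k = j + i * n + n := by rw [hk, Nat.succ_mul, Nat.add_assoc]
    have hstep := hcontract _ _ _ (ih rfl (Nat.le_add_right j (i * n)))
    rwa [← transferIter_trans, ← mul_assoc, ← pow_succ'] at hstep

variable [∀ j, IsProbabilityMeasure (m j)]

theorem IsAdmissible.exists_abs_integral_mul_comp_orbit_le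
    (hT : ∀ j, Measure.QuasiMeasurePreserving (T j) (m j) (m (j + 1)))
    (hv : IsVariation m var) (hadm : IsAdmissible m var T) :
    ∃ (n : ℕ) (γ : ℝ≥0), 1 ≤ n ∧ γ < 1 ∧ ∀ g : X 0 → ℝ, MemB (m 0) (var 0) g →
      ∫ x, g x ∂(m 0) = 0 → ∃ s : ℝ≥0, ∀ (i : ℕ) (ψ : X (i * n) → ℝ), MemLp ψ ∞ (m (i * n)) →
        |∫ x, g x * ψ (orbit T (Nat.zero_le (i * n)) x) ∂(m 0)| ≤
          γ ^ i * s * ∫ x, |ψ (orbit T (Nat.zero_le (i * n)) x)| ∂(m 0) := by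
  obtain ⟨C, hC⟩ := hv.exists_isVarConst
  obtain ⟨R, n, γ, hR, hn, hγ, hcontract⟩ := hadm.exists_contraction hT hv hC
  refine ⟨n, γ, hn, hγ, fun g hg hg0 => ?_⟩
  obtain ⟨s, hs⟩ : ∃ s, CenteredLE m var T R 0 g s :=
    ⟨_, .of_bNormLE hC one_pos hR (by simp [dens_zero]) (BNormLE.of_memB hg) hg0⟩
  refine ⟨s, fun i ψ hψ => ?_⟩
  rw [← integral_transferIter_mul hT (Nat.zero_le (i * n)) hg.1 hψ]
  exact_mod_cast (hs.transferIter_iterate hcontract i (Nat.zero_add _).symm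
    (Nat.zero_le _)).abs_integral_mul_le hT hψ

theorem IsAdmissible.integral_mul_eq_zero_of_tendsto_alongOrbit
    (hT : ∀ j, Measure.QuasiMeasurePreserving (T j) (m j) (m (j + 1)))
    (hv : IsVariation m var) (hadm : IsAdmissible m var T) {y : ∀ n, X n → ℝ} {D : ℝ}
    (hy : ∀ n, Measurable (y n)) (hyD : ∀ n x, |y n x| ≤ D) {f : X 0 → ℝ}
    (hf : ∀ᵐ x ∂(m 0), Tendsto (fun n => alongOrbit T y n x) atTop (𝓝 (f x)))
    {g : X 0 → ℝ} (hg : MemB (m 0) (var 0) g) (hg0 : ∫ x, g x ∂(m 0) = 0) :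
    ∫ x, g x * f x ∂(m 0) = 0 := by
  obtain ⟨n, γ, hn, hγ, hdecay⟩ := hadm.exists_abs_integral_mul_comp_orbit_le hT hv
  obtain ⟨s, hs⟩ := hdecay g hg hg0
  have hmeas (k : ℕ) : Measurable (alongOrbit T y k) :=
    (hy k).comp (quasiMeasurePreserving_orbit hT (Nat.zero_le k)).measurable
  have hlim : Tendsto (fun k => ∫ x, g x * alongOrbit T y k x ∂(m 0)) atTop
      (𝓝 (∫ x, g x * f x ∂(m 0))) := by
    refine tendsto_integral_of_dominated_convergence (fun x => |g x| * D)
      (fun k => hg.1.1.mul (hmeas k).aestronglyMeasurable) (hg.1.abs.mul_const D)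
      (fun k => .of_forall fun x => ?_) (hf.mono fun x hx => hx.const_mul _)
    rw [norm_mul]
    exact mul_le_mul_of_nonneg_left (hyD k _) (abs_nonneg _)
  have hgeom : Tendsto (fun i : ℕ => (γ : ℝ) ^ i * s * D) atTop (𝓝 0) := by
    simpa using ((tendsto_pow_atTop_nhds_zero_of_lt_one γ.2 (by exact_mod_cast hγ)).mul_const
      (s : ℝ)).mul_const D
  refine tendsto_nhds_unique (hlim.comp (tendsto_id.atTop_mul_const' hn))
    (squeeze_zero_norm (fun i => (hs i (y (i * n))
      (memLp_top_of_bound (hy _).aestronglyMeasurable D (.of_forall (hyD _)))).trans ?_) hgeom)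
  refine mul_le_mul_of_nonneg_left ?_ (by positivity)
  simpa using integral_mono_of_nonneg (μ := m 0) (.of_forall fun _ => abs_nonneg _)
    (integrable_const D) (.of_forall fun x => hyD (i * n) (orbit T (Nat.zero_le (i * n)) x))

theorem IsVariation.integral_mul_eq_zero (hv : IsVariation m var) {j : ℕ} {k : X j → ℝ} {D : ℝ}
    (hk : AEStronglyMeasurable k (m j)) (hkD : ∀ᵐ x ∂(m j), |k x| ≤ D)
    (horth : ∀ g : X j → ℝ, MemB (m j) (var j) g → ∫ x, g x * k x ∂(m j) = 0) {f : X j → ℝ}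
    (hf : Integrable f (m j)) : ∫ x, f x * k x ∂(m j) = 0 := by
  have hk_top : MemLp k ∞ (m j) := memLp_top_of_bound hk D hkD
  have hbound (ε : ℝ≥0) (hε : 0 < ε) : |∫ x, f x * k x ∂(m j)| ≤ ε * D := by
    obtain ⟨g, hg, hfg⟩ := hv.dense j f hf ε hε
    have hsub : Integrable (fun x => f x - g x) (m j) := hf.sub hg.1
    rw [eLpNorm_one_eq_lintegral_enorm, ← ofReal_integral_norm_eq_lintegral_enorm hsub,
      ENNReal.ofReal_le_coe] at hfg
    obtain ⟨x₀, hx₀⟩ := hkD.exists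
    calc |∫ x, f x * k x ∂(m j)| = |∫ x, (f x - g x) * k x ∂(m j)| := by
          have hfk : Integrable (fun x => f x * k x) (m j) := hf.mul_of_top_left hk_top
          have hgk : Integrable (fun x => g x * k x) (m j) := hg.1.mul_of_top_left hk_top
          simp only [sub_mul]
          rw [integral_sub hfk hgk, horth g hg, sub_zero]
      _ ≤ ∫ x, |f x - g x| * D ∂(m j) := by
          refine abs_integral_le_integral_abs.trans (integral_mono_ae
            (hsub.mul_of_top_left hk_top).abs (hsub.abs.mul_const D) ?_)
          filter_upwards [hkD] with x hx
          rw [abs_mul]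
          exact mul_le_mul_of_nonneg_left hx (abs_nonneg _)
      _ ≤ ε * D := by
          rw [integral_mul_const]
          exact mul_le_mul_of_nonneg_right hfg ((abs_nonneg _).trans hx₀)
  have hlim : Tendsto (fun ε : ℝ≥0 => (ε : ℝ) * D) (𝓝[>] 0) (𝓝 0) := by
    have hcont : Continuous fun ε : ℝ≥0 => (ε : ℝ) * D := by fun_prop
    simpa using (hcont.tendsto 0).mono_left nhdsWithin_le_nhds
  exact abs_nonpos_iff.1 (ge_of_tendsto hlim (eventually_nhdsWithin_of_forall hbound))

theorem IsAdmissible.ae_eq_integral_of_tendsto_alongOrbit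
    (hT : ∀ j, Measure.QuasiMeasurePreserving (T j) (m j) (m (j + 1)))
    (hv : IsVariation m var) (hadm : IsAdmissible m var T) {y : ∀ n, X n → ℝ} {D : ℝ}
    (hy : ∀ n, Measurable (y n)) (hyD : ∀ n x, |y n x| ≤ D) {f : X 0 → ℝ}
    (hf : ∀ᵐ x ∂(m 0), Tendsto (fun n => alongOrbit T y n x) atTop (𝓝 (f x))) :
    ∀ᵐ x ∂(m 0), f x = ∫ z, f z ∂(m 0) := by
  set e := ∫ z, f z ∂(m 0)
  have hfm : AEStronglyMeasurable f (m 0) := aestronglyMeasurable_of_tendsto_ae atTop (fun n =>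
    ((hy n).comp (quasiMeasurePreserving_orbit hT n.zero_le).measurable).aestronglyMeasurable) hf
  have hfD : ∀ᵐ x ∂(m 0), |f x| ≤ D := hf.mono fun x hx =>
    le_of_tendsto hx.abs (.of_forall fun n => hyD n _)
  have hf_top : MemLp f ∞ (m 0) := memLp_top_of_bound hfm D hfD
  have hfi : Integrable f (m 0) := hf_top.integrable le_top
  have horth (g : X 0 → ℝ) (hg : MemB (m 0) (var 0) g) :
      ∫ x, g x * (f x - e) ∂(m 0) = 0 := by
    obtain ⟨a, hone⟩ := hv.exists_bNormLE_one 0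
    set a' := ∫ z, g z ∂(m 0) with ha'
    have hgB : MemB (m 0) (var 0) fun x => g x - a' * 1 :=
      ((BNormLE.of_memB hg).sub hv (hone.const_mul hv a')).memB
    have hzero := hadm.integral_mul_eq_zero_of_tendsto_alongOrbit hT hv hy hyD hf hgB (by
      rw [integral_sub hg.1 (integrable_const _)]; simp [ha'])
    have hgf : Integrable (fun x => g x * f x) (m 0) := hg.1.mul_of_top_left hf_top
    simp only [sub_mul, mul_sub, mul_one] at hzero ⊢
    rw [integral_sub hgf (hfi.const_mul _), integral_const_mul] at hzero
    rw [integral_sub hgf (hg.1.mul_const _), integral_mul_const, hzero]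
  have hsub : Integrable (fun x => f x - e) (m 0) := hfi.sub (integrable_const e)
  have hsubD : ∀ᵐ x ∂(m 0), |f x - e| ≤ D + |e| := hfD.mono fun x hx =>
    (abs_sub _ _).trans (by gcongr)
  have hsq := hv.integral_mul_eq_zero hsub.1 hsubD horth hsub
  rw [integral_eq_zero_iff_of_nonneg (fun x => mul_self_nonneg _)
    (hsub.mul_of_top_left (memLp_top_of_bound hsub.1 _ hsubD))] at hsq
  filter_upwards [hsq] with x hx
  exact sub_eq_zero.1 (mul_self_eq_zero.1 hx)

theorem IsAdmissible.exists_ae_eq_const_of_tendsto_alongOrbit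
    (hT : ∀ j, Measure.QuasiMeasurePreserving (T j) (m j) (m (j + 1)))
    (hv : IsVariation m var) (hadm : IsAdmissible m var T) {y : ∀ n, X n → ℝ}
    (hy : ∀ n, Measurable (y n)) {Z : X 0 → ℝ}
    (hZ : ∀ᵐ x ∂(m 0), Tendsto (fun n => alongOrbit T y n x) atTop (𝓝 (Z x))) :
    ∃ κ : ℝ, ∀ᵐ x ∂(m 0), Z x = κ := by
  have harctan := hadm.ae_eq_integral_of_tendsto_alongOrbit hT hv
    (y := fun n x => Real.arctan (y n x)) (D := Real.pi / 2)
    (fun n => Real.measurable_arctan.comp (hy n))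
    (fun n x => abs_le.2 ⟨(Real.neg_pi_div_two_lt_arctan _).le, (Real.arctan_lt_pi_div_two _).le⟩)
    (hZ.mono fun x hx => (Real.continuous_arctan.tendsto _).comp hx)
  exact ⟨_, harctan.mono fun x hx => (Real.tan_arctan (Z x)).symm.trans (congrArg Real.tan hx)⟩

end Exactness

section OrbitSum

variable {X : ℕ → Type*} {T : ∀ j, X j → X (j + 1)}

theorem apply_orbit_congr (g : ∀ k, X k → ℝ) {j a b : ℕ} (hab : a = b) (ha : j ≤ a) (hb : j ≤ b)
    (x : X j) : g a (orbit T ha x) = g b (orbit T hb x) := by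
  subst hab; rfl

theorem apply_orbit_add_zero (g : ∀ k, X k → ℝ) (j : ℕ) (x : X j) :
    g (j + 0) (orbit T (Nat.le_add_right j 0) x) = g j x :=
  congrArg (g j) (orbit_self T (Nat.le_refl j) x)

theorem apply_orbit_add_succ (g : ∀ k, X k → ℝ) (j i : ℕ) (x : X j) :
    g (j + (i + 1)) (orbit T (Nat.le_add_right j (i + 1)) x) =
      g (j + 1 + i) (orbit T (Nat.le_add_right (j + 1) i) (T j x)) := by
  rw [← orbit_succ_left T (by lia : j ≤ j + 1 + i)]
  exact apply_orbit_congr g (by lia) _ _ x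

variable {M y : ∀ j, X j → ℝ}

theorem sum_range_alongOrbit_add {x : X 0}
    (hx : ∀ k, alongOrbit T M k x = alongOrbit T y (k + 1) x - alongOrbit T y k x) (n N : ℕ) :
    ∑ i ∈ Finset.range N, alongOrbit T M (n + i) x =
      alongOrbit T y (n + N) x - alongOrbit T y n x := by
  simp only [hx]
  exact Finset.sum_range_sub (fun i => alongOrbit T y (n + i) x) N

variable [∀ j, MeasurableSpace (X j)] {m : ∀ j, Measure (X j)}

theorem ae_alongOrbit_eq_sub
    (hT : ∀ j, Measure.QuasiMeasurePreserving (T j) (m j) (m (j + 1)))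
    (hMy : ∀ j, ∀ᵐ x ∂(m j), M j x = y (j + 1) (T j x) - y j x) :
    ∀ᵐ x ∂(m 0), ∀ k, alongOrbit T M k x = alongOrbit T y (k + 1) x - alongOrbit T y k x := by
  refine ae_all_iff.2 fun k => ?_
  filter_upwards [(quasiMeasurePreserving_orbit hT (Nat.zero_le k)).ae (hMy k)] with x hx
  rw [alongOrbit, alongOrbit, orbit_succ T (Nat.zero_le k), hx]

theorem ae_tendsto_sum_orbit_of_succ
    (hT : ∀ j, Measure.QuasiMeasurePreserving (T j) (m j) (m (j + 1))) {n : ℕ}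
    (hMy : ∀ᵐ x ∂(m n), M n x = y (n + 1) (T n x) - y n x) {κ : ℝ}
    (hsucc : ∀ᵐ x ∂(m (n + 1)), Tendsto
      (fun N => ∑ i ∈ Finset.range N, M (n + 1 + i) (orbit T (Nat.le_add_right (n + 1) i) x))
      atTop (𝓝 (κ - y (n + 1) x))) :
    ∀ᵐ x ∂(m n), Tendsto
      (fun N => ∑ i ∈ Finset.range N, M (n + i) (orbit T (Nat.le_add_right n i) x))
      atTop (𝓝 (κ - y n x)) := by
  filter_upwards [(hT n).ae hsucc, hMy] with x hx hxM
  rw [← tendsto_add_atTop_iff_nat 1]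
  simp only [Finset.sum_range_succ', apply_orbit_add_succ M, apply_orbit_add_zero M]
  convert hx.add_const (M n x) using 2
  rw [hxM]
  ring

variable [∀ j, IsProbabilityMeasure (m j)]

theorem absolutelyContinuous_map_orbit
    (hT : ∀ j, Measure.QuasiMeasurePreserving (T j) (m j) (m (j + 1))) {n : ℕ}
    (hd : ∀ᵐ x ∂(m n), 0 < dens T m n x) : m n ≪ (m 0).map (orbit T (Nat.zero_le n)) := by
  have horbit := (quasiMeasurePreserving_orbit hT (Nat.zero_le n)).measurable
  refine Measure.AbsolutelyContinuous.mk fun A hA hA0 => ?_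
  rw [Measure.map_apply horbit hA] at hA0
  have hint : Integrable (fun y => dens T m n y * A.indicator (fun _ => (1 : ℝ)) y) (m n) :=
    (dens_integrable n).mul_of_top_left (memLp_top_indicator hA)
  have hzero := integral_dens_mul hT n (memLp_top_indicator (ν := m n) hA)
  have hzero₀ : ∫ x, A.indicator (fun _ => (1 : ℝ)) (orbit T (Nat.zero_le n) x) ∂(m 0) = 0 :=
    integral_eq_zero_of_ae ((measure_eq_zero_iff_ae_notMem.1 hA0).mono fun x hx =>
      Set.indicator_of_notMem (s := A) hx _)
  rw [hzero₀, integral_eq_zero_iff_of_nonneg_ae (hd.mono fun x hx =>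
      mul_nonneg hx.le (Set.indicator_nonneg (fun _ _ => zero_le_one) _)) hint] at hzero
  refine measure_eq_zero_iff_ae_notMem.2 ?_
  filter_upwards [hzero, hd] with x hx hdx hxA
  simp only [Set.indicator_of_mem hxA, mul_one, Pi.zero_apply] at hx
  exact hdx.ne' hx

theorem ae_tendsto_sum_orbit_of_dens_pos
    (hT : ∀ j, Measure.QuasiMeasurePreserving (T j) (m j) (m (j + 1)))
    (hM : ∀ j, Measurable (M j)) (hy : ∀ j, Measurable (y j))
    (hMy : ∀ j, ∀ᵐ x ∂(m j), M j x = y (j + 1) (T j x) - y j x) {n : ℕ}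
    (hd : ∀ᵐ x ∂(m n), 0 < dens T m n x) {κ : ℝ}
    (hκ : ∀ᵐ x ∂(m 0), Tendsto (fun k => alongOrbit T y k x) atTop (𝓝 κ)) :
    ∀ᵐ x ∂(m n), Tendsto
      (fun N => ∑ i ∈ Finset.range N, M (n + i) (orbit T (Nat.le_add_right n i) x))
      atTop (𝓝 (κ - y n x)) := by
  have horbit {j k : ℕ} (h : j ≤ k) := (quasiMeasurePreserving_orbit hT h).measurable
  refine (absolutelyContinuous_map_orbit hT hd).ae_le
    ((ae_map_iff (horbit _).aemeasurable (measurableSet_tendsto_fun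
      (fun N => Finset.measurable_sum _ fun i _ => (hM _).comp (horbit _))
      ((hy n).const_sub κ))).2 ?_)
  filter_upwards [ae_alongOrbit_eq_sub hT hMy, hκ] with x hx hxκ
  refine ((hxκ.comp (tendsto_atTop_mono (Nat.le_add_left · n) tendsto_id)).sub_const _).congr
    fun N => ?_
  rw [Function.comp_apply, ← sum_range_alongOrbit_add hx]
  exact Finset.sum_congr rfl fun i _ => congrArg (M (n + i)) (orbit_trans T _ _ _ x)

theorem ae_tendsto_sum_orbit
    (hT : ∀ j, Measure.QuasiMeasurePreserving (T j) (m j) (m (j + 1)))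
    (hM : ∀ j, Measurable (M j)) (hy : ∀ j, Measurable (y j))
    (hMy : ∀ j, ∀ᵐ x ∂(m j), M j x = y (j + 1) (T j x) - y j x) {n₀ : ℕ}
    (hd : ∀ j ≥ n₀, ∀ᵐ x ∂(m j), 0 < dens T m j x) {κ : ℝ}
    (hκ : ∀ᵐ x ∂(m 0), Tendsto (fun k => alongOrbit T y k x) atTop (𝓝 κ)) (n : ℕ) :
    ∀ᵐ x ∂(m n), Tendsto
      (fun N => ∑ i ∈ Finset.range N, M (n + i) (orbit T (Nat.le_add_right n i) x))
      atTop (𝓝 (κ - y n x)) := by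
  rcases le_total n₀ n with hn | hn
  · exact ae_tendsto_sum_orbit_of_dens_pos hT hM hy hMy (hd n hn) hκ
  · induction hn using Nat.decreasingInduction with
    | self => exact ae_tendsto_sum_orbit_of_dens_pos hT hM hy hMy (hd n₀ le_rfl) hκ
    | of_succ n _ ih => exact ae_tendsto_sum_orbit_of_succ hT (hMy n) ih

end OrbitSum

section Remainder

variable {Ω : Type*} [mΩ : MeasurableSpace Ω] {P : Measure Ω} {ξ : ℕ → Ω → ℝ} {S : Ω → ℝ}
  {h u : ℕ → Ω → ℝ} {q : ℕ → ℝ}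

theorem IsPsumLimit.ae_tendsto_sub (hS : IsPsumLimit P ξ S)
    (hhu : ∀ᵐ ω ∂P, ∀ n, h n ω - u n ω - q n = psum ξ n ω - S ω) :
    ∀ᵐ ω ∂P, Tendsto (fun n => h n ω - u n ω - q n) atTop (𝓝 0) := by
  filter_upwards [hhu, hS.tendsto] with ω hω hlim
  simpa [hω] using hlim.sub_const (S ω)

theorem IsPsumLimit.tendsto_eLpNorm_sub (hS : IsPsumLimit P ξ S)
    (hhu : ∀ᵐ ω ∂P, ∀ n, h n ω - u n ω - q n = psum ξ n ω - S ω) {p : ℝ≥0∞} (hp1 : 1 ≤ p)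
    (hp : p ≠ ∞) : Tendsto (fun n => eLpNorm (fun ω => h n ω - u n ω - q n) p P) atTop (𝓝 0) :=
  (hS.tendsto_eLpNorm p hp1 hp).congr fun n =>
    eLpNorm_congr_ae (hhu.mono fun _ hω => (hω n).symm)

variable [IsProbabilityMeasure P] {𝓖 : ℕ → MeasurableSpace Ω} {D : ℝ}

theorem IsRevMartDiff.memLp_psum (hξ : IsRevMartDiff P 𝓖 ξ D) (n : ℕ) (p : ℝ≥0∞) :
    MemLp (psum ξ n) p P :=
  (hξ.bddMeas_psum n).memLp_top.mono_exponent le_top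

theorem IsRevMartDiff.integral_psum (hξ : IsRevMartDiff P 𝓖 ξ D) (n : ℕ) :
    ∫ ω, psum ξ n ω ∂P = 0 := by
  simpa using hξ.integral_psum_mul (n := n) (BddMeas.const 1)

theorem IsPsumLimit.integral_eq_zero (hS : IsPsumLimit P ξ S) (hξ : IsRevMartDiff P 𝓖 ξ D) :
    ∫ ω, S ω ∂P = 0 := by
  have hlim := tendsto_integral_of_L1' S (hS.memLp 1 le_rfl ENNReal.one_ne_top).1
    (.of_forall fun n => memLp_one_iff_integrable.1 (hξ.memLp_psum n 1))
    (hS.tendsto_eLpNorm 1 le_rfl ENNReal.one_ne_top)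
  simp only [hξ.integral_psum] at hlim
  exact tendsto_nhds_unique hlim tendsto_const_nhds

theorem IsPsumLimit.integral_eq (hS : IsPsumLimit P ξ S) (hξ : IsRevMartDiff P 𝓖 ξ D)
    (hu : ∀ n, Integrable (u n) P) (hu0 : ∀ n, ∫ ω, u n ω ∂P = 0)
    (hhu : ∀ᵐ ω ∂P, ∀ n, h n ω - u n ω - q n = psum ξ n ω - S ω) (n : ℕ) :
    ∫ ω, h n ω ∂P = q n := by
  have hpsum := memLp_one_iff_integrable.1 (hξ.memLp_psum n 1)
  have hSint := memLp_one_iff_integrable.1 (hS.memLp 1 le_rfl ENNReal.one_ne_top)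
  have hdiff : Integrable (fun ω => psum ξ n ω - S ω) P := hpsum.sub hSint
  have heq : h n =ᵐ[P] fun ω => psum ξ n ω - S ω + u n ω + q n := by
    filter_upwards [hhu] with ω hω
    linarith [hω n]
  rw [integral_congr_ae heq, integral_add (hdiff.fun_add (hu n)) (integrable_const _),
    integral_add hdiff (hu n), integral_sub hpsum hSint, hξ.integral_psum,
    hS.integral_eq_zero hξ, hu0]
  simp

theorem IsPsumLimit.memLp_of_sub_eq (hS : IsPsumLimit P ξ S) (hξ : IsRevMartDiff P 𝓖 ξ D)
    (hhu : ∀ᵐ ω ∂P, ∀ n, h n ω - u n ω - q n = psum ξ n ω - S ω) {n : ℕ} {p : ℝ≥0∞}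
    (hu : MemLp (u n) p P) (hp1 : 1 ≤ p) (hp : p ≠ ∞) : MemLp (h n) p P := by
  refine ((((hξ.memLp_psum n p).sub (hS.memLp p hp1 hp)).add hu).add
    (memLp_const (q n))).ae_eq ?_
  filter_upwards [hhu] with ω hω
  simp only [Pi.add_apply, Pi.sub_apply]
  linarith [hω n]

theorem IsPsumLimit.exists_eLpNorm_sub_le (hS : IsPsumLimit P ξ S) (hξ : IsRevMartDiff P 𝓖 ξ D)
    (hhu : ∀ᵐ ω ∂P, ∀ n, h n ω - u n ω - q n = psum ξ n ω - S ω) {p : ℝ≥0∞} {b : ℝ≥0}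
    (hu : ∀ n, MemLp (u n) p P) (hub : ∀ n, eLpNorm (u n) p P ≤ b) (hp1 : 1 ≤ p) (hp : p ≠ ∞) :
    ∃ K : ℝ≥0, ∀ n, eLpNorm (fun ω => h n ω - q n) p P ≤ K := by
  have hSp := hS.memLp p hp1 hp
  obtain ⟨K, hK⟩ := hS.exists_eLpNorm_le p hp1 hp
  refine ⟨K + (eLpNorm S p P).toNNReal + b, fun n => ?_⟩
  have heq : (fun ω => h n ω - q n) =ᵐ[P] psum ξ n - S + u n := by
    filter_upwards [hhu] with ω hω
    simp only [Pi.add_apply, Pi.sub_apply]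
    linarith [hω n]
  have hpsum := hξ.memLp_psum n p
  calc eLpNorm (fun ω => h n ω - q n) p P = eLpNorm (psum ξ n - S + u n) p P :=
        eLpNorm_congr_ae heq
    _ ≤ eLpNorm (psum ξ n - S) p P + eLpNorm (u n) p P :=
        eLpNorm_add_le (hpsum.sub hSp).1 (hu n).1 hp1
    _ ≤ eLpNorm (psum ξ n) p P + eLpNorm S p P + eLpNorm (u n) p P := by
        gcongr
        exact eLpNorm_sub_le hpsum.1 hSp.1 hp1
    _ ≤ K + eLpNorm S p P + b := by gcongr <;> [exact hK n; exact hub n]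
    _ = _ := by push_cast; rw [ENNReal.coe_toNNReal hSp.2.ne]

end Remainder

/-! ### Coboundaries -/

section Coboundary

variable {X : ℕ → Type*} [∀ j, MeasurableSpace (X j)] {m : ∀ j, Measure (X j)}
  {var : ∀ j, (X j → ℝ) → ℝ≥0∞} {T : ∀ j, X j → X (j + 1)}

theorem IsMartingaleCoboundary.ae_eq_sub {F H U M : ∀ j, X j → ℝ} {a : ℕ → ℝ} {n₀ : ℕ}
    (hUM : IsMartingaleCoboundary m T (fun j x => F j x - a j) U M n₀)
    (hFH : ∀ j, ∀ᵐ x ∂(m j), F j x = H (j + 1) (T j x) - H j x) (j : ℕ) :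
    ∀ᵐ x ∂(m j), M j x =
      (H (j + 1) (T j x) - U (j + 1) (T j x) - ∑ k ∈ Finset.range (j + 1), a k) -
        (H j x - U j x - ∑ k ∈ Finset.range j, a k) := by
  filter_upwards [hUM.eq j, hFH j] with x hx hxH
  rw [Finset.sum_range_succ]
  linarith

variable [∀ j, IsProbabilityMeasure (m j)]

theorem IsAdmissible.exists_isPsumLimit_of_coboundary
    (hT : ∀ j, Measure.QuasiMeasurePreserving (T j) (m j) (m (j + 1)))
    (hv : IsVariation m var) (hadm : IsAdmissible m var T) {M y : ∀ j, X j → ℝ} {D s : ℝ}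
    (hM : IsRevMartDiff (m 0) (orbitAlgebra T) (alongOrbit T M) D)
    (hvar : CondVarDefectLE (m 0) (orbitAlgebra T) (alongOrbit T M) s)
    (hy : ∀ n, Measurable (y n))
    (hMy : ∀ j, ∀ᵐ x ∂(m j), M j x = y (j + 1) (T j x) - y j x) :
    ∃ (S : X 0 → ℝ) (κ : ℝ), IsPsumLimit (m 0) (alongOrbit T M) S ∧
      (∀ᵐ x ∂(m 0), Tendsto (fun n => alongOrbit T y n x) atTop (𝓝 κ)) ∧
      ∀ᵐ x ∂(m 0), ∀ n, alongOrbit T y n x - κ = psum (alongOrbit T M) n x - S x := by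
  have hpsum : ∀ᵐ x ∂(m 0), ∀ n,
      psum (alongOrbit T M) n x = alongOrbit T y n x - alongOrbit T y 0 x := by
    filter_upwards [ae_alongOrbit_eq_sub hT hMy] with x hx n
    simp only [psum, hx]
    exact Finset.sum_range_sub (fun k => alongOrbit T y k x) n
  obtain ⟨S, hS⟩ := hM.exists_isPsumLimit hvar
    (G := alongOrbit T y 0) (Y := alongOrbit T y)
    ((hy 0).comp (quasiMeasurePreserving_orbit hT (Nat.zero_le 0)).measurable)
    (fun n => (hy n).comp (comap_measurable _))
    fun n => hpsum.mono fun x hx => by rw [hx n, sub_sub_cancel]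
  have hlim : ∀ᵐ x ∂(m 0), Tendsto (fun n => alongOrbit T y n x) atTop
      (𝓝 (S x + alongOrbit T y 0 x)) := by
    filter_upwards [hS.tendsto, hpsum] with x hxS hx
    refine (hxS.add_const (alongOrbit T y 0 x)).congr fun n => ?_
    rw [hx n, sub_add_cancel]
  obtain ⟨κ, hκ⟩ := hadm.exists_ae_eq_const_of_tendsto_alongOrbit hT hv hy hlim
  refine ⟨S, κ, hS, ?_, ?_⟩
  · filter_upwards [hlim, hκ] with x hx hxκ
    rwa [hxκ] at hx
  · filter_upwards [hpsum, hκ] with x hx hxκ n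
    rw [hx n, ← hxκ]
    ring

theorem IsAdmissible.exists_isPsumLimit_of_isMartingaleCoboundary
    (hT : ∀ j, Measure.QuasiMeasurePreserving (T j) (m j) (m (j + 1)))
    (hv : IsVariation m var) (hadm : IsAdmissible m var T) {c : ℝ≥0} {n₀ : ℕ} (hc : 0 < c)
    (hd : ∀ j ≥ n₀, ∀ᵐ x ∂(m j), (c : ℝ) ≤ dens T m j x) {F H U M : ∀ j, X j → ℝ} {a : ℕ → ℝ}
    {B : ℝ≥0} (hU : ∀ j, IsBoundedRep m var j (U j) B) (hM : ∀ j, IsBoundedRep m var j (M j) B)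
    (hUM : IsMartingaleCoboundary m T (fun j x => F j x - a j) U M n₀)
    (hH : ∀ j, Measurable (H j)) (hFH : ∀ j, ∀ᵐ x ∂(m j), F j x = H (j + 1) (T j x) - H j x) :
    ∃ S : X 0 → ℝ, IsPsumLimit (m 0) (alongOrbit T M) S ∧
      (∀ᵐ x ∂(m 0), ∀ n, alongOrbit T H n x - alongOrbit T U n x - ∫ y, alongOrbit T H n y ∂(m 0) =
        psum (alongOrbit T M) n x - S x) ∧
      ∀ n, ∀ᵐ x ∂(m n), Tendsto
        (fun N => ∑ i ∈ Finset.range N, M (n + i) (orbit T (Nat.le_add_right n i) x)) atTop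
        (𝓝 ((∫ y, alongOrbit T H n y ∂(m 0)) + U n x - H n x)) := by
  have hrev := hUM.isRevMartDiff hT hM
  obtain ⟨s, hs⟩ := hadm.exists_condVarDefectLE hT hv hc hd hM hUM.eq_zero
  set y : ∀ n, X n → ℝ := fun n x => H n x - U n x - ∑ k ∈ Finset.range n, a k with hy_def
  have hy : ∀ n, Measurable (y n) := fun n => ((hH n).sub (hU n).measurable).sub_const _
  have hMy := hUM.ae_eq_sub hFH
  obtain ⟨S, κ, hS, hκ, hyS⟩ := hadm.exists_isPsumLimit_of_coboundary hT hv hrev hs hy hMy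
  have hHU : ∀ᵐ x ∂(m 0), ∀ n, alongOrbit T H n x - alongOrbit T U n x -
      (κ + ∑ k ∈ Finset.range n, a k) = psum (alongOrbit T M) n x - S x := by
    filter_upwards [hyS] with x hx n
    rw [← hx n]
    simp only [alongOrbit, hy_def]
    ring
  have hq := hS.integral_eq hrev (fun n => ((hU n).bddMeas_alongOrbit hT).integrable)
    (fun n => hUM.integral_alongOrbit_eq_zero hT (hU n)) hHU
  refine ⟨S, hS, by simpa only [hq] using hHU, fun n => ?_⟩
  have hpos : ∀ j ≥ n₀, ∀ᵐ x ∂(m j), 0 < dens T m j x := fun j hj =>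
    (hd j hj).mono fun _ => (NNReal.coe_pos.2 hc).trans_le
  filter_upwards [ae_tendsto_sum_orbit hT (fun j => (hM j).measurable) hy hMy hpos hκ n] with x hx
  rw [hq]
  convert hx using 2
  simp only [hy_def]
  ring

end Coboundary

end SeqLivsic

theorem mainTheorem2 {X : ℕ → Type*} [∀ j, MeasurableSpace (X j)]
    (m : ∀ j, Measure (X j)) [∀ j, IsProbabilityMeasure (m j)]
    (var : ∀ j, (X j → ℝ) → ℝ≥0∞) (hvar : IsVariation m var)
    (T : ∀ j, X j → X (j + 1))
    (hT : ∀ j, Measure.QuasiMeasurePreserving (T j) (m j) (m (j + 1)))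
    (hcomp : ∃ C : ℝ≥0, ∀ j (h : X (j + 1) → ℝ), Integrable h (m (j + 1)) →
      var (j + 1) h ≤ 1 → var j (fun x => h (T j x)) ≤ C)
    (hadm : IsAdmissible m var T)
    (F : ∀ j, X j → ℝ) (hF : ∀ j, MemB (m j) (var j) (F j))
    (hFbdd : ∃ C : ℝ≥0, ∀ j, bNorm (m j) (var j) (F j) ≤ C)
    (H : ∀ j, X j → ℝ) (hH : ∀ j, Measurable (H j))
    (hFH : ∀ j, ∀ᵐ x ∂(m j), F j x = H (j + 1) (T j x) - H j x) :
    ∃ U M : ∀ j, X j → ℝ,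
      -- the decomposition of `F_j`
      (∀ j, Integrable (fun x => F j (orbit T (Nat.zero_le j) x)) (m 0) ∧
        ∀ᵐ x ∂(m j), F j x =
          (∫ y, F j (orbit T (Nat.zero_le j) y) ∂(m 0)) + U (j + 1) (T j x) - U j x + M j x) ∧
      -- regularity of `U_j` and `M_j`
      (∀ j, MemB (m j) (var j) (U j) ∧ MemB (m j) (var j) (M j)) ∧
      (∃ C : ℝ≥0, ∀ j, bNorm (m j) (var j) (U j) ≤ C) ∧
      (∀ j, Integrable (fun x => U j (orbit T (Nat.zero_le j) x)) (m 0) ∧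
        ∫ x, U j (orbit T (Nat.zero_le j) x) ∂(m 0) = 0) ∧
      (∃ C : ℝ≥0, ∀ j, bNorm (m j) (var j) (M j) ≤ C) ∧
      -- reverse martingale differences
      (∀ j, Integrable (fun x => M j (orbit T (Nat.zero_le j) x)) (m 0) ∧
        (m 0)[fun x => M j (orbit T (Nat.zero_le j) x) |
          MeasurableSpace.comap (orbit T (Nat.zero_le (j + 1))) inferInstance] =ᵐ[m 0] 0) ∧
      -- convergence of the martingale almost surely and in every `L^p`
      (∃ S : X 0 → ℝ,
        (∀ᵐ x ∂(m 0), Tendsto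
          (fun n => ∑ k ∈ Finset.range n, M k (orbit T (Nat.zero_le k) x)) atTop (𝓝 (S x))) ∧
        ∀ p : ℝ≥0∞, 1 ≤ p → p ≠ ∞ → MemLp S p (m 0) ∧
          Tendsto (fun n => eLpNorm
            (fun x => (∑ k ∈ Finset.range n, M k (orbit T (Nat.zero_le k) x)) - S x) p (m 0))
            atTop (𝓝 0)) ∧
      -- moments of `H_n`
      (∀ (n : ℕ) (p : ℝ≥0∞), 1 ≤ p → p ≠ ∞ →
        MemLp (fun x => H n (orbit T (Nat.zero_le n) x)) p (m 0)) ∧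
      (∀ p : ℝ≥0∞, 1 ≤ p → p ≠ ∞ → ∃ C : ℝ≥0, ∀ j,
        eLpNorm (fun x => H j (orbit T (Nat.zero_le j) x) -
          ∫ y, H j (orbit T (Nat.zero_le j) y) ∂(m 0)) p (m 0) ≤ C) ∧
      -- the formula for `H_n`
      (∀ n, ∀ᵐ x ∂(m n), ∃ s : ℝ,
        Tendsto (fun N => ∑ i ∈ Finset.range N, M (n + i) (orbit T (Nat.le_add_right n i) x))
          atTop (𝓝 s) ∧
        H n x = (∫ y, H n (orbit T (Nat.zero_le n) y) ∂(m 0)) + U n x - s) ∧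
      -- the limit of `(H_n - U_n) ∘ T_0^{(n)} - q_n`
      (∀ᵐ x ∂(m 0), Tendsto
        (fun n => H n (orbit T (Nat.zero_le n) x) - U n (orbit T (Nat.zero_le n) x) -
          ∫ y, H n (orbit T (Nat.zero_le n) y) ∂(m 0)) atTop (𝓝 0)) ∧
      (∀ p : ℝ≥0∞, 1 ≤ p → p ≠ ∞ → Tendsto
        (fun n => eLpNorm
          (fun x => H n (orbit T (Nat.zero_le n) x) - U n (orbit T (Nat.zero_le n) x) -
            ∫ y, H n (orbit T (Nat.zero_le n) y) ∂(m 0)) p (m 0)) atTop (𝓝 0)) := by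
  obtain ⟨C, hC⟩ := hvar.exists_isVarConst
  obtain ⟨c, hc⟩ := hcomp
  obtain ⟨b, hb⟩ := hFbdd
  have hFb : ∀ j, BNormLE m var j (F j) b := fun j => ⟨(hF j).1, hb j⟩
  obtain ⟨d, n₀, hd, hdens⟩ := hadm.exists_le_dens hvar
  obtain ⟨U, M, B, hU, hM, hUM⟩ := hadm.exists_isMartingaleCoboundary hT hvar hd hdens hc hFb
  obtain ⟨S, hS, hHU, hH_sum⟩ :=
    hadm.exists_isPsumLimit_of_isMartingaleCoboundary hT hvar hd hdens hU hM hUM hH hFH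
  have hrev := hUM.isRevMartDiff hT hM
  have hUbdd := fun j => (hU j).bddMeas_alongOrbit hT
  have hUp := fun j (p : ℝ≥0∞) => (hUbdd j).memLp_top (μ := m 0) |>.mono_exponent (p := p) le_top
  have hUB : ∀ j p, eLpNorm (alongOrbit T U j) p (m 0) ≤ B := fun j p =>
    eLpNorm_le_of_ae_abs_le (.of_forall fun _ => (hU j).abs_le _) p
  refine ⟨U, M, fun j => ⟨(hFb j).integrable_comp_orbit hT hC, (hUM.eq j).mono fun x hx => ?_⟩,
    fun j => ⟨(hU j).bNormLE.memB, (hM j).bNormLE.memB⟩, ⟨B, fun j => (hU j).bNormLE.2⟩,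
    fun j => ⟨(hUbdd j).integrable, hUM.integral_alongOrbit_eq_zero hT (hU j)⟩,
    ⟨B, fun j => (hM j).bNormLE.2⟩,
    fun j => ⟨(hrev.bddMeas j).integrable, hrev.condExp_ae_eq_zero j⟩,
    ⟨S, hS.tendsto, fun p hp1 hp => ⟨hS.memLp p hp1 hp, hS.tendsto_eLpNorm p hp1 hp⟩⟩,
    fun n p hp1 hp => hS.memLp_of_sub_eq hrev hHU (hUp n p) hp1 hp,
    fun p hp1 hp => hS.exists_eLpNorm_sub_le hrev hHU (hUp · p) (hUB · p) hp1 hp,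
    fun n => (hH_sum n).mono fun x hx => ⟨_, hx, (sub_sub_cancel _ _).symm⟩,
    hS.ae_tendsto_sub hHU, fun p hp1 hp => hS.tendsto_eLpNorm_sub hHU hp1 hp⟩
  linarith
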